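/- Let $d\ge 2$ be an integer. On $L^2(\mathbb{R})$ let $Q$, $P$ be the position and momentum operators, $(e^{-iaP}f)(x)=f(x-a)$, $(e^{iaQ}f)(x)=e^{iax}f(x)$, and let $(M_\alpha f)(x)=\alpha^{-1/2}f(x/\alpha)$ for $\alpha>0$. **States and codes.** For $\kappa,\Delta,\varepsilon>0$ let $\eta_\kappa(x)=\frac{\sqrt\kappa}{\pi^{1/4}}e^{-\kappa^2x^2/2}$ and $\Psi_\Delta(x)=\frac{1}{\pi^{1/4}\sqrt\Delta}e^{-x^2/(2\Delta^2)}$, and let $\Psi^\varepsilon_\Delta$ be the $L^2$-normalized restriction of $\Psi_\Delta$ to $[-\varepsilon,\varepsilon]$. Let $\mathsf{GKP}_{\kappa,\Delta}$ and $\mathsf{GKP}^\varepsilon_{\kappa,\Delta}$ be the $L^2$-normalizations of $\sum_{s\in\mathbb{Z}}\eta_\kappa(s)\Psi_\Delta(\cdot-s)$ and $\sum_{s\in\mathbb{Z}}\eta_\kappa(s)\Psi^\varepsilon_\Delta(\cdot-s)$, respectively. For a state $\Psi$ and $j\in\{0,\dots,d-1\}$ put $\Psi(j)_d=e^{-ij\sqrt{2\pi/d}\,P}M_{\sqrt{2\pi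 d}}\Psi$. For $\kappa\in(0,1/4)$ let $\Delta_\kappa=\kappa/(2\pi d)$, let $$\widetilde{\mathcal{L}}_\kappa=\mathrm{span}\{\mathsf{GKP}_{\kappa,\Delta_\kappa}(j)_d\}_{j=0}^{d-1}\quad\text{and}\quad \mathcal{L}_\kappa=\mathrm{span}\{\mathsf{GKP}^{1/(2d)}_{\kappa,\Delta_\kappa}(j)_d\}_{j=0}^{d-1}$$ be the symmetrically squeezed untruncated and truncated GKP codes. The states spanning $\mathcal{L}_\kappa$ are orthonormal, and $\mathcal{L}_\kappa$ carries the isometric encoding $e_j\mapsto \mathsf{GKP}^{1/(2d)}_{\kappa,\Delta_\kappa}(j)_d$. **Logical gate error.** For a code $\mathcal{L}\subset L^2(\mathbb{R})$ with a unitary encoding map $\mathsf{Enc}:\mathbb{C}^d\to\mathcal{L}$, a unitary $U$ on $\mathbb{C}^d$ and a unitary $W$ on $L^2(\mathbb{R})$, let $$\mathsf{err}_{\mathcal{L}}(W,U)=\big\|(\mathcal{W}-\mathcal{U})\circ\Pi_{\mathcal{L}}\big\|_\diamond,$$ where $\mathcal{W}(\rho)=W\rho W^\dagger$, $\mathcal{U}(\rho)=\bar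 U\rho\bar U^\dagger$ with $\bar U=\mathsf{Enc}\,U\,\mathsf{Enc}^{-1}$ on $\mathcal{L}$, $\Pi_{\mathcal{L}}(\rho)=\pi_{\mathcal{L}}\rho\pi_{\mathcal{L}}$ with $\pi_{\mathcal{L}}$ the orthogonal projection onto $\mathcal{L}$, and $\|\mathcal{E}\|_\diamond=\sup_{n\in\mathbb{N}}\sup_{\|A\|_1\le 1}\|(\mathcal{E}\otimes\mathrm{id}_{\mathcal{B}(\mathbb{C}^n)})(A)\|_1$ with the trace norm $\|X\|_1=\mathrm{tr}\sqrt{X^\dagger X}$. **Statement.** For every $\kappa\in(0,1/4)$ there is an isometric (unitary) encoding $\mathsf{Enc}_{\widetilde{\mathcal{L}}_\kappa}:\mathbb{C}^d\to\widetilde{\mathcal{L}}_\kappa$, not depending on $W$ and $U$, such that the following hold. 1. For all $\kappa\in(0,1/4)$, all unitaries $W$ on $L^2(\mathbb{R})$ and all unitaries $U$ on $\mathbb{C}^d$, $$\mathsf{err}_{\widetilde{\mathcal{L}}_\kappa}(W,U)\le\tfrac52\,\mathsf{err}_{\mathcal{L}_\kappa}(W,U)+20\,d^{3/4}\kappa^{1/4}.$$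 2. For every unitary $U$ on $\mathbb{C}^d$ and all unitaries $W_\kappa$ on $L^2(\mathbb{R})$, $\kappa\in(0,1/4)$: if $\lim_{\kappa\to0}\mathsf{err}_{\mathcal{L}_\kappa}(W_\kappa,U)=0$, then $\lim_{\kappa\to0}\mathsf{err}_{\widetilde{\mathcal{L}}_\kappa}(W_\kappa,U)=0$. 3. Let $X|x\rangle=|x+1 \bmod d\rangle$, $Z|x\rangle=e^{2\pi ix/d}|x\rangle$ and $\mathsf{F}|x\rangle=d^{-1/2}\sum_{y=0}^{d-1}e^{2\pi ixy/d}|y\rangle$, and let $W_X=e^{-i\sqrt{2\pi/d}\,P}$, $W_Z=e^{i\sqrt{2\pi/d}\,Q}$ and $W_{\mathsf{F}}=e^{i\pi(Q^2+P^2)/4}$. Then $$\lim_{\kappa\to0}\mathsf{err}_{\widetilde{\mathcal{L}}_\kappa}(W_X,X)=\lim_{\kappa\to0}\mathsf{err}_{\widetilde{\mathcal{L}}_\kappa}(W_Z,Z)=\lim_{\kappa\to0}\mathsf{err}_{\widetilde{\mathcal{L}}_\kappa}(W_{\mathsf{F}},\mathsf{F})=0.$$ -/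

import Mathlib

noncomputable section

namespace GKP

open MeasureTheory
open scoped ENNReal Real SchwartzMap FourierTransform

/-- The trace of a positive operator, as the supremum of its partial traces. -/
def posTrace {H : Type*} [NormedAddCommGroup H] [InnerProductSpace ℂ H]
    (T : H →L[ℂ] H) : ℝ≥0∞ :=
  ⨆ (n : ℕ) (e : Fin n → H) (_ : Orthonormal ℂ e),
    ∑ i, ENNReal.ofReal (RCLike.re (inner ℂ (e i) (T (e i))))

/-- The trace norm `‖X‖₁ = tr |X|`, `|X| = √(X† X)`; it is `∞` if `X` is not trace class. -/
def traceNorm {H : Type*} [NormedAddCommGroup H] [InnerProductSpace ℂ H] [CompleteSpace H]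
    (X : H →L[ℂ] H) : ℝ≥0∞ :=
  posTrace (CFC.abs X)

/-- The map `ρ ↦ V ρ V†`. -/
def conjMap {H K : Type*} [NormedAddCommGroup H] [InnerProductSpace ℂ H] [CompleteSpace H]
    [NormedAddCommGroup K] [InnerProductSpace ℂ K] [CompleteSpace K] (V : H →L[ℂ] K) :
    (H →L[ℂ] H) →ₗ[ℂ] (K →L[ℂ] K) where
  toFun ρ := V ∘L ρ ∘L ContinuousLinearMap.adjoint V
  map_add' := by intros; ext; simp
  map_smul' := by intros; ext; simp

/-- The Hilbert space `H ⊗ ℂⁿ`, as the orthogonal sum of `n` copies of `H`. -/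
abbrev Amp (H : Type*) (n : ℕ) : Type _ := PiLp 2 (fun _ : Fin n => H)

/-- The operator `1 ⊗ ⟨a|` from `H ⊗ ℂⁿ` to `H`. -/
def slot {H : Type*} [NormedAddCommGroup H] [InnerProductSpace ℂ H] (n : ℕ) (a : Fin n) :
    Amp H n →L[ℂ] H := PiLp.proj 2 (fun _ : Fin n => H) a

/-- The map `E ⊗ id` on the operators on `H ⊗ ℂⁿ`: `E` acts on each of the `n × n` blocks. -/
def amplify {H K : Type*} [NormedAddCommGroup H] [InnerProductSpace ℂ H] [CompleteSpace H]
    [NormedAddCommGroup K] [InnerProductSpace ℂ K] [CompleteSpace K]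
    (E : (H →L[ℂ] H) →ₗ[ℂ] (K →L[ℂ] K)) (n : ℕ) (A : Amp H n →L[ℂ] Amp H n) :
    Amp K n →L[ℂ] Amp K n :=
  ∑ a : Fin n, ∑ b : Fin n,
    ContinuousLinearMap.adjoint (slot n a) ∘L
      E (slot n a ∘L A ∘L ContinuousLinearMap.adjoint (slot n b)) ∘L slot n b

/-- The diamond norm `sup_n ‖E ⊗ id_{B(ℂⁿ)}‖₁`, where `‖·‖₁` is the norm induced by the trace norm. -/
def diamondNorm {H K : Type*} [NormedAddCommGroup H] [InnerProductSpace ℂ H] [CompleteSpace H]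
    [NormedAddCommGroup K] [InnerProductSpace ℂ K] [CompleteSpace K]
    (E : (H →L[ℂ] H) →ₗ[ℂ] (K →L[ℂ] K)) : ℝ≥0∞ :=
  ⨆ (n : ℕ) (A : Amp H n →L[ℂ] Amp H n) (_ : traceNorm A ≤ 1), traceNorm (amplify E n A)

/-- The operator `Enc U Dec` on the code space `L` for a logical operator `U`, with `Dec = Enc⁻¹`. -/
def logicalOp {H : Type*} [NormedAddCommGroup H] [InnerProductSpace ℂ H] {d : ℕ}
    {L : Submodule ℂ H} (enc : EuclideanSpace ℂ (Fin d) ≃ₗᵢ[ℂ] L)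
    (U : Matrix (Fin d) (Fin d) ℂ) : L →L[ℂ] L :=
  (enc : EuclideanSpace ℂ (Fin d) →L[ℂ] L) ∘L
    Matrix.toEuclideanCLM (𝕜 := ℂ) U ∘L (enc.symm : L →L[ℂ] EuclideanSpace ℂ (Fin d))

/-- The logical gate error `‖(𝒲 - 𝒰) ∘ Π_L‖_⋄` of the implementation `W` of the logical gate `U` on the
code `L`, where `𝒲(ρ) = W ρ W†`, `𝒰(ρ) = (Enc U Dec) ρ (Enc U Dec)†` for operators `ρ` on `L`, and
`Π_L(ρ) = π_L ρ π_L` with `π_L` the orthogonal projection onto `L`. -/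
def logicalError {H : Type*} [NormedAddCommGroup H] [InnerProductSpace ℂ H] [CompleteSpace H]
    {d : ℕ} {L : Submodule ℂ H} (enc : EuclideanSpace ℂ (Fin d) ≃ₗᵢ[ℂ] L)
    (W : H ≃ₗᵢ[ℂ] H) (U : Matrix (Fin d) (Fin d) ℂ) : ℝ≥0∞ :=
  haveI : FiniteDimensional ℂ L := enc.toLinearEquiv.finiteDimensional
  haveI : CompleteSpace L := FiniteDimensional.complete ℂ L
  diamondNorm
    ((conjMap (W : H →L[ℂ] H) ∘ₗ conjMap L.subtypeL -
      conjMap L.subtypeL ∘ₗ conjMap (logicalOp enc U)) ∘ₗ conjMap L.orthogonalProjectionOnto)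

/-- The Hilbert space `L²(ℝ)`. -/
abbrev L2R : Type := Lp ℂ 2 (volume : Measure ℝ)

theorem map_affine {α : ℝ} (hα : 0 < α) (b : ℝ) :
    Measure.map (fun x : ℝ => (x - b) / α) volume = ENNReal.ofReal α • volume := by
  have h1 : (fun x : ℝ => (x - b) / α) = (fun x => α⁻¹ * x) ∘ (fun x => x - b) := by
    ext x; simp [div_eq_inv_mul]
  rw [h1, ← Measure.map_map (by fun_prop) (by fun_prop), map_sub_right_eq_self,
    Real.map_volume_mul_left (by positivity)]
  simp [abs_of_pos hα]

theorem quasi_affine {α : ℝ} (hα : 0 < α) (b : ℝ) :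
    Measure.QuasiMeasurePreserving (fun x : ℝ => (x - b) / α) volume volume :=
  ⟨by fun_prop, by rw [map_affine hα]; exact Measure.smul_absolutelyContinuous⟩

/-- The function `x ↦ α^{-1/2} u(x) f((x - b)/α)`. -/
def affineFun (α b : ℝ) (u : ℝ → ℂ) (f : ℝ → ℂ) (x : ℝ) : ℂ :=
  (((Real.sqrt α)⁻¹ : ℝ) : ℂ) * u x * f ((x - b) / α)

theorem aestronglyMeasurable_affineFun {α : ℝ} (hα : 0 < α) (b : ℝ) {u f : ℝ → ℂ}
    (hu : Measurable u) (hf : AEStronglyMeasurable f volume) :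
    AEStronglyMeasurable (affineFun α b u f) volume := by
  unfold affineFun
  exact ((measurable_const.mul hu).aestronglyMeasurable).mul
    (hf.comp_quasiMeasurePreserving (quasi_affine hα b))

theorem eLpNorm_affineFun {α : ℝ} (hα : 0 < α) (b : ℝ) {u f : ℝ → ℂ}
    (hu1 : ∀ x, ‖u x‖ = 1) (hf : AEStronglyMeasurable f volume) :
    eLpNorm (affineFun α b u f) 2 volume = eLpNorm f 2 volume := by
  have h1 : eLpNorm (affineFun α b u f) 2 volume =
      eLpNorm ((((Real.sqrt α)⁻¹ : ℝ) : ℂ) • (f ∘ fun x : ℝ => (x - b) / α)) 2 volume := by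
    apply eLpNorm_congr_norm_ae
    filter_upwards with x
    simp [affineFun, hu1]
  rw [h1, eLpNorm_const_smul, ← eLpNorm_map_measure ?_ (quasi_affine hα b).aemeasurable,
    map_affine hα, eLpNorm_smul_measure_of_ne_top (by simp)]
  · rw [smul_eq_mul, ← mul_assoc]
    have h2 : ‖(((Real.sqrt α)⁻¹ : ℝ) : ℂ)‖ₑ = ENNReal.ofReal (Real.sqrt α)⁻¹ := by
      rw [← ofReal_norm, Complex.norm_real, Real.norm_of_nonneg (by positivity)]
    rw [h2]
    have h3 : ENNReal.ofReal α ^ (1 / (2 : ℝ≥0∞)).toReal = ENNReal.ofReal (Real.sqrt α) := by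
      rw [Real.sqrt_eq_rpow, ← ENNReal.ofReal_rpow_of_pos hα]; simp
    rw [h3, ← ENNReal.ofReal_mul (by positivity),
      inv_mul_cancel₀ (Real.sqrt_pos.mpr hα).ne']
    simp
  · rw [map_affine hα]
    exact hf.mono_ac Measure.smul_absolutelyContinuous

theorem memLp_affineFun {α : ℝ} (hα : 0 < α) (b : ℝ) {u f : ℝ → ℂ}
    (hu : Measurable u) (hu1 : ∀ x, ‖u x‖ = 1) (hf : MemLp f 2 volume) :
    MemLp (affineFun α b u f) 2 volume :=
  ⟨aestronglyMeasurable_affineFun hα b hu hf.1, by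
    rw [eLpNorm_affineFun hα b hu1 hf.1]; exact hf.2⟩

theorem affineFun_congr {α : ℝ} (hα : 0 < α) (b : ℝ) (u : ℝ → ℂ) {f g : ℝ → ℂ}
    (h : f =ᵐ[volume] g) : affineFun α b u f =ᵐ[volume] affineFun α b u g := by
  filter_upwards [(quasi_affine hα b).ae_eq_comp h] with x hx
  simp only [affineFun]
  simp only [Function.comp] at hx
  rw [hx]

/-- The isometry `f ↦ (x ↦ α^{-1/2} u(x) f((x - b)/α))` of `L²(ℝ)`. -/
def affineIsom {α : ℝ} (hα : 0 < α) (b : ℝ) (u : ℝ → ℂ) (hu : Measurable u)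
    (hu1 : ∀ x, ‖u x‖ = 1) : L2R →ₗᵢ[ℂ] L2R where
  toFun f := (memLp_affineFun hα b hu hu1 (Lp.memLp f)).toLp (affineFun α b u f)
  map_add' f g := by
    rw [← MemLp.toLp_add]
    apply MemLp.toLp_congr
    refine (affineFun_congr hα b u (Lp.coeFn_add f g)).trans ?_
    filter_upwards with x
    simp [affineFun, mul_add]
  map_smul' c f := by
    rw [RingHom.id_apply, ← MemLp.toLp_const_smul]
    apply MemLp.toLp_congr
    refine (affineFun_congr hα b u (Lp.coeFn_smul c f)).trans ?_
    filter_upwards with x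
    simp only [affineFun, Pi.smul_apply, smul_eq_mul]
    ring
  norm_map' f := by
    change ‖(memLp_affineFun hα b hu hu1 (Lp.memLp f)).toLp (affineFun α b u f)‖ = ‖f‖
    rw [Lp.norm_toLp, eLpNorm_affineFun hα b hu1 (Lp.aestronglyMeasurable f), Lp.norm_def]

theorem affineIsom_coeFn {α : ℝ} (hα : 0 < α) (b : ℝ) (u : ℝ → ℂ) (hu : Measurable u)
    (hu1 : ∀ x, ‖u x‖ = 1) (f : L2R) :
    affineIsom hα b u hu hu1 f =ᵐ[volume] affineFun α b u f :=
  MemLp.coeFn_toLp (memLp_affineFun hα b hu hu1 (Lp.memLp f))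

theorem affineIsom_surjective {α : ℝ} (hα : 0 < α) (b : ℝ) (u : ℝ → ℂ) (hu : Measurable u)
    (hu1 : ∀ x, ‖u x‖ = 1) : Function.Surjective (affineIsom hα b u hu hu1) := by
  intro g
  have hu' : Measurable fun y : ℝ => (u (α * y + b))⁻¹ := by fun_prop
  have hu1' : ∀ y : ℝ, ‖(u (α * y + b))⁻¹‖ = 1 := fun y => by rw [norm_inv, hu1, inv_one]
  refine ⟨affineIsom (inv_pos.mpr hα) (-b / α) _ hu' hu1' g, ?_⟩
  apply Lp.ext
  refine (affineIsom_coeFn hα b u hu hu1 _).trans ?_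
  refine (affineFun_congr hα b u (affineIsom_coeFn _ _ _ hu' hu1' g)).trans ?_
  filter_upwards with x
  have h0 : u x ≠ 0 := fun h => by simpa [h] using hu1 x
  have h1 : α * ((x - b) / α) + b = x := by field_simp; ring
  have h2 : ((x - b) / α - -b / α) / α⁻¹ = x := by field_simp; ring
  simp only [affineFun, h1, h2]
  have h3 : ((Real.sqrt α : ℝ) : ℂ) ≠ 0 := by exact_mod_cast (Real.sqrt_pos.mpr hα).ne'
  rw [Real.sqrt_inv]
  push_cast
  field_simp

/-- The unitary `f ↦ (x ↦ α^{-1/2} u(x) f((x - b)/α))` of `L²(ℝ)`. -/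
def affineUnitary {α : ℝ} (hα : 0 < α) (b : ℝ) (u : ℝ → ℂ) (hu : Measurable u)
    (hu1 : ∀ x, ‖u x‖ = 1) : L2R ≃ₗᵢ[ℂ] L2R :=
  LinearIsometryEquiv.ofSurjective (affineIsom hα b u hu hu1)
    (affineIsom_surjective hα b u hu hu1)

theorem affineUnitary_coeFn {α : ℝ} (hα : 0 < α) (b : ℝ) (u : ℝ → ℂ) (hu : Measurable u)
    (hu1 : ∀ x, ‖u x‖ = 1) (f : L2R) :
    affineUnitary hα b u hu hu1 f =ᵐ[volume] affineFun α b u f :=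
  affineIsom_coeFn hα b u hu hu1 f

/-- `e^{-iaP}`, the translation `f ↦ f(· - a)`. -/
def translation (a : ℝ) : L2R ≃ₗᵢ[ℂ] L2R :=
  affineUnitary one_pos a (fun _ => 1) measurable_const (by simp)

theorem translation_coeFn (a : ℝ) (f : L2R) :
    translation a f =ᵐ[volume] fun x => f (x - a) := by
  refine (affineUnitary_coeFn _ _ _ _ _ f).trans ?_
  filter_upwards with x
  simp [affineFun]

/-- `M_α`, the squeezing unitary `f ↦ α^{-1/2} f(·/α)`. -/
def squeezing {α : ℝ} (hα : 0 < α) : L2R ≃ₗᵢ[ℂ] L2R :=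
  affineUnitary hα 0 (fun _ => 1) measurable_const (by simp)

theorem squeezing_coeFn {α : ℝ} (hα : 0 < α) (f : L2R) :
    squeezing hα f =ᵐ[volume] fun x => (((Real.sqrt α)⁻¹ : ℝ) : ℂ) * f (x / α) := by
  refine (affineUnitary_coeFn _ _ _ _ _ f).trans ?_
  filter_upwards with x
  simp [affineFun]

/-- `e^{iaQ}`, the multiplication by `e^{iax}`. -/
def modulation (a : ℝ) : L2R ≃ₗᵢ[ℂ] L2R :=
  affineUnitary one_pos 0 (fun x => Complex.exp (Complex.I * (a * x : ℝ)))
    (by fun_prop) (fun x => by rw [mul_comm]; exact Complex.norm_exp_ofReal_mul_I _)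

theorem modulation_coeFn (a : ℝ) (f : L2R) :
    modulation a f =ᵐ[volume] fun x => Complex.exp (Complex.I * (a * x : ℝ)) * f x := by
  refine (affineUnitary_coeFn _ _ _ _ _ f).trans ?_
  filter_upwards with x
  simp [affineFun]


/-- The Gaussian envelope `η_κ`. -/
def envelope (κ x : ℝ) : ℝ :=
  Real.sqrt κ / π ^ (1 / 4 : ℝ) * Real.exp (-(κ ^ 2 * x ^ 2 / 2))

/-- The Gaussian peak `Ψ_Δ`. -/
def peak (Δ x : ℝ) : ℝ :=
  1 / (π ^ (1 / 4 : ℝ) * Real.sqrt Δ) * Real.exp (-(x ^ 2 / (2 * Δ ^ 2)))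

theorem memLp_peak (Δ : ℝ) : MemLp (fun x : ℝ => (peak Δ x : ℂ)) 2 volume := by
  have hm : AEStronglyMeasurable (fun x : ℝ => (peak Δ x : ℂ)) volume := by
    apply Measurable.aestronglyMeasurable
    unfold peak
    fun_prop
  rcases eq_or_ne Δ 0 with rfl | hΔ
  · have : (fun x : ℝ => (peak 0 x : ℂ)) = fun _ => 0 := by ext x; simp [peak]
    rw [this]
    exact MemLp.zero'
  · rw [memLp_two_iff_integrable_sq_norm hm]
    have hb : 0 < 1 / Δ ^ 2 := by positivity
    have h := (integrable_exp_neg_mul_sq hb).const_mul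
      ((1 / (π ^ (1 / 4 : ℝ) * Real.sqrt Δ)) ^ 2)
    refine h.congr (Filter.Eventually.of_forall fun x => ?_)
    simp only [Complex.norm_real, Real.norm_eq_abs, sq_abs, peak]
    rw [mul_pow, ← Real.exp_nat_mul]
    congr 2
    push_cast
    field_simp

theorem memLp_peakTrunc (ε Δ : ℝ) :
    MemLp ((Set.Icc (-ε) ε).indicator fun x : ℝ => (peak Δ x : ℂ)) 2 volume :=
  (memLp_peak Δ).indicator measurableSet_Icc

/-- The unit vector in the direction of `f`. -/
def normalized (f : L2R) : L2R := ((‖f‖⁻¹ : ℝ) : ℂ) • f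

theorem norm_normalized {f : L2R} (hf : f ≠ 0) : ‖normalized f‖ = 1 := by
  unfold normalized
  rw [norm_smul, Complex.norm_real, norm_inv, norm_norm, inv_mul_cancel₀ (norm_ne_zero_iff.mpr hf)]

/-- The normalization of `∑_s η_κ(s) f(· - s)`. -/
def gkpComb (κ : ℝ) (f : L2R) : L2R :=
  normalized (∑' s : ℤ, (envelope κ s : ℂ) • translation s f)

/-- `Ψ_Δ` as an element of `L²(ℝ)`. -/
def peakL2 (Δ : ℝ) : L2R := (memLp_peak Δ).toLp

/-- The truncated peak `Ψ_Δ^ε`: the restriction of `Ψ_Δ` to `[-ε, ε]`, normalized. -/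
def peakTruncL2 (ε Δ : ℝ) : L2R := normalized (memLp_peakTrunc ε Δ).toLp

/-- The approximate GKP state `GKP_{κ,Δ}`. -/
def gkp (κ Δ : ℝ) : L2R := gkpComb κ (peakL2 Δ)

/-- The truncated approximate GKP state `GKP_{κ,Δ}^ε`. -/
def gkpTrunc (ε κ Δ : ℝ) : L2R := gkpComb κ (peakTruncL2 ε Δ)

theorem sqrt_two_pi_mul_pos {d : ℕ} (hd : 2 ≤ d) : 0 < Real.sqrt (2 * π * d) := by
  have : (0 : ℝ) < d := by exact_mod_cast (by omega : 0 < d)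
  positivity

/-- The code state `f(j)_d = e^{-ij√(2π/d)P} M_{√(2πd)} f`. -/
def codeword {d : ℕ} (hd : 2 ≤ d) (f : L2R) (j : Fin d) : L2R :=
  translation (((j : ℕ) : ℝ) * Real.sqrt (2 * π / d)) (squeezing (sqrt_two_pi_mul_pos hd) f)

/-- `f` vanishes almost everywhere outside `S`. -/
def SuppIn (f : L2R) (S : Set ℝ) : Prop := ∀ᵐ x, x ∉ S → f x = 0

theorem SuppIn.translation {f : L2R} {S : Set ℝ} (h : SuppIn f S) (a : ℝ) :
    SuppIn (translation a f) {x | x - a ∈ S} := by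
  have h' := (quasi_affine one_pos a).ae h
  filter_upwards [h', translation_coeFn a f] with x hx hx2 hxS
  rw [hx2]
  simpa using hx (by simpa using hxS)

theorem SuppIn.squeezing {f : L2R} {S : Set ℝ} (h : SuppIn f S) {α : ℝ} (hα : 0 < α) :
    SuppIn (squeezing hα f) {x | x / α ∈ S} := by
  have h' := (quasi_affine hα 0).ae h
  filter_upwards [h', squeezing_coeFn hα f] with x hx hx2 hxS
  rw [hx2]
  have : f (x / α) = 0 := by simpa using hx (by simpa using hxS)
  rw [this, mul_zero]

theorem SuppIn.smul {f : L2R} {S : Set ℝ} (h : SuppIn f S) (c : ℂ) : SuppIn (c • f) S := by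
  filter_upwards [h, Lp.coeFn_smul c f] with x hx hx2 hxS
  rw [hx2, Pi.smul_apply, hx hxS, smul_zero]

theorem SuppIn.inner_eq_zero {f g : L2R} {S T : Set ℝ} (hf : SuppIn f S) (hg : SuppIn g T)
    (h : volume (S ∩ T) = 0) : inner ℂ f g = 0 := by
  rw [L2.inner_def]
  apply integral_eq_zero_of_ae
  filter_upwards [hf, hg, measure_eq_zero_iff_ae_notMem.mp h] with x hx hy hxy
  by_cases hS : x ∈ S
  · have : x ∉ T := fun hT => hxy ⟨hS, hT⟩
    simp [hy this]
  · simp [hx hS]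

theorem suppIn_peakTruncL2 (ε Δ : ℝ) : SuppIn (peakTruncL2 ε Δ) (Set.Icc (-ε) ε) := by
  refine SuppIn.smul ?_ _
  filter_upwards [(memLp_peakTrunc ε Δ).coeFn_toLp] with x hx hxS
  rw [hx, Set.indicator_of_notMem hxS]

theorem norm_peakTruncL2 {ε Δ : ℝ} (hε : 0 < ε) (hΔ : 0 < Δ) : ‖peakTruncL2 ε Δ‖ = 1 := by
  apply norm_normalized
  intro h
  have h1 := (memLp_peakTrunc ε Δ).coeFn_toLp
  rw [h] at h1
  have h2 : ∀ᵐ x : ℝ, x ∉ Set.Icc (-ε) ε := by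
    filter_upwards [h1, Lp.coeFn_zero ℂ 2 (volume : Measure ℝ)] with x hx hx0 hxS
    rw [hx0, Set.indicator_of_mem hxS, Pi.zero_apply] at hx
    have hp : 0 < peak Δ x := by unfold peak; positivity
    exact hp.ne (by exact_mod_cast hx)
  have h3 := measure_eq_zero_iff_ae_notMem.mpr h2
  rw [Real.volume_Icc, ENNReal.ofReal_eq_zero] at h3
  linarith

theorem summable_envelope {κ : ℝ} (hκ : 0 < κ) : Summable fun s : ℤ => envelope κ s := by
  apply Summable.mul_left
  have h := ((summable_jacobiTheta₂_term_iff 0 (Complex.I * ((κ ^ 2 / (2 * π) : ℝ) : ℂ))).mpr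
    (by rw [Complex.I_mul_im, Complex.ofReal_re]; positivity)).norm
  refine h.congr fun n => ?_
  rw [jacobiTheta₂_term, mul_zero, zero_add, Complex.norm_exp]
  congr 1
  have : (π * Complex.I * (n : ℂ) ^ 2 * (Complex.I * ((κ ^ 2 / (2 * π) : ℝ) : ℂ)) : ℂ) =
      ((-(κ ^ 2 * (n : ℝ) ^ 2 / 2) : ℝ) : ℂ) := by
    have hp : (π : ℂ) ≠ 0 := by exact_mod_cast Real.pi_ne_zero
    push_cast
    field_simp
    rw [Complex.I_sq]; ring
  rw [this, Complex.ofReal_re]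

/-- Distinct peaks of the truncated code states are orthogonal. -/
theorem inner_peaks_eq_zero {d : ℕ} (hd : 2 ≤ d) (Δ : ℝ) {j k : Fin d} {s t : ℤ}
    (h : (j, s) ≠ (k, t)) :
    inner ℂ (codeword hd (translation s (peakTruncL2 (1 / (2 * d)) Δ)) j)
      (codeword hd (translation t (peakTruncL2 (1 / (2 * d)) Δ)) k) = 0 := by
  have hd0 : (0 : ℝ) < d := by exact_mod_cast (by omega : 0 < d)
  have hS := ((((suppIn_peakTruncL2 (1 / (2 * d)) Δ).translation s).squeezing
    (sqrt_two_pi_mul_pos hd)).translation (((j : ℕ) : ℝ) * Real.sqrt (2 * π / d)))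
  have hT := ((((suppIn_peakTruncL2 (1 / (2 * d)) Δ).translation t).squeezing
    (sqrt_two_pi_mul_pos hd)).translation (((k : ℕ) : ℝ) * Real.sqrt (2 * π / d)))
  refine hS.inner_eq_zero hT ?_
  set r := Real.sqrt (2 * π * d) with hr
  have hr0 : 0 < r := sqrt_two_pi_mul_pos hd
  have hq : Real.sqrt (2 * π / d) = r / d := by
    rw [hr, eq_div_iff hd0.ne', ← Real.sqrt_sq hd0.le, ← Real.sqrt_mul (by positivity)]
    congr 1
    rw [Real.sqrt_sq hd0.le]
    field_simp
  apply measure_mono_null (t := {r * (((j : ℕ) + d * s + ((k : ℕ) + d * t) : ℝ) / (2 * d))})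
  · rintro x ⟨hx, hy⟩
    simp only [Set.mem_ofPred_eq, Set.mem_Icc, hq] at hx hy
    obtain ⟨u, rfl⟩ : ∃ u, x = r * u := ⟨x / r, by field_simp⟩
    have e1 : ∀ n : ℕ, (r * u - n * (r / d)) / r = u - n / d := fun n => by field_simp
    rw [e1] at hx hy
    have hne : ((j : ℕ) : ℤ) + d * s ≠ ((k : ℕ) : ℤ) + d * t := by
      intro he
      have hjk : ((j : ℕ) : ℤ) = (k : ℕ) := by
        have h1 : (((j : ℕ) : ℤ) + d * s) % d = (j : ℕ) := by
          rw [Int.add_mul_emod_self_left, Int.emod_eq_of_lt (by omega) (by exact_mod_cast j.2)]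
        have h2 : (((k : ℕ) : ℤ) + d * t) % d = (k : ℕ) := by
          rw [Int.add_mul_emod_self_left, Int.emod_eq_of_lt (by omega) (by exact_mod_cast k.2)]
        rw [← h1, ← h2, he]
      have hst : s = t := by
        have h3 : (d : ℤ) * s = d * t := by omega
        exact mul_left_cancel₀ (by omega) h3
      exact h (by rw [hst, Fin.ext (by exact_mod_cast hjk : (j : ℕ) = k)])
    have g1 : -1 ≤ 2 * (d * u) - 2 * ((j : ℕ) + d * s) := by
      have := mul_le_mul_of_nonneg_left hx.1 (by positivity : (0 : ℝ) ≤ 2 * d)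
      field_simp at this; linarith
    have g2 : 2 * (d * u) - 2 * ((j : ℕ) + d * s) ≤ 1 := by
      have := mul_le_mul_of_nonneg_left hx.2 (by positivity : (0 : ℝ) ≤ 2 * d)
      field_simp at this; linarith
    have g3 : -1 ≤ 2 * (d * u) - 2 * ((k : ℕ) + d * t) := by
      have := mul_le_mul_of_nonneg_left hy.1 (by positivity : (0 : ℝ) ≤ 2 * d)
      field_simp at this; linarith
    have g4 : 2 * (d * u) - 2 * ((k : ℕ) + d * t) ≤ 1 := by
      have := mul_le_mul_of_nonneg_left hy.2 (by positivity : (0 : ℝ) ≤ 2 * d)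
      field_simp at this; linarith
    have key : 2 * (d * u) = ((j : ℕ) + d * s + ((k : ℕ) + d * t) : ℝ) := by
      rcases lt_or_gt_of_ne hne with hl | hl
      · have : ((j : ℕ) : ℝ) + d * s + 1 ≤ (k : ℕ) + d * t := by exact_mod_cast hl
        linarith
      · have : ((k : ℕ) : ℝ) + d * t + 1 ≤ (j : ℕ) + d * s := by exact_mod_cast hl
        linarith
    rw [Set.mem_singleton_iff, ← key]
    field_simp
  · exact measure_singleton _

theorem codeword_smul {d : ℕ} (hd : 2 ≤ d) (c : ℂ) (f : L2R) (j : Fin d) :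
    codeword hd (c • f) j = c • codeword hd f j := by
  simp [codeword]

theorem codeword_tsum {d : ℕ} (hd : 2 ≤ d) (f : ℤ → L2R) (j : Fin d) :
    codeword hd (∑' s, f s) j = ∑' s, codeword hd (f s) j := by
  unfold codeword
  have h (V : L2R ≃ₗᵢ[ℂ] L2R) (g : ℤ → L2R) : V (∑' s, g s) = ∑' s, V (g s) :=
    V.toContinuousLinearEquiv.map_tsum
  rw [h, h]

theorem norm_codeword {d : ℕ} (hd : 2 ≤ d) (f : L2R) (j : Fin d) : ‖codeword hd f j‖ = ‖f‖ := by
  simp [codeword]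

theorem inner_tsum_eq_zero {f : ℤ → L2R} {g : L2R} (h : ∀ s, inner ℂ g (f s) = 0) :
    inner ℂ g (∑' s, f s) = 0 := by
  by_cases hf : Summable f
  · have := (innerSL ℂ g).map_tsum hf
    simp only [innerSL_apply_apply] at this
    rw [this]; simp [h]
  · simp [tsum_eq_zero_of_not_summable hf]

theorem inner_codeword_codeword {d : ℕ} (hd : 2 ≤ d) (f g : L2R) (j : Fin d) :
    inner ℂ (codeword hd f j) (codeword hd g j) = inner ℂ f g := by
  simp [codeword]

theorem gkpTrunc_ne_zero {d : ℕ} (hd : 2 ≤ d) {κ Δ : ℝ} (hκ : 0 < κ) (hΔ : 0 < Δ) :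
    (∑' s : ℤ, (envelope κ s : ℂ) • translation s (peakTruncL2 (1 / (2 * d)) Δ)) ≠ 0 := by
  have hd0 : (0 : ℝ) < d := by exact_mod_cast (by omega : 0 < d)
  set ψ := peakTruncL2 (1 / (2 * d)) Δ with hψ
  have hn : ‖ψ‖ = 1 := norm_peakTruncL2 (by positivity) hΔ
  have hs : Summable fun s : ℤ => (envelope κ s : ℂ) • translation s ψ := by
    apply Summable.of_norm
    refine (summable_envelope hκ).norm.congr fun s => ?_
    rw [norm_smul, LinearIsometryEquiv.norm_map, hn, Complex.norm_real, mul_one]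
  intro h0
  have h1 := (innerSL ℂ (translation ((0 : ℤ) : ℝ) ψ)).map_tsum hs
  rw [h0, map_zero, tsum_eq_single 0] at h1
  · have he : (envelope κ ((0 : ℤ) : ℝ) : ℂ) ≠ 0 := by
      have : 0 < envelope κ ((0 : ℤ) : ℝ) := by unfold envelope; positivity
      exact_mod_cast this.ne'
    rw [innerSL_apply_apply, inner_smul_right, inner_self_eq_norm_sq_to_K,
      LinearIsometryEquiv.norm_map, hn] at h1
    exact he (by simpa using h1.symm)
  · intro s hs0
    rw [innerSL_apply_apply, inner_smul_right,
      ← inner_codeword_codeword hd _ _ (⟨0, by omega⟩ : Fin d),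
      inner_peaks_eq_zero hd Δ (by simpa using hs0.symm), mul_zero]

theorem orthonormal_codeword {d : ℕ} (hd : 2 ≤ d) {κ Δ : ℝ} (hκ : 0 < κ) (hΔ : 0 < Δ) :
    Orthonormal ℂ (codeword hd (gkpTrunc (1 / (2 * d)) κ Δ)) := by
  refine ⟨fun j => ?_, fun j k hjk => ?_⟩
  · rw [norm_codeword]
    exact norm_normalized (gkpTrunc_ne_zero hd hκ hΔ)
  · change inner ℂ (codeword hd (gkpTrunc (1 / (2 * d)) κ Δ) j)
      (codeword hd (gkpTrunc (1 / (2 * d)) κ Δ) k) = 0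
    unfold gkpTrunc gkpComb normalized
    rw [codeword_smul, codeword_smul, inner_smul_left, inner_smul_right, codeword_tsum hd _ k]
    rw [inner_tsum_eq_zero, mul_zero, mul_zero]
    intro t
    rw [← inner_conj_symm, codeword_tsum, inner_tsum_eq_zero, map_zero]
    intro s
    rw [codeword_smul, codeword_smul, inner_smul_left, inner_smul_right,
      inner_peaks_eq_zero hd Δ (by simpa using fun h : k = j => absurd h.symm hjk)]
    simp

/-- The code spanned by the states `f(j)_d`, `0 ≤ j < d`. -/
def gkpCode {d : ℕ} (hd : 2 ≤ d) (f : L2R) : Submodule ℂ L2R :=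
  Submodule.span ℂ (Set.range (codeword hd f))

/-- The isometric encoding that maps the standard basis to an orthonormal family `v`. -/
def isometricEncoding {d : ℕ} {v : Fin d → L2R} (hv : Orthonormal ℂ v) :
    EuclideanSpace ℂ (Fin d) ≃ₗᵢ[ℂ] Submodule.span ℂ (Set.range v) :=
  ((Module.Basis.span hv.linearIndependent).toOrthonormalBasis (by
    have : v = fun j => ((Module.Basis.span hv.linearIndependent j : _) : L2R) := by
      ext1 j; rw [Module.Basis.span_apply]
    rw [this] at hv
    exact (Submodule.span ℂ (Set.range v)).subtypeₗᵢ.orthonormal_comp_iff.mp hv)).repr.symm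

theorem isometricEncoding_single {d : ℕ} {v : Fin d → L2R} (hv : Orthonormal ℂ v) (j : Fin d) :
    (isometricEncoding hv (EuclideanSpace.single j 1) : L2R) = v j := by
  unfold isometricEncoding
  rw [OrthonormalBasis.repr_symm_single, Module.Basis.coe_toOrthonormalBasis,
    Module.Basis.span_apply]

/-- The width `Δ = κ/(2πd)` of the symmetrically squeezed code. -/
def symWidth (d : ℕ) (κ : ℝ) : ℝ := κ / (2 * π * d)

theorem symWidth_pos {d : ℕ} (hd : 2 ≤ d) {κ : ℝ} (hκ : 0 < κ) : 0 < symWidth d κ := by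
  have : (0 : ℝ) < d := by exact_mod_cast (by omega : 0 < d)
  unfold symWidth
  positivity

/-- The symmetrically squeezed GKP code `GKP_{κ,κ/(2πd)}[d]`. -/
def symCode {d : ℕ} (hd : 2 ≤ d) (κ : ℝ) : Submodule ℂ L2R :=
  gkpCode hd (gkp κ (symWidth d κ))

/-- The symmetrically squeezed truncated GKP code `GKP_κ^⋆[d]`, with truncation `ε = 1/(2d)`. -/
def symCodeTrunc {d : ℕ} (hd : 2 ≤ d) (κ : ℝ) : Submodule ℂ L2R :=
  gkpCode hd (gkpTrunc (1 / (2 * d)) κ (symWidth d κ))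

/-- The encoding `e_j ↦ GKP_{κ,κ/(2πd)}^{1/(2d)}(j)_d` of the truncated code. -/
def symEncodingTrunc {d : ℕ} (hd : 2 ≤ d) {κ : ℝ} (hκ : 0 < κ) :
    EuclideanSpace ℂ (Fin d) ≃ₗᵢ[ℂ] symCodeTrunc hd κ :=
  isometricEncoding (orthonormal_codeword hd hκ (symWidth_pos hd hκ))

/-- The logical gate `X`, `X|x⟩ = |x + 1 mod d⟩`. -/
def gateX (d : ℕ) : Matrix (Fin d) (Fin d) ℂ :=
  Matrix.of fun y x => if (y : ℕ) = ((x : ℕ) + 1) % d then 1 else 0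

/-- The logical gate `Z`, `Z|x⟩ = e^{2πix/d}|x⟩`. -/
def gateZ (d : ℕ) : Matrix (Fin d) (Fin d) ℂ :=
  Matrix.diagonal fun x => Complex.exp (2 * π * Complex.I * (x : ℕ) / d)

/-- The logical gate `F`, `F|x⟩ = d^{-1/2} ∑_y e^{2πixy/d}|y⟩`. -/
def gateF (d : ℕ) : Matrix (Fin d) (Fin d) ℂ :=
  Matrix.of fun y x =>
    ((Real.sqrt d)⁻¹ : ℝ) * Complex.exp (2 * π * Complex.I * ((x : ℕ) * (y : ℕ)) / d)

/-- The unitary `e^{iπ(Q² + P²)/4}`, that is `f ↦ (x ↦ e^{iπ/4} (2π)^{-1/2} ∫ e^{ixy} f(y) dy)`.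
The lemmas `energy_herm` and `fourierUnitary_herm` below check that it acts as the scalar `e^{iπ(2n+1)/4}` on the
`n`-th Hermite function, an eigenvector of `Q² + P²` with eigenvalue `2n + 1`. -/
def fourierUnitary : L2R ≃ₗᵢ[ℂ] L2R :=
  (Lp.fourierTransformₗᵢ ℝ ℂ).symm.trans
    (affineUnitary Real.two_pi_pos 0 (fun _ => Complex.exp (((π / 4 : ℝ) : ℂ) * Complex.I))
      measurable_const (fun _ => Complex.norm_exp_ofReal_mul_I _))

theorem gaussian_bound (k n : ℕ) : ∃ C : ℝ, ∀ x : ℝ,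
    ‖x‖ ^ k * ‖iteratedFDeriv ℝ n (fun y : ℝ => Real.exp (-(y ^ 2 / 2))) x‖ ≤ C := by
  obtain ⟨C, hC⟩ : ∃ C : ℝ, ∀ x : ℝ, ‖(Polynomial.X ^ k * Polynomial.hermite n).aeval x *
      Real.exp (-(x ^ 2 / 2))‖ ≤ C := by
    have hx (m : ℕ) : ∃ C : ℝ, ∀ x : ℝ, ‖x ^ m * Real.exp (-(x ^ 2 / 2))‖ ≤ C := by
      refine ⟨1 + 2 ^ m * m.factorial, fun x => ?_⟩
      have h1 := Real.pow_div_factorial_le_exp (x ^ 2 / 2) (by positivity) m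
      rw [div_le_iff₀ (by positivity), div_pow, div_le_iff₀ (by positivity)] at h1
      have h2 : |x ^ m| ≤ 1 + (x ^ 2) ^ m := by
        have h3 : (x ^ 2) ^ m = |x ^ m| ^ 2 := by rw [sq_abs]; ring
        rw [h3]; nlinarith [sq_nonneg (|x ^ m| - 1)]
      have h4 : Real.exp (-(x ^ 2 / 2)) ≤ 1 := Real.exp_le_one_iff.mpr (by nlinarith [sq_nonneg x])
      have h5 : Real.exp (x ^ 2 / 2) * Real.exp (-(x ^ 2 / 2)) = 1 := by
        rw [← Real.exp_add]; simp
      have h6 := Real.exp_pos (-(x ^ 2 / 2))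
      rw [Real.norm_eq_abs, abs_mul, abs_of_pos h6]
      have h7 := mul_le_mul_of_nonneg_right (h2.trans (add_le_add_right h1 1)) h6.le
      have h8 : (1 + Real.exp (x ^ 2 / 2) * m.factorial * 2 ^ m) * Real.exp (-(x ^ 2 / 2)) =
          Real.exp (-(x ^ 2 / 2)) + 2 ^ m * m.factorial := by linear_combination (m.factorial * 2 ^ m : ℝ) * h5
      linarith
    generalize (Polynomial.X ^ k * Polynomial.hermite n) = p
    induction p using Polynomial.induction_on' with
    | add p q hp hq =>
      obtain ⟨C, hC⟩ := hp
      obtain ⟨D, hD⟩ := hq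
      refine ⟨C + D, fun x => ?_⟩
      rw [map_add, add_mul]
      exact (norm_add_le _ _).trans (add_le_add (hC x) (hD x))
    | monomial m a =>
      obtain ⟨C, hC⟩ := hx m
      refine ⟨‖(a : ℝ)‖ * C, fun x => ?_⟩
      rw [Polynomial.aeval_monomial, mul_assoc, norm_mul]
      exact mul_le_mul_of_nonneg_left (hC x) (norm_nonneg _)
  refine ⟨C, fun x => (le_of_eq ?_).trans (hC x)⟩
  rw [norm_iteratedFDeriv_eq_norm_iteratedDeriv, iteratedDeriv_eq_iterate,
    Polynomial.deriv_gaussian_eq_hermite_mul_gaussian]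
  simp
  ring

/-- The function `x ↦ e^{-x²/2}`. -/
def gauss : 𝓢(ℝ, ℂ) :=
  SchwartzMap.postcompCLM (𝕜 := ℝ) Complex.ofRealCLM
    { toFun := fun y : ℝ => Real.exp (-(y ^ 2 / 2))
      smooth' := by fun_prop
      decay' := gaussian_bound }

theorem gauss_apply (x : ℝ) : gauss x = Complex.exp (-(x ^ 2 / 2)) := by
  change ((Real.exp _ : ℝ) : ℂ) = _
  push_cast; rfl

/-- Multiplication by `x`. -/
def posOp : 𝓢(ℝ, ℂ) →L[ℂ] 𝓢(ℝ, ℂ) := SchwartzMap.smulLeftCLM ℂ (fun x : ℝ => (x : ℂ))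

/-- The derivative. -/
def difOp : 𝓢(ℝ, ℂ) →L[ℂ] 𝓢(ℝ, ℂ) := SchwartzMap.derivCLM ℂ ℂ

theorem posOp_apply (f : 𝓢(ℝ, ℂ)) (x : ℝ) : posOp f x = x * f x := by
  have h : (fun x : ℝ => (x : ℂ)).HasTemperateGrowth := by fun_prop
  simp [posOp, SchwartzMap.smulLeftCLM_apply_apply h]

theorem difOp_apply (f : 𝓢(ℝ, ℂ)) (x : ℝ) : difOp f x = deriv f x := rfl

theorem difOp_posOp (f : 𝓢(ℝ, ℂ)) : difOp (posOp f) = f + posOp (difOp f) := by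
  ext x
  have h : (posOp f : ℝ → ℂ) = fun x : ℝ => (x : ℂ) * f x := funext (posOp_apply f)
  rw [difOp_apply, h, add_apply, posOp_apply, difOp_apply]
  have := ((hasDerivAt_id x).ofReal_comp.mul (f.hasDerivAt x)).deriv
  simp only [id_eq, Complex.ofReal_one, one_mul] at this
  exact this

/-- The (unnormalized) Hermite functions: the `n`-th one is `(x - d/dx)ⁿ e^{-x²/2}`. -/
def herm (n : ℕ) : 𝓢(ℝ, ℂ) := (fun f => posOp f - difOp f)^[n] gauss

theorem herm_succ (n : ℕ) : herm (n + 1) = posOp (herm n) - difOp (herm n) :=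
  Function.iterate_succ_apply' _ _ _

theorem difOp_gauss : difOp gauss = - posOp gauss := by
  ext x
  rw [difOp_apply, neg_apply, posOp_apply, gauss_apply,
    (funext gauss_apply : (gauss : ℝ → ℂ) = _)]
  have h := ((((hasDerivAt_id x).ofReal_comp.pow 2).div_const 2).neg.cexp).deriv
  simp at h
  simpa [mul_comm] using h

/-- `(Q² + P²) h_n = (2n + 1) h_n` for the `n`-th Hermite function `h_n`. -/
theorem energy_herm (n : ℕ) : posOp (posOp (herm n)) - difOp (difOp (herm n)) =
    ((2 * n + 1 : ℕ) : ℂ) • herm n := by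
  induction n with
  | zero =>
    simp [herm, difOp_gauss, difOp_posOp]
  | succ n ih =>
    set f := herm n with hf
    have h1 : posOp (posOp (herm (n + 1))) - difOp (difOp (herm (n + 1))) =
        posOp (posOp (posOp f) - difOp (difOp f)) - difOp (posOp (posOp f) - difOp (difOp f))
          + (2 : ℂ) • (posOp f - difOp f) := by
      simp only [herm_succ, map_sub, map_add, difOp_posOp, ← hf, two_smul]
      abel
    rw [h1, ih, map_smul, map_smul, ← smul_sub, ← herm_succ, ← add_smul]
    congr 1
    push_cast; ring

/-- The function `x ↦ e^{iπ/4} (2π)^{-1/2} ∫ e^{ixy} f(y) dy`. -/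
def fourierFun (f : 𝓢(ℝ, ℂ)) : ℝ → ℂ :=
  affineFun (2 * π) 0 (fun _ => Complex.exp (((π / 4 : ℝ) : ℂ) * Complex.I)) (𝓕⁻ f : 𝓢(ℝ, ℂ))

theorem fourierUnitary_toLp (f : 𝓢(ℝ, ℂ)) :
    fourierUnitary (f.toLp 2 volume) =ᵐ[volume] fourierFun f := by
  have h : (Lp.fourierTransformₗᵢ ℝ ℂ).symm (f.toLp 2 volume) = (𝓕⁻ f : 𝓢(ℝ, ℂ)).toLp 2 volume :=
    SchwartzMap.toLp_fourierInv_eq f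
  refine (affineUnitary_coeFn Real.two_pi_pos 0 _ measurable_const
    (fun _ => Complex.norm_exp_ofReal_mul_I _) _).trans
    (affineFun_congr (g := (𝓕⁻ f : 𝓢(ℝ, ℂ))) Real.two_pi_pos 0 _ ?_)
  exact (Filter.EventuallyEq.of_eq (congrArg (fun g : L2R => (g : ℝ → ℂ)) h)).trans
    (SchwartzMap.coeFn_toLp _ _ _)

theorem lineDeriv_one (f : 𝓢(ℝ, ℂ)) : LineDeriv.lineDerivOp (1 : ℝ) f = difOp f := by
  ext x
  rw [SchwartzMap.lineDerivOp_apply_eq_fderiv, difOp_apply, fderiv_apply_one_eq_deriv]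

theorem smulLeft_one (f : 𝓢(ℝ, ℂ)) :
    SchwartzMap.smulLeftCLM ℂ (fun x : ℝ => inner ℝ x (1 : ℝ)) f = posOp f := by
  ext x
  have : (fun x : ℝ => inner ℝ x (1 : ℝ)).HasTemperateGrowth := by fun_prop
  rw [SchwartzMap.smulLeftCLM_apply_apply this, posOp_apply]
  simp

theorem fourierFun_create (f : 𝓢(ℝ, ℂ)) (x : ℝ) :
    fourierFun (posOp f - difOp f) x =
      Complex.I * (x * fourierFun f x - deriv (fourierFun f) x) := by
  have h1 := SchwartzMap.lineDerivOp_fourierInv_eq f (1 : ℝ)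
  have h2 := SchwartzMap.fourierInv_lineDerivOp_eq f (1 : ℝ)
  rw [lineDeriv_one, smulLeft_one, FourierTransform.fourierInv_smul] at h1
  rw [lineDeriv_one] at h2
  erw [smulLeft_one] at h2
  have h3 : deriv (fourierFun f) x = (((Real.sqrt (2 * π))⁻¹ : ℝ) : ℂ) *
      Complex.exp (((π / 4 : ℝ) : ℂ) * Complex.I) *
      (((2 * π : ℝ) : ℂ)⁻¹ * difOp (𝓕⁻ f) (x / (2 * π))) := by
    have h4 : HasDerivAt (fun y : ℝ => (y - 0) / (2 * π)) ((2 * π)⁻¹) x := by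
      simpa using ((hasDerivAt_id x).sub_const 0).div_const (2 * π)
    have h5 := ((𝓕⁻ f : 𝓢(ℝ, ℂ)).hasDerivAt ((x - 0) / (2 * π))).scomp x h4
    have h6 := (h5.const_mul ((((Real.sqrt (2 * π))⁻¹ : ℝ) : ℂ) *
      Complex.exp (((π / 4 : ℝ) : ℂ) * Complex.I))).deriv
    rw [sub_zero] at h6
    rw [difOp_apply, ← Complex.ofReal_inv, ← Complex.real_smul]
    exact h6
  rw [h3]
  have h7 : (𝓕⁻ (posOp f - difOp f) : 𝓢(ℝ, ℂ)) = 𝓕⁻ (posOp f) - 𝓕⁻ (difOp f) :=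
    map_sub (FourierTransform.fourierInvCLM ℂ 𝓢(ℝ, ℂ)) _ _
  simp only [fourierFun, affineFun, h7, h2, h1, sub_apply, smul_apply, posOp_apply, smul_eq_mul,
    sub_zero]
  have hp : (π : ℂ) ≠ 0 := by exact_mod_cast Real.pi_ne_zero
  push_cast
  field_simp
  linear_combination (𝓕⁻ (posOp f) : 𝓢(ℝ, ℂ)) (x / (2 * π)) * Complex.I_sq

theorem fourierFun_gauss (x : ℝ) :
    fourierFun gauss x = Complex.exp (((π / 4 : ℝ) : ℂ) * Complex.I) * gauss x := by
  have hp : (π : ℂ) ≠ 0 := by exact_mod_cast Real.pi_ne_zero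
  have h1 := fourier_gaussian_innerProductSpace (V := ℝ) (b := 1 / 2) (by norm_num)
    (-((x - 0) / (2 * π)))
  have h2 : (𝓕⁻ gauss : 𝓢(ℝ, ℂ)) ((x - 0) / (2 * π)) =
      ((Real.sqrt (2 * π) : ℝ) : ℂ) * Complex.exp (-(x ^ 2 / 2)) := by
    rw [SchwartzMap.fourierInv_coe, Real.fourierInv_eq_fourier_neg, (funext gauss_apply :
      (gauss : ℝ → ℂ) = _)]
    have h3 : (fun v : ℝ => Complex.exp (-(1 / 2) * (‖v‖ : ℂ) ^ 2)) =
        fun v : ℝ => Complex.exp (-((v : ℂ) ^ 2 / 2)) := by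
      ext v
      congr 1
      rw [← Complex.ofReal_pow, Real.norm_eq_abs, sq_abs]
      push_cast; ring
    rw [h3] at h1
    rw [h1]
    congr 1
    · rw [Real.sqrt_eq_rpow, Complex.ofReal_cpow (by positivity)]
      simp [mul_comm]
    · congr 1
      rw [Real.norm_eq_abs, ← Complex.ofReal_pow |_|, sq_abs]
      push_cast
      field_simp
      ring
  simp only [fourierFun, affineFun]
  rw [h2, gauss_apply]
  have h4 : ((Real.sqrt (2 * π) : ℝ) : ℂ) ≠ 0 := by
    exact_mod_cast (Real.sqrt_pos.mpr Real.two_pi_pos).ne'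
  rw [Complex.ofReal_inv]
  field_simp

/-- `e^{iπ(Q² + P²)/4} h_n = e^{iπ(2n+1)/4} h_n` for the `n`-th Hermite function `h_n`. -/
theorem fourierUnitary_herm (n : ℕ) :
    fourierUnitary ((herm n).toLp 2 volume) =
      Complex.exp (Complex.I * (π / 4 * (2 * n + 1) : ℝ)) • (herm n).toLp 2 volume := by
  have h (n : ℕ) : fourierFun (herm n) =
      fun x => Complex.exp (Complex.I * (π / 4 * (2 * n + 1) : ℝ)) * herm n x := by
    induction n with
    | zero =>
      ext x
      rw [herm, Function.iterate_zero_apply, fourierFun_gauss]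
      congr 2
      push_cast; ring
    | succ n ih =>
      ext x
      rw [herm_succ, fourierFun_create, ih, deriv_const_mul _ (herm n).differentiableAt,
        sub_apply, posOp_apply, difOp_apply]
      have : Complex.exp (Complex.I * (π / 4 * (2 * (n + 1 : ℕ) + 1) : ℝ)) =
          Complex.I * Complex.exp (Complex.I * (π / 4 * (2 * n + 1) : ℝ)) := by
        conv_rhs => lhs; rw [← Complex.exp_pi_div_two_mul_I]
        rw [← Complex.exp_add]
        congr 1
        push_cast; ring
      rw [this]; ring
  apply Lp.ext
  refine (fourierUnitary_toLp _).trans ?_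
  rw [h n]
  filter_upwards [Lp.coeFn_smul (Complex.exp (Complex.I * (π / 4 * (2 * n + 1) : ℝ)))
    ((herm n).toLp 2 volume), (herm n).coeFn_toLp 2 volume] with x h1 h2
  rw [h1, Pi.smul_apply, h2, smul_eq_mul]

end GKP

end

/-! A full peak and its truncation differ only by the Gaussian tail beyond ε = 1/(2d), and ε/Δ_κ =
π/κ for every d. Hence the normalized truncated and untruncated combs differ by at most 7κ^{3/2}
(`norm_gkp_sub_gkpTrunc_le`). The untruncated code states are linearly independent for every κ
(`linearIndependent_codeword`), so sending e_j to the j-th of them is an injective near-isometry,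
and its polar factor is an encoding within O(√d κ^{3/2}) of the truncated one
(`exists_symEncoding`). The logical error is Lipschitz in the encoding, with constant 4 in operator
norm (`logicalError_le_add`). This gives claim 1, even with factor 1 in place of 5/2, and claim 2
follows by letting κ tend to 0.

By claim 2, the gates X, Z and F need only be examined on the truncated code. The error there is at
most twice the sum, over basis states, of the distance between the action of W and that of U, up to
a global phase (`logicalError_le_sum`). Up to O(√κ) the states may be replaced by images of the
unnormalized full comb A = Σ η_κ(s) Ψ_Δ(· − s), whose norm is at least 1 (`logicalError_trunc_le`).
Three properties of A remain, each up to O(√κ). It is invariant under translation by 1 because the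
envelope varies slowly (X). It is invariant under modulation by 2π because the peaks are narrow (Z).
It reproduces itself under the Fourier transform (F): by Poisson summation the rescaled transform is
a phase times d^{-1/2} η_κ(x) times a sum of peaks on (1/d)ℤ (`squeezing_fourierUnitary_comb`),
these peaks again have width Δ thanks to the symmetric choice Δ = κ/(2πd), and replacing η_κ(x) by
its value at a nearby integer yields Σ_k A(· − k/d) (`norm_windowedComb_sub_le`).

The diamond norm estimates rest on duality for the trace norm: `norm_sum_inner_le` and
`traceNorm_le` bound it from both sides by the numbers |Σ ⟨e_i, K X e_i⟩| with K a contraction and e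
finite orthonormal, which yields the triangle inequality and the ideal property. -/

noncomputable section

namespace GKP

open MeasureTheory
open scoped ENNReal Real SchwartzMap FourierTransform

/-! ### Trace norm: duality with contractions, triangle inequality, ideal property. -/

section TraceNorm

variable {H : Type*} [NormedAddCommGroup H] [InnerProductSpace ℂ H]

theorem posTrace_ge (T : H →L[ℂ] H) {n : ℕ} {e : Fin n → H} (he : Orthonormal ℂ e) :
    ∑ i, ENNReal.ofReal (RCLike.re (inner ℂ (e i) (T (e i)))) ≤ posTrace T :=
  le_iSup_of_le n (le_iSup_of_le e (le_iSup_of_le he le_rfl))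

theorem re_inner_nonneg_of_nonneg {S : H →L[ℂ] H} (hS : 0 ≤ S) (v : H) :
    0 ≤ RCLike.re (inner ℂ v (S v)) :=
  ((ContinuousLinearMap.nonneg_iff_isPositive S).mp hS).re_inner_nonneg_right v

variable [CompleteSpace H]

theorem norm_abs_apply (X : H →L[ℂ] H) (v : H) : ‖CFC.abs X v‖ = ‖X v‖ := by
  have h1 : ContinuousLinearMap.adjoint (CFC.abs X) = CFC.abs X :=
    (CFC.abs_nonneg X).isSelfAdjoint.star_eq
  have h2 : inner ℂ (CFC.abs X v) (CFC.abs X v) = inner ℂ (X v) (X v) := by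
    rw [← ContinuousLinearMap.adjoint_inner_right, h1, ← mul_apply_eq_comp,
      CFC.abs_mul_abs, mul_apply_eq_comp, ContinuousLinearMap.star_eq_adjoint,
      ContinuousLinearMap.adjoint_inner_right]
  rw [inner_self_eq_norm_sq_to_K, inner_self_eq_norm_sq_to_K] at h2
  have h3 : ‖CFC.abs X v‖ ^ 2 = ‖X v‖ ^ 2 := by exact_mod_cast h2
  exact (sq_eq_sq₀ (norm_nonneg _) (norm_nonneg _)).mp h3

/-- Compression of `S = T T` by a contraction does not increase the partial traces. -/
theorem sum_norm_sq_comp_le {T B : H →L[ℂ] H} (hT : IsSelfAdjoint T) (hB : ‖B‖ ≤ 1) {n : ℕ}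
    {e : Fin n → H} (he : Orthonormal ℂ e) :
    ∃ (m : ℕ) (f : Fin m → H), m ≤ n ∧ Orthonormal ℂ f ∧
      ∑ i, ‖T (B (e i))‖ ^ 2 ≤ ∑ j, ‖T (f j)‖ ^ 2 := by
  have hT' : ContinuousLinearMap.adjoint T = T := hT.star_eq
  let V := Submodule.span ℂ (Set.range fun i => T (B (e i)))
  have : FiniteDimensional ℂ V := FiniteDimensional.span_of_finite ℂ (Set.finite_range _)
  let b := stdOrthonormalBasis ℂ V
  have hb : Orthonormal ℂ fun j => (b j : H) := b.orthonormal.comp_linearIsometry V.subtypeₗᵢ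
  refine ⟨_, fun j => (b j : H), ?_, hb, ?_⟩
  -- The bound m ≤ n keeps the total of the ε-shifts in `norm_sum_inner_le` below nε.
  · exact (finrank_range_le_card (R := ℂ) (fun i => T (B (e i)))).trans_eq (Fintype.card_fin n)
  have h1 (i) : ‖T (B (e i))‖ ^ 2 =
      ∑ j, ‖inner ℂ (e i) (ContinuousLinearMap.adjoint B (T (b j)))‖ ^ 2 := by
    have := b.sum_sq_norm_inner_right
      (⟨T (B (e i)), Submodule.subset_span (Set.mem_range_self i)⟩ : V)
    rw [Submodule.coe_norm] at this
    rw [← this]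
    refine Finset.sum_congr rfl fun j _ => ?_
    rw [ContinuousLinearMap.adjoint_inner_right, Submodule.coe_inner, ← inner_conj_symm,
      RCLike.norm_conj]
    conv_rhs => rw [← hT', ContinuousLinearMap.adjoint_inner_right]
  simp_rw [h1]
  -- With the sums exchanged, Bessel's inequality for e bounds the j-th inner sum by ‖B†T b_j‖².
  rw [Finset.sum_comm]
  refine Finset.sum_le_sum fun j _ => ?_
  refine (he.sum_inner_products_le _).trans ?_
  gcongr
  calc _ ≤ ‖ContinuousLinearMap.adjoint B‖ * ‖T (b j)‖ := ContinuousLinearMap.le_opNorm _ _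
    _ ≤ 1 * ‖T (b j)‖ := by
        gcongr
        rwa [LinearIsometryEquiv.norm_map]
    _ = _ := one_mul _

/-- A contraction `V` and a positive `S` with `X = V S`, where `S` exceeds `|X|` by a scalar. -/
theorem exists_polar (X : H →L[ℂ] H) {ε : ℝ} (hε : 0 < ε) :
    ∃ V S : H →L[ℂ] H, ‖V‖ ≤ 1 ∧ 0 ≤ S ∧ X = V * S ∧ S = CFC.abs X + (ε : ℂ) • 1 ∧
      ∀ w, ‖CFC.abs X w - (ContinuousLinearMap.adjoint V * X) w‖ ≤ ε * ‖w‖ := by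
  set P := CFC.abs X with hP
  have hP0 : 0 ≤ P := CFC.abs_nonneg X
  have hPs : ContinuousLinearMap.adjoint P = P := hP0.isSelfAdjoint.star_eq
  set S := P + (ε : ℂ) • (1 : H →L[ℂ] H) with hS
  -- The cross term 2ε⟨v, Pv⟩ is nonnegative. This inequality makes both X S⁻¹ and P S⁻¹
  -- contractions.
  have hle (v : H) : ‖P v‖ ≤ ‖S v‖ := by
    have h1 : ‖S v‖ ^ 2 = ‖P v‖ ^ 2 + 2 * (ε * RCLike.re (inner ℂ v (P v))) + ‖(ε : ℂ) • v‖ ^ 2 := by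
      rw [hS, add_apply, norm_add_sq (𝕜 := ℂ)]
      have h2 : inner ℂ (P v) (((ε : ℂ) • (1 : H →L[ℂ] H)) v) = (ε : ℂ) * inner ℂ (P v) v :=
        inner_smul_right _ _ _
      have h3 : RCLike.re (inner ℂ (P v) v) = RCLike.re (inner ℂ v (P v)) :=
        inner_re_symm (𝕜 := ℂ) _ _
      rw [h2, ← h3]
      simp
    have h2 := re_inner_nonneg_of_nonneg hP0 v
    refine (sq_le_sq₀ (norm_nonneg _) (norm_nonneg _)).mp ?_
    have : 0 ≤ ε * RCLike.re (inner ℂ v (P v)) := mul_nonneg hε.le h2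
    nlinarith [sq_nonneg ‖(ε : ℂ) • v‖]
  -- If S = P + ε were not invertible, −ε would lie in the spectrum of the positive operator P.
  have hu : IsUnit S := by
    by_contra h
    have h1 : -ε ∈ spectrum ℝ P := by
      rw [spectrum.mem_iff]
      intro h2
      apply h
      have : S = -(algebraMap ℝ (H →L[ℂ] H) (-ε) - P) := by
        ext v
        simp [hS, Algebra.algebraMap_eq_smul_one]
      rw [this]
      exact h2.neg
    have := spectrum_nonneg_of_nonneg hP0 h1
    linarith
  obtain ⟨G, hG1, hG2⟩ : ∃ G, S * G = 1 ∧ G * S = 1 := ⟨_, hu.mul_val_inv, hu.val_inv_mul⟩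
  have hSs : IsSelfAdjoint S := by
    refine hP0.isSelfAdjoint.add (IsSelfAdjoint.smul ?_ (IsSelfAdjoint.one _))
    simp [IsSelfAdjoint]
  have hGs : ContinuousLinearMap.adjoint G = G := by
    have h1 : star G * S = 1 := by
      have := congrArg star hG1
      rwa [star_mul, hSs.star_eq, star_one] at this
    calc star G = star G * (S * G) := by rw [hG1, mul_one]
      _ = G := by rw [← mul_assoc, h1, one_mul]
  refine ⟨X * G, S, ?_, ?_, ?_, rfl, fun w => ?_⟩
  · refine ContinuousLinearMap.opNorm_le_bound _ zero_le_one fun v => ?_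
    rw [one_mul, mul_apply_eq_comp, ← norm_abs_apply]
    refine (hle _).trans ?_
    rw [← mul_apply_eq_comp, hG1]
    simp
  · refine add_nonneg hP0 ?_
    rw [ContinuousLinearMap.nonneg_iff_isPositive]
    refine ContinuousLinearMap.IsPositive.smul_of_nonneg ContinuousLinearMap.isPositive_one ?_
    exact_mod_cast hε.le
  · rw [mul_assoc, hG2, mul_one]
  · have h1 : ContinuousLinearMap.adjoint (X * G) * X = G * (P * P) := by
      have : ContinuousLinearMap.adjoint (X * G) = star G * star X := star_mul _ _
      rw [this, mul_assoc, ← CFC.abs_mul_abs X]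
      congr 1
    have hcomm : P * G = G * P := by
      have h3 : P * S = S * P := by
        rw [hS, mul_add, add_mul, mul_smul_comm, smul_mul_assoc, one_mul, mul_one]
      calc P * G = G * S * P * G := by rw [hG2, one_mul]
        _ = G * (P * S) * G := by rw [h3, mul_assoc G]
        _ = G * P := by rw [mul_assoc, mul_assoc, hG1, mul_one]
    -- With V = X S⁻¹, the operator V†X misses |X| by ε P S⁻¹, whose norm is at most ε.
    have h2 : P - G * (P * P) = P * ((ε : ℂ) • G) := by
      have : P = S - (ε : ℂ) • 1 := by simp [hS]
      have h4 : G * (P * P) = P * (G * P) := by rw [← mul_assoc, ← mul_assoc, hcomm]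
      rw [h4]
      nth_rewrite 3 [this]
      rw [mul_sub, hG2, mul_sub, mul_one, mul_smul_comm, mul_one, mul_smul_comm]
      abel
    rw [h1, ← sub_apply, h2, mul_smul_comm, smul_apply,
      norm_smul, Complex.norm_real, Real.norm_of_nonneg hε.le, mul_apply_eq_comp]
    gcongr
    refine (hle _).trans ?_
    rw [← mul_apply_eq_comp, hG1]
    simp

/-- Writing X = V S and S = T², each summand becomes ⟨T(KV)†e_i, T B e_i⟩. Cauchy–Schwarz leaves
sums Σ ‖T C e_i‖² with C a contraction, which `sum_norm_sq_comp_le` turns into partial traces of S =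
|X| + ε. -/
theorem norm_sum_inner_le {X K B : H →L[ℂ] H} (hK : ‖K‖ ≤ 1) (hB : ‖B‖ ≤ 1) {n : ℕ}
    {e : Fin n → H} (he : Orthonormal ℂ e) :
    ENNReal.ofReal ‖∑ i, inner ℂ (e i) ((K * X * B) (e i))‖ ≤ traceNorm X := by
  refine ENNReal.le_of_forall_pos_le_add fun δ hδ _ => ?_
  obtain ⟨ε, hε, hεn⟩ : ∃ ε : ℝ, 0 < ε ∧ n * ε ≤ δ := by
    refine ⟨δ / (n + 1), by positivity, ?_⟩
    rw [mul_div_assoc', div_le_iff₀ (by positivity)]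
    nlinarith [δ.2]
  obtain ⟨V, S, hV, hS0, hX, hS, -⟩ := exists_polar X hε
  set T := CFC.sqrt S with hT
  have hTs : IsSelfAdjoint T := (CFC.sqrt_nonneg S).isSelfAdjoint
  have hT' : ContinuousLinearMap.adjoint T = T := hTs.star_eq
  have hTT : T * T = S := CFC.sqrt_mul_sqrt_self S hS0
  have hC : ‖ContinuousLinearMap.adjoint (K * V)‖ ≤ 1 := by
    rw [LinearIsometryEquiv.norm_map]
    exact (norm_mul_le _ _).trans (mul_le_one₀ hK (norm_nonneg _) hV)
  have bound {C : H →L[ℂ] H} (hC : ‖C‖ ≤ 1) :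
      ENNReal.ofReal (∑ i, ‖T (C (e i))‖ ^ 2) ≤ traceNorm X + δ := by
    obtain ⟨m, f, hm, hf, hle⟩ := sum_norm_sq_comp_le hTs hC he
    have h1 (j) : ‖T (f j)‖ ^ 2 = RCLike.re (inner ℂ (f j) (CFC.abs X (f j))) + ε := by
      have h2 : inner ℂ (T (f j)) (T (f j)) = inner ℂ (f j) (S (f j)) := by
        rw [← ContinuousLinearMap.adjoint_inner_right, hT', ← mul_apply_eq_comp, hTT]
      have h3 : inner ℂ (f j) (S (f j)) = inner ℂ (f j) (CFC.abs X (f j)) + (ε : ℂ) := by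
        have h4 : S (f j) = CFC.abs X (f j) + (ε : ℂ) • f j := by rw [hS]; rfl
        rw [h4, inner_add_right, inner_smul_right, inner_self_eq_norm_sq_to_K, hf.1 j]
        simp
      rw [← inner_self_eq_norm_sq (𝕜 := ℂ), h2, h3, map_add]
      simp
    simp_rw [h1, Finset.sum_add_distrib] at hle
    refine (ENNReal.ofReal_le_ofReal hle).trans ?_
    rw [ENNReal.ofReal_add (Finset.sum_nonneg fun j _ =>
      re_inner_nonneg_of_nonneg (CFC.abs_nonneg X) _) (Finset.sum_nonneg fun _ _ => hε.le)]
    refine add_le_add ?_ ?_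
    · rw [ENNReal.ofReal_sum_of_nonneg fun j _ =>
        re_inner_nonneg_of_nonneg (CFC.abs_nonneg X) _]
      exact posTrace_ge _ hf
    · refine ENNReal.ofReal_le_of_le_toReal ?_
      rw [ENNReal.coe_toReal]
      simp only [Finset.sum_const, Finset.card_univ, Fintype.card_fin, nsmul_eq_mul]
      refine le_trans ?_ hεn
      gcongr
  have hsum : ‖∑ i, inner ℂ (e i) ((K * X * B) (e i))‖ ≤
      ((∑ i, ‖T (ContinuousLinearMap.adjoint (K * V) (e i))‖ ^ 2) +
        ∑ i, ‖T (B (e i))‖ ^ 2) / 2 := by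
    rw [← Finset.sum_add_distrib, Finset.sum_div]
    refine norm_sum_le_of_le _ fun i _ => ?_
    have : K * X * B = (K * V) * (T * (T * B)) := by
      rw [hX, ← hTT]; simp only [mul_assoc]
    rw [this, mul_apply_eq_comp, ← ContinuousLinearMap.adjoint_inner_left,
      mul_apply_eq_comp T, ← ContinuousLinearMap.adjoint_inner_left, hT']
    refine (norm_inner_le_norm _ _).trans ?_
    rw [mul_apply_eq_comp T]
    nlinarith [sq_nonneg (‖T (ContinuousLinearMap.adjoint (K * V) (e i))‖ - ‖T (B (e i))‖)]
  have h1 := bound hC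
  have h2 := bound hB
  refine (ENNReal.ofReal_le_ofReal hsum).trans ?_
  rcases eq_or_ne (traceNorm X) ⊤ with ht | ht
  · simp [ht]
  have ht' : traceNorm X + δ ≠ ⊤ := by simp [ht]
  rw [← ENNReal.ofReal_toReal ht'] at h1 h2 ⊢
  rw [ENNReal.ofReal_le_ofReal_iff ENNReal.toReal_nonneg] at h1 h2
  apply ENNReal.ofReal_le_ofReal
  linarith

/-- Converse half of the duality: K = V† from `exists_polar` recovers the partial traces of |X| with
a loss of at most ε per vector. -/
theorem traceNorm_le {X : H →L[ℂ] H} {c : ℝ≥0∞}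
    (h : ∀ K : H →L[ℂ] H, ‖K‖ ≤ 1 → ∀ (n : ℕ) (e : Fin n → H), Orthonormal ℂ e →
      ENNReal.ofReal ‖∑ i, inner ℂ (e i) ((K * X) (e i))‖ ≤ c) : traceNorm X ≤ c := by
  refine iSup_le fun n => iSup_le fun e => iSup_le fun he => ?_
  refine ENNReal.le_of_forall_pos_le_add fun δ hδ _ => ?_
  obtain ⟨ε, hε, hεn⟩ : ∃ ε : ℝ, 0 < ε ∧ n * ε ≤ δ := by
    refine ⟨δ / (n + 1), by positivity, ?_⟩
    rw [mul_div_assoc', div_le_iff₀ (by positivity)]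
    nlinarith [δ.2]
  obtain ⟨V, S, hV, -, -, -, hW⟩ := exists_polar X hε
  have h1 := h (ContinuousLinearMap.adjoint V) (by rwa [LinearIsometryEquiv.norm_map]) n e he
  rw [← ENNReal.ofReal_sum_of_nonneg fun j _ =>
        re_inner_nonneg_of_nonneg (CFC.abs_nonneg X) _]
  refine le_trans ?_ (add_le_add_left h1 _)
  rw [← ENNReal.ofReal_coe_nnreal, ← ENNReal.ofReal_add (norm_nonneg _) δ.coe_nonneg]
  apply ENNReal.ofReal_le_ofReal
  have h2 : ∑ i, RCLike.re (inner ℂ (e i) (CFC.abs X (e i))) ≤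
      ∑ i, (RCLike.re (inner ℂ (e i) ((ContinuousLinearMap.adjoint V * X) (e i))) + ε) := by
    refine Finset.sum_le_sum fun i _ => ?_
    have h3 : RCLike.re (inner ℂ (e i) (CFC.abs X (e i) -
        (ContinuousLinearMap.adjoint V * X) (e i))) ≤ ε := by
      refine (RCLike.re_le_norm _).trans ((norm_inner_le_norm _ _).trans ?_)
      have := hW (e i)
      rw [he.1 i] at this ⊢
      linarith
    rw [inner_sub_right, map_sub] at h3
    linarith
  rw [Finset.sum_add_distrib] at h2
  simp only [Finset.sum_const, Finset.card_univ, Fintype.card_fin, nsmul_eq_mul] at h2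
  have h4 := RCLike.re_le_norm (∑ i, inner ℂ (e i) ((ContinuousLinearMap.adjoint V * X) (e i)))
  rw [map_sum] at h4
  linarith

theorem traceNorm_add_le (X Y : H →L[ℂ] H) : traceNorm (X + Y) ≤ traceNorm X + traceNorm Y := by
  refine traceNorm_le fun K hK n e he => ?_
  have h1 := norm_sum_inner_le (X := X) (B := 1) hK ContinuousLinearMap.norm_id_le he
  have h2 := norm_sum_inner_le (X := Y) (B := 1) hK ContinuousLinearMap.norm_id_le he
  refine le_trans ?_ (add_le_add h1 h2)
  rw [← ENNReal.ofReal_add (norm_nonneg _) (norm_nonneg _)]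
  apply ENNReal.ofReal_le_ofReal
  simp only [mul_add, mul_one, add_apply, inner_add_right,
    Finset.sum_add_distrib]
  exact norm_add_le _ _

/-- The factors K and B are rescaled to contractions and absorbed into the test operators of
`norm_sum_inner_le`; the cases a = 0 and b = 0 are split off because the rescaling divides by them.
-/
theorem traceNorm_mul_mul_le (X : H →L[ℂ] H) {K B : H →L[ℂ] H} {a b : ℝ} (hK : ‖K‖ ≤ a)
    (hB : ‖B‖ ≤ b) : traceNorm (K * X * B) ≤ ENNReal.ofReal (a * b) * traceNorm X := by
  refine traceNorm_le fun C hC n e he => ?_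
  have ha0 : 0 ≤ a := (norm_nonneg _).trans hK
  have hb0 : 0 ≤ b := (norm_nonneg _).trans hB
  rcases ha0.eq_or_lt with rfl | ha
  · rw [norm_le_zero_iff.mp hK]; simp
  rcases hb0.eq_or_lt with rfl | hb
  · rw [norm_le_zero_iff.mp hB]; simp
  have hK' : ‖((a⁻¹ : ℝ) : ℂ) • (C * K)‖ ≤ 1 := by
    rw [norm_smul, Complex.norm_real, norm_inv, Real.norm_of_nonneg ha.le, inv_mul_le_one₀ ha]
    calc _ ≤ ‖C‖ * ‖K‖ := norm_mul_le _ _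
      _ ≤ 1 * a := by gcongr
      _ = a := one_mul a
  have hB' : ‖((b⁻¹ : ℝ) : ℂ) • B‖ ≤ 1 := by
    rw [norm_smul, Complex.norm_real, norm_inv, Real.norm_of_nonneg hb.le, inv_mul_le_one₀ hb]
    exact hB
  have h := norm_sum_inner_le (X := X) hK' hB' he
  have h2 : ‖∑ i, inner ℂ (e i) ((C * (K * X * B)) (e i))‖ = a * b *
      ‖∑ i, inner ℂ (e i) ((((a⁻¹ : ℝ) : ℂ) • (C * K) * X * (((b⁻¹ : ℝ) : ℂ) • B)) (e i))‖ := by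
    have h3 : C * (K * X * B) = ((a * b : ℝ) : ℂ) •
        (((a⁻¹ : ℝ) : ℂ) • (C * K) * X * (((b⁻¹ : ℝ) : ℂ) • B)) := by
      simp only [smul_mul_assoc, mul_smul_comm, smul_smul, mul_assoc]
      rw [← Complex.ofReal_mul, ← Complex.ofReal_mul]
      field_simp
      simp
    rw [h3]
    simp only [smul_apply, inner_smul_right, ← Finset.mul_sum]
    rw [norm_mul, Complex.norm_real, Real.norm_of_nonneg (by positivity)]
  rw [h2, ENNReal.ofReal_mul (by positivity)]
  gcongr

end TraceNorm

/-! ### Diamond norm calculus for maps ρ ↦ VρV†. -/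

section Diamond

open ContinuousLinearMap

variable {H : Type*} [NormedAddCommGroup H] [InnerProductSpace ℂ H] [CompleteSpace H]

theorem adjoint_slot_apply (n : ℕ) (a : Fin n) (x : H) :
    adjoint (slot n a) x = PiLp.single 2 a x := by
  refine ext_inner_left ℂ fun y => ?_
  rw [adjoint_inner_right, PiLp.inner_apply, Finset.sum_eq_single a]
  · simp [slot]
  · intro b _ hb
    simp [hb]
  · simp

/-- The operator `V ⊗ 1` on `H ⊗ ℂⁿ`. -/
def ampOp (n : ℕ) (V : H →L[ℂ] H) : Amp H n →L[ℂ] Amp H n :=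
  ∑ a : Fin n, adjoint (slot n a) ∘L V ∘L slot n a

theorem ampOp_apply (n : ℕ) (V : H →L[ℂ] H) (x : Amp H n) (a : Fin n) :
    ampOp n V x a = V (x a) := by
  have : ampOp n V x = ∑ b : Fin n, PiLp.single 2 b (V (x b)) := by
    simp only [ampOp, sum_apply, comp_apply, adjoint_slot_apply]
    rfl
  rw [this, WithLp.ofLp_sum, Finset.sum_apply, Finset.sum_eq_single a]
  · simp
  · intro b _ hb
    simp [hb.symm]
  · simp

theorem adjoint_ampOp (n : ℕ) (V : H →L[ℂ] H) : adjoint (ampOp n V) = ampOp n (adjoint V) := by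
  simp only [ampOp, map_sum, adjoint_comp, adjoint_adjoint]
  rfl

theorem ampOp_sub (n : ℕ) (V W : H →L[ℂ] H) : ampOp n (V - W) = ampOp n V - ampOp n W := by
  ext x a
  simp [ampOp_apply]

theorem norm_ampOp_le (n : ℕ) {V : H →L[ℂ] H} {c : ℝ} (hV : ‖V‖ ≤ c) : ‖ampOp n V‖ ≤ c := by
  have hc : 0 ≤ c := (norm_nonneg _).trans hV
  refine opNorm_le_bound _ hc fun x => ?_
  refine (sq_le_sq₀ (norm_nonneg _) (by positivity)).mp ?_
  rw [mul_pow, PiLp.norm_sq_eq_of_L2, PiLp.norm_sq_eq_of_L2, Finset.mul_sum]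
  refine Finset.sum_le_sum fun a _ => ?_
  rw [ampOp_apply, ← mul_pow]
  gcongr
  exact V.le_of_opNorm_le hV _

theorem amplify_conjMap (n : ℕ) (V : H →L[ℂ] H) (A : Amp H n →L[ℂ] Amp H n) :
    amplify (conjMap V) n A = ampOp n V * A * adjoint (ampOp n V) := by
  rw [adjoint_ampOp]
  ext1 x
  simp only [amplify, ampOp, conjMap, LinearMap.coe_mk, AddHom.coe_mk, mul_apply_eq_comp,
    sum_apply, comp_apply, map_sum]
  exact Finset.sum_comm

theorem amplify_sub (n : ℕ) (E F : (H →L[ℂ] H) →ₗ[ℂ] (H →L[ℂ] H))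
    (A : Amp H n →L[ℂ] Amp H n) : amplify (E - F) n A = amplify E n A - amplify F n A := by
  ext1 x
  simp [amplify]

theorem amplify_add (n : ℕ) (E F : (H →L[ℂ] H) →ₗ[ℂ] (H →L[ℂ] H))
    (A : Amp H n →L[ℂ] Amp H n) : amplify (E + F) n A = amplify E n A + amplify F n A := by
  ext1 x
  simp [amplify, Finset.sum_add_distrib]

/-- R ⊗ 1 acts within each slot, so extracting the block (a, b) of (R ⊗ 1) A (R ⊗ 1)† conjugates the
block of A by R. -/
theorem amplify_comp_conjMap (n : ℕ) (E : (H →L[ℂ] H) →ₗ[ℂ] (H →L[ℂ] H)) (R : H →L[ℂ] H)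
    (A : Amp H n →L[ℂ] Amp H n) :
    amplify (E ∘ₗ conjMap R) n A = amplify E n (ampOp n R * A * adjoint (ampOp n R)) := by
  have h1 (a : Fin n) (B : H →L[ℂ] H) : slot n a ∘L ampOp n B = B ∘L slot n a := by
    ext x
    exact ampOp_apply n B x a
  have h2 (b : Fin n) : adjoint (ampOp n R) ∘L adjoint (slot n b) =
      adjoint (slot n b) ∘L adjoint R := by
    rw [← adjoint_comp, h1, adjoint_comp]
  have h3 (a b : Fin n) : slot n a ∘L (ampOp n R * A * adjoint (ampOp n R)) ∘L adjoint (slot n b) =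
      conjMap R (slot n a ∘L A ∘L adjoint (slot n b)) := by
    calc _ = (slot n a ∘L ampOp n R) ∘L A ∘L (adjoint (ampOp n R) ∘L adjoint (slot n b)) := rfl
      _ = _ := by rw [h1, h2]; rfl
  simp only [amplify, LinearMap.comp_apply, h3]

theorem le_diamondNorm (E : (H →L[ℂ] H) →ₗ[ℂ] (H →L[ℂ] H)) {n : ℕ}
    {A : Amp H n →L[ℂ] Amp H n} (hA : traceNorm A ≤ 1) :
    traceNorm (amplify E n A) ≤ diamondNorm E :=
  le_iSup_of_le n (le_iSup_of_le A (le_iSup_of_le hA le_rfl))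

theorem diamondNorm_add_le (E F : (H →L[ℂ] H) →ₗ[ℂ] (H →L[ℂ] H)) :
    diamondNorm (E + F) ≤ diamondNorm E + diamondNorm F := by
  refine iSup_le fun n => iSup_le fun A => iSup_le fun hA => ?_
  rw [amplify_add]
  exact (traceNorm_add_le _ _).trans (add_le_add (le_diamondNorm E hA) (le_diamondNorm F hA))

/-- Conjugation by the contraction R ⊗ 1 maps the trace norm unit ball into itself. -/
theorem diamondNorm_comp_conjMap_le (E : (H →L[ℂ] H) →ₗ[ℂ] (H →L[ℂ] H)) {R : H →L[ℂ] H}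
    (hR : ‖R‖ ≤ 1) : diamondNorm (E ∘ₗ conjMap R) ≤ diamondNorm E := by
  refine iSup_le fun n => iSup_le fun A => iSup_le fun hA => ?_
  rw [amplify_comp_conjMap]
  apply le_diamondNorm
  have h := traceNorm_mul_mul_le A (norm_ampOp_le n hR)
    (B := adjoint (ampOp n R)) (b := 1)
    (by rw [LinearIsometryEquiv.norm_map]; exact norm_ampOp_le n hR)
  simpa using h.trans (mul_le_mul_right hA _)

/-- VAV† − WAW† = (V − W)AV† + WA(V − W)†, and the ideal property bounds each term by δ‖A‖₁. -/
theorem diamondNorm_conjMap_sub_le {V W : H →L[ℂ] H} {δ : ℝ} (hV : ‖V‖ ≤ 1) (hW : ‖W‖ ≤ 1)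
    (h : ‖V - W‖ ≤ δ) : diamondNorm (conjMap V - conjMap W) ≤ ENNReal.ofReal (2 * δ) := by
  refine iSup_le fun n => iSup_le fun A => iSup_le fun hA => ?_
  have hδ : 0 ≤ δ := (norm_nonneg _).trans h
  have key : amplify (conjMap V - conjMap W) n A =
      ampOp n (V - W) * A * adjoint (ampOp n V) + ampOp n W * A * adjoint (ampOp n (V - W)) := by
    rw [amplify_sub, amplify_conjMap, amplify_conjMap, ampOp_sub, map_sub]
    simp only [sub_mul, mul_sub]
    abel
  have h1 := traceNorm_mul_mul_le A (norm_ampOp_le n h) (B := adjoint (ampOp n V)) (b := 1)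
    (by rw [LinearIsometryEquiv.norm_map]; exact norm_ampOp_le n hV)
  have h2 := traceNorm_mul_mul_le A (norm_ampOp_le n hW) (B := adjoint (ampOp n (V - W))) (b := δ)
    (by rw [LinearIsometryEquiv.norm_map]; exact norm_ampOp_le n h)
  rw [key]
  refine (traceNorm_add_le _ _).trans ((add_le_add h1 h2).trans ?_)
  rw [mul_one, one_mul, ← add_mul, ← ENNReal.ofReal_add hδ hδ, two_mul]
  exact mul_le_of_le_one_right' hA

theorem conjMap_comp {K L : Type*} [NormedAddCommGroup K] [InnerProductSpace ℂ K]
    [CompleteSpace K] [NormedAddCommGroup L] [InnerProductSpace ℂ L] [CompleteSpace L]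
    (V : K →L[ℂ] L) (W : H →L[ℂ] K) : conjMap V ∘ₗ conjMap W = conjMap (V ∘L W) := by
  ext1 ρ
  simp only [conjMap, LinearMap.comp_apply, LinearMap.coe_mk, AddHom.coe_mk, adjoint_comp]
  rfl

/-- Serves to discard the global phase e^{iπ/4} in the implementation of F. -/
theorem conjMap_smul {K : Type*} [NormedAddCommGroup K] [InnerProductSpace ℂ K]
    [CompleteSpace K] {c : ℂ} (hc : ‖c‖ = 1) (V : H →L[ℂ] K) : conjMap (c • V) = conjMap V := by
  have h1 : starRingEnd ℂ c * c = 1 := by rw [RCLike.conj_mul, hc]; simp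
  ext1 ρ
  simp only [conjMap, LinearMap.coe_mk, AddHom.coe_mk]
  rw [show adjoint (c • V) = starRingEnd ℂ c • adjoint V from map_smulₛₗ _ _ _]
  ext1 x
  simp [smul_smul, h1]

end Diamond

/-! ### Logical error: dependence on the encoding, and a bound by the action on basis states. -/

section LogicalError

open ContinuousLinearMap

variable {H : Type*} [NormedAddCommGroup H] [InnerProductSpace ℂ H] [CompleteSpace H] {d : ℕ}

/-- The encoding as an isometry into the ambient space. -/
def encIsom {L : Submodule ℂ H} (enc : EuclideanSpace ℂ (Fin d) ≃ₗᵢ[ℂ] L) :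
    EuclideanSpace ℂ (Fin d) →ₗᵢ[ℂ] H :=
  L.subtypeₗᵢ.comp enc.toLinearIsometry

theorem adjoint_comp_isometry {E : Type*} [NormedAddCommGroup E] [InnerProductSpace ℂ E]
    [CompleteSpace E] (S : E →ₗᵢ[ℂ] H) :
    adjoint S.toContinuousLinearMap ∘L S.toContinuousLinearMap = 1 := by
  ext v
  refine ext_inner_left ℂ fun w => ?_
  rw [comp_apply, adjoint_inner_right]
  exact S.inner_map_map w v

/-- With S the encoding viewed as an isometry into H, S† is projection followed by decoding and SS†
is the projection onto the code. Both channels thus become conjugations by operators on H. -/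
theorem logicalError_eq {L : Submodule ℂ H} (enc : EuclideanSpace ℂ (Fin d) ≃ₗᵢ[ℂ] L)
    (W : H ≃ₗᵢ[ℂ] H) (U : Matrix (Fin d) (Fin d) ℂ) :
    logicalError enc W U = diamondNorm
      (conjMap ((W : H →L[ℂ] H) ∘L (encIsom enc).toContinuousLinearMap ∘L
          adjoint (encIsom enc).toContinuousLinearMap) -
        conjMap ((encIsom enc).toContinuousLinearMap ∘L Matrix.toEuclideanCLM (𝕜 := ℂ) U ∘L
          adjoint (encIsom enc).toContinuousLinearMap)) := by
  have : FiniteDimensional ℂ L := enc.toLinearEquiv.finiteDimensional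
  have : CompleteSpace L := FiniteDimensional.complete ℂ L
  have h1 : (enc.symm : L →L[ℂ] EuclideanSpace ℂ (Fin d)) ∘L L.orthogonalProjectionOnto =
      adjoint (encIsom enc).toContinuousLinearMap := by
    ext1 x
    refine ext_inner_left ℂ fun v => ?_
    rw [adjoint_inner_right]
    change inner ℂ v (enc.symm (L.orthogonalProjectionOnto x)) = inner ℂ (enc v : H) x
    rw [← enc.inner_map_map, LinearIsometryEquiv.apply_symm_apply,
      Submodule.inner_orthogonalProjectionOnto_eq_of_mem_left]
  have h2 : L.subtypeL ∘L L.orthogonalProjectionOnto =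
      (encIsom enc).toContinuousLinearMap ∘L adjoint (encIsom enc).toContinuousLinearMap := by
    rw [← h1]
    ext1 x
    exact congrArg Subtype.val (enc.apply_symm_apply _).symm
  rw [logicalError, LinearMap.sub_comp, LinearMap.comp_assoc, LinearMap.comp_assoc,
    conjMap_comp, conjMap_comp, conjMap_comp, conjMap_comp, h2, ← h1]
  rfl

variable {L M : Submodule ℂ H}

theorem norm_comp_le_one {E F G : Type*} [NormedAddCommGroup E] [InnerProductSpace ℂ E]
    [NormedAddCommGroup F] [InnerProductSpace ℂ F] [NormedAddCommGroup G] [InnerProductSpace ℂ G]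
    {A : F →L[ℂ] G} {B : E →L[ℂ] F} (hA : ‖A‖ ≤ 1) (hB : ‖B‖ ≤ 1) : ‖A ∘L B‖ ≤ 1 :=
  (opNorm_comp_le _ _).trans (mul_le_one₀ hA (norm_nonneg _) hB)

theorem norm_toEuclideanCLM_le {U : Matrix (Fin d) (Fin d) ℂ}
    (hU : U ∈ Matrix.unitaryGroup (Fin d) ℂ) : ‖Matrix.toEuclideanCLM (𝕜 := ℂ) U‖ ≤ 1 := by
  have h := Unitary.map_mem (Matrix.toEuclideanCLM (n := Fin d) (𝕜 := ℂ)) hU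
  refine opNorm_le_bound _ zero_le_one fun v => ?_
  rw [norm_map_of_mem_unitary h, one_mul]

/-- Precomposing the error map of the encoding S with conjugation by the contraction ST† turns WSS†
and SuS† into WST† and SuT†, at no cost. Changing the remaining S into T moves each of the two by at
most δ in operator norm, hence costs 2δ twice. -/
theorem logicalError_le_add (enc : EuclideanSpace ℂ (Fin d) ≃ₗᵢ[ℂ] L)
    (enc' : EuclideanSpace ℂ (Fin d) ≃ₗᵢ[ℂ] M) (W : H ≃ₗᵢ[ℂ] H) {U : Matrix (Fin d) (Fin d) ℂ}
    (hU : U ∈ Matrix.unitaryGroup (Fin d) ℂ) {δ : ℝ} (hδ : 0 ≤ δ)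
    (h : ∀ v, ‖(enc' v : H) - enc v‖ ≤ δ * ‖v‖) :
    logicalError enc' W U ≤ logicalError enc W U + ENNReal.ofReal (4 * δ) := by
  rw [logicalError_eq, logicalError_eq]
  set S := (encIsom enc).toContinuousLinearMap with hS
  set T := (encIsom enc').toContinuousLinearMap with hT
  set u := Matrix.toEuclideanCLM (𝕜 := ℂ) U with hu
  have hS1 : ‖S‖ ≤ 1 := (encIsom enc).norm_toContinuousLinearMap_le
  have hT1 : ‖T‖ ≤ 1 := (encIsom enc').norm_toContinuousLinearMap_le
  have hSa : ‖adjoint S‖ ≤ 1 := by rwa [LinearIsometryEquiv.norm_map]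
  have hTa : ‖adjoint T‖ ≤ 1 := by rwa [LinearIsometryEquiv.norm_map]
  have hu1 : ‖u‖ ≤ 1 := norm_toEuclideanCLM_le hU
  have hW1 : ‖(W : H →L[ℂ] H)‖ ≤ 1 := W.toLinearIsometry.norm_toContinuousLinearMap_le
  have hSS : adjoint S ∘L S = 1 := adjoint_comp_isometry _
  have hTS : ‖T - S‖ ≤ δ := opNorm_le_bound _ hδ h
  have hST : ‖S - T‖ ≤ δ := by rwa [norm_sub_rev]
  have key : conjMap ((W : H →L[ℂ] H) ∘L T ∘L adjoint T) - conjMap (T ∘L u ∘L adjoint T) =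
      (conjMap ((W : H →L[ℂ] H) ∘L S ∘L adjoint S) - conjMap (S ∘L u ∘L adjoint S)) ∘ₗ
          conjMap (S ∘L adjoint T) +
        ((conjMap ((W : H →L[ℂ] H) ∘L T ∘L adjoint T) -
          conjMap ((W : H →L[ℂ] H) ∘L S ∘L adjoint T)) +
        (conjMap (S ∘L u ∘L adjoint T) - conjMap (T ∘L u ∘L adjoint T))) := by
    have h1 : ((W : H →L[ℂ] H) ∘L S ∘L adjoint S) ∘L S ∘L adjoint T =
        (W : H →L[ℂ] H) ∘L S ∘L adjoint T :=
      calc _ = (W : H →L[ℂ] H) ∘L S ∘L (adjoint S ∘L S) ∘L adjoint T := rfl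
        _ = _ := by rw [hSS]; rfl
    have h2 : (S ∘L u ∘L adjoint S) ∘L S ∘L adjoint T = S ∘L u ∘L adjoint T :=
      calc _ = S ∘L u ∘L (adjoint S ∘L S) ∘L adjoint T := rfl
        _ = _ := by rw [hSS]; rfl
    rw [LinearMap.sub_comp, conjMap_comp, conjMap_comp, h1, h2]
    abel
  rw [key]
  refine (diamondNorm_add_le _ _).trans (add_le_add ?_ ?_)
  · exact diamondNorm_comp_conjMap_le _ (norm_comp_le_one hS1 hTa)
  refine (diamondNorm_add_le _ _).trans ?_
  rw [show 4 * δ = 2 * δ + 2 * δ by ring, ENNReal.ofReal_add (by positivity) (by positivity)]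
  refine add_le_add ?_ ?_
  · refine diamondNorm_conjMap_sub_le (norm_comp_le_one hW1 (norm_comp_le_one hT1 hTa))
      (norm_comp_le_one hW1 (norm_comp_le_one hS1 hTa)) ?_
    rw [← comp_sub, ← sub_comp]
    exact (opNorm_comp_le _ _).trans ((mul_le_of_le_one_left (norm_nonneg _) hW1).trans
      ((opNorm_comp_le _ _).trans ((mul_le_of_le_one_right (norm_nonneg _) hTa).trans hTS)))
  · refine diamondNorm_conjMap_sub_le (norm_comp_le_one hS1 (norm_comp_le_one hu1 hTa))
      (norm_comp_le_one hT1 (norm_comp_le_one hu1 hTa)) ?_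
    rw [← sub_comp]
    exact (opNorm_comp_le _ _).trans ((mul_le_of_le_one_right (norm_nonneg _)
      (norm_comp_le_one hu1 hTa)).trans hST)

/-- The logical error is controlled by the action of `W` on the encoded basis, up to a phase. -/
theorem logicalError_le_sum (enc : EuclideanSpace ℂ (Fin d) ≃ₗᵢ[ℂ] L) (W : H ≃ₗᵢ[ℂ] H)
    {U : Matrix (Fin d) (Fin d) ℂ} (hU : U ∈ Matrix.unitaryGroup (Fin d) ℂ) {c : ℂ}
    (hc : ‖c‖ = 1) :
    logicalError enc W U ≤ ENNReal.ofReal (2 * ∑ j, ‖W (enc (EuclideanSpace.single j 1)) -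
      c • ∑ k, U k j • (enc (EuclideanSpace.single k 1) : H)‖) := by
  rw [logicalError_eq]
  set S := (encIsom enc).toContinuousLinearMap with hS
  set u := Matrix.toEuclideanCLM (𝕜 := ℂ) U with hu
  have hS1 : ‖S‖ ≤ 1 := (encIsom enc).norm_toContinuousLinearMap_le
  have hSa : ‖adjoint S‖ ≤ 1 := by rwa [LinearIsometryEquiv.norm_map]
  have hu1 : ‖u‖ ≤ 1 := norm_toEuclideanCLM_le hU
  have hW1 : ‖(W : H →L[ℂ] H)‖ ≤ 1 := W.toLinearIsometry.norm_toContinuousLinearMap_le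
  have h1 : ‖S ∘L u ∘L adjoint S‖ ≤ 1 := norm_comp_le_one hS1 (norm_comp_le_one hu1 hSa)
  -- Conjugation does not see the phase c, so it may be inserted before operators are compared.
  rw [← conjMap_smul hc (S ∘L u ∘L adjoint S)]
  refine diamondNorm_conjMap_sub_le (norm_comp_le_one hW1 (norm_comp_le_one hS1 hSa))
    (by rwa [norm_smul, hc, one_mul]) ?_
  have h2 : (W : H →L[ℂ] H) ∘L S ∘L adjoint S - c • (S ∘L u ∘L adjoint S) =
      ((W : H →L[ℂ] H) ∘L S - c • (S ∘L u)) ∘L adjoint S := by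
    ext x; simp
  rw [h2]
  refine (opNorm_comp_le _ _).trans ((mul_le_of_le_one_right (norm_nonneg _) hSa).trans ?_)
  refine opNorm_le_bound _ (Finset.sum_nonneg fun _ _ => norm_nonneg _) fun v => ?_
  have h3 : v = ∑ j, v j • EuclideanSpace.single j (1 : ℂ) := by
    simpa using ((EuclideanSpace.basisFun (Fin d) ℂ).sum_repr v).symm
  conv_lhs => rw [h3, map_sum]
  rw [Finset.sum_mul]
  refine norm_sum_le_of_le _ fun j _ => ?_
  rw [map_smul, norm_smul, mul_comm]
  refine mul_le_mul (le_of_eq ?_) (PiLp.norm_apply_le v j) (norm_nonneg _) (norm_nonneg _)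
  congr 1
  have h4 : u (EuclideanSpace.single j 1) = ∑ k, U k j • EuclideanSpace.single k (1 : ℂ) := by
    ext i
    rw [hu, Matrix.ofLp_toEuclideanCLM]
    simp [Pi.single_apply]
  simp only [sub_apply, comp_apply, smul_apply, h4, map_sum, map_smul]
  rfl

end LogicalError

/-! ### Commutation relations of translation, modulation, squeezing and the Fourier transform. -/

section Covariance

theorem translation_translation (a b : ℝ) (f : L2R) :
    translation a (translation b f) = translation (a + b) f := by
  apply Lp.ext
  refine (translation_coeFn a _).trans (.trans ?_ (translation_coeFn (a + b) f).symm)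
  have h := (quasi_affine one_pos a).ae_eq_comp (translation_coeFn b f)
  filter_upwards [h] with x hx
  simp only [Function.comp, div_one] at hx
  rw [hx, sub_sub]

theorem translation_squeezing {α : ℝ} (hα : 0 < α) (b : ℝ) (f : L2R) :
    translation (α * b) (squeezing hα f) = squeezing hα (translation b f) := by
  apply Lp.ext
  refine (translation_coeFn _ _).trans (.trans ?_ (squeezing_coeFn hα _).symm)
  have h1 := (quasi_affine one_pos (α * b)).ae_eq_comp (squeezing_coeFn hα f)
  have h2 := (quasi_affine hα 0).ae_eq_comp (translation_coeFn b f)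
  filter_upwards [h1, h2] with x hx hy
  simp only [Function.comp, div_one, sub_zero] at hx hy
  rw [hx, hy]
  congr 2
  field_simp

theorem squeezing_squeezing {α β γ : ℝ} (hα : 0 < α) (hβ : 0 < β) (hγ : 0 < γ) (h : α * β = γ)
    (f : L2R) : squeezing hα (squeezing hβ f) = squeezing hγ f := by
  subst h
  apply Lp.ext
  refine (squeezing_coeFn hα _).trans (.trans ?_ (squeezing_coeFn hγ f).symm)
  have h := (quasi_affine hα 0).ae_eq_comp (squeezing_coeFn hβ f)
  filter_upwards [h] with x hx
  simp only [Function.comp, sub_zero] at hx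
  rw [hx, Real.sqrt_mul hα.le, div_div]
  push_cast
  field_simp

theorem modulation_squeezing {α : ℝ} (hα : 0 < α) (a : ℝ) (f : L2R) :
    modulation a (squeezing hα f) = squeezing hα (modulation (a * α) f) := by
  apply Lp.ext
  refine (modulation_coeFn _ _).trans (.trans ?_ (squeezing_coeFn hα _).symm)
  have h2 := (quasi_affine hα 0).ae_eq_comp (modulation_coeFn (a * α) f)
  filter_upwards [squeezing_coeFn hα f, h2] with x hx hy
  simp only [Function.comp, sub_zero] at hy
  rw [hx, hy]
  have : a * α * (x / α) = a * x := by field_simp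
  rw [this]
  ring

theorem modulation_translation (a b : ℝ) (f : L2R) :
    modulation a (translation b f) =
      Complex.exp (Complex.I * (a * b : ℝ)) • translation b (modulation a f) := by
  apply Lp.ext
  refine (modulation_coeFn _ _).trans (.trans ?_ (Lp.coeFn_smul _ _).symm)
  have h2 := (quasi_affine one_pos b).ae_eq_comp (modulation_coeFn a f)
  filter_upwards [translation_coeFn b f, translation_coeFn b (modulation a f), h2] with x hx hy hz
  simp only [Function.comp, div_one] at hz
  rw [hx, Pi.smul_apply, hy, hz, smul_eq_mul, ← mul_assoc, ← Complex.exp_add]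
  congr 2
  push_cast
  ring

/-- By density of the Schwartz functions, covariance of the Fourier unitary need only be checked
where it is given by an integral. -/
theorem eq_of_eq_on_schwartz {V W : L2R →L[ℂ] L2R}
    (h : ∀ f : 𝓢(ℝ, ℂ), V (f.toLp 2 volume) = W (f.toLp 2 volume)) : V = W := by
  have hd : DenseRange (SchwartzMap.toLpCLM ℝ ℂ 2 (volume : Measure ℝ)) :=
    SchwartzMap.denseRange_toLpCLM (E := ℝ) (F := ℂ) (by simp)
  exact DFunLike.coe_injective (hd.equalizer V.continuous W.continuous (funext h))

/-- The Fourier transform turns translations into modulations. -/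
theorem fourierUnitary_translation (a : ℝ) (f : L2R) :
    fourierUnitary (translation a f) = modulation a (fourierUnitary f) := by
  suffices h : (fourierUnitary : L2R →L[ℂ] L2R) ∘L (translation a : L2R →L[ℂ] L2R) =
      (modulation a : L2R →L[ℂ] L2R) ∘L (fourierUnitary : L2R →L[ℂ] L2R) from
    DFunLike.congr_fun h f
  refine eq_of_eq_on_schwartz fun f => ?_
  change fourierUnitary (translation a (f.toLp 2 volume)) =
    modulation a (fourierUnitary (f.toLp 2 volume))
  have h1 : translation a (f.toLp 2 volume) = (f.compSubConstCLM ℂ a).toLp 2 volume := by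
    apply Lp.ext
    have h2 := (quasi_affine one_pos a).ae_eq_comp (f.coeFn_toLp 2 volume)
    filter_upwards [translation_coeFn a (f.toLp 2 volume), h2,
      (f.compSubConstCLM ℂ a).coeFn_toLp 2 volume] with x hx hy hz
    simp only [Function.comp, div_one] at hy
    rw [hx, hy, hz]
    rfl
  rw [h1]
  apply Lp.ext
  refine (fourierUnitary_toLp _).trans (.trans ?_ (modulation_coeFn _ _).symm)
  filter_upwards [fourierUnitary_toLp f] with x hx
  rw [hx]
  simp only [fourierFun, affineFun, SchwartzMap.fourierInv_coe, Real.fourierInv_eq']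
  have h3 : (∫ v : ℝ, Complex.exp (((2 * π * inner ℝ v ((x - 0) / (2 * π)) : ℝ) : ℂ) * Complex.I) •
      f (v - a)) = Complex.exp (Complex.I * (a * x : ℝ)) *
      ∫ v : ℝ, Complex.exp (((2 * π * inner ℝ v ((x - 0) / (2 * π)) : ℝ) : ℂ) * Complex.I) • f v := by
    have h4 := integral_sub_right_eq_self (μ := volume) (fun v : ℝ =>
      Complex.exp (((2 * π * inner ℝ v ((x - 0) / (2 * π)) : ℝ) : ℂ) * Complex.I) • f v) a
    rw [← h4, ← integral_const_mul]
    congr 1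
    ext v
    rw [smul_eq_mul, smul_eq_mul, ← mul_assoc, ← Complex.exp_add]
    congr 2
    have hp : (π : ℂ) ≠ 0 := by exact_mod_cast Real.pi_ne_zero
    simp
    field_simp
    ring
  refine Eq.trans (congrArg _ h3) ?_
  ring

/-- The Fourier transform inverts squeezing. -/
theorem fourierUnitary_squeezing {α : ℝ} (hα : 0 < α) (f : L2R) :
    fourierUnitary (squeezing hα f) = squeezing (inv_pos.mpr hα) (fourierUnitary f) := by
  suffices h : (fourierUnitary : L2R →L[ℂ] L2R) ∘L (squeezing hα : L2R →L[ℂ] L2R) =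
      (squeezing (inv_pos.mpr hα) : L2R →L[ℂ] L2R) ∘L (fourierUnitary : L2R →L[ℂ] L2R) from
    DFunLike.congr_fun h f
  refine eq_of_eq_on_schwartz fun f => ?_
  change fourierUnitary (squeezing hα (f.toLp 2 volume)) =
    squeezing (inv_pos.mpr hα) (fourierUnitary (f.toLp 2 volume))
  let g : 𝓢(ℝ, ℂ) := (((Real.sqrt α)⁻¹ : ℝ) : ℂ) •
    SchwartzMap.compCLMOfContinuousLinearEquiv ℂ
      (ContinuousLinearEquiv.unitsEquivAut ℝ (Units.mk0 α⁻¹ (inv_ne_zero hα.ne'))) f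
  have hg (x : ℝ) : g x = (((Real.sqrt α)⁻¹ : ℝ) : ℂ) * f (x / α) := rfl
  have h1 : squeezing hα (f.toLp 2 volume) = g.toLp 2 volume := by
    apply Lp.ext
    have h2 := (quasi_affine hα 0).ae_eq_comp (f.coeFn_toLp 2 volume)
    filter_upwards [squeezing_coeFn hα (f.toLp 2 volume), h2, g.coeFn_toLp 2 volume] with x hx hy hz
    simp only [Function.comp, sub_zero] at hy
    rw [hx, hy, hz, hg]
  rw [h1]
  apply Lp.ext
  refine (fourierUnitary_toLp _).trans (.trans ?_ (squeezing_coeFn _ _).symm)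
  have h2 := (quasi_affine (inv_pos.mpr hα) 0).ae_eq_comp (fourierUnitary_toLp f)
  filter_upwards [h2] with x hx
  simp only [Function.comp, sub_zero] at hx
  rw [hx]
  simp only [fourierFun, affineFun, SchwartzMap.fourierInv_coe, Real.fourierInv_eq', hg]
  have h3 : (∫ v : ℝ, Complex.exp (((2 * π * inner ℝ v ((x - 0) / (2 * π)) : ℝ) : ℂ) * Complex.I) •
      ((((Real.sqrt α)⁻¹ : ℝ) : ℂ) * f (v / α))) = (((Real.sqrt α⁻¹)⁻¹ : ℝ) : ℂ) *
      ∫ v : ℝ, Complex.exp (((2 * π * inner ℝ v ((x / α⁻¹ - 0) / (2 * π)) : ℝ) : ℂ) * Complex.I) •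
        f v := by
    have h4 := Measure.integral_comp_div (fun v : ℝ => Complex.exp (((2 * π *
      inner ℝ v ((x / α⁻¹ - 0) / (2 * π)) : ℝ) : ℂ) * Complex.I) • f v) α
    -- The Jacobian α of v ↦ v/α turns the factor α^{-1/2} into α^{1/2}, the normalization of
    -- squeezing by α⁻¹.
    have h5 : (((Real.sqrt α⁻¹)⁻¹ : ℝ) : ℂ) = (((Real.sqrt α)⁻¹ : ℝ) : ℂ) * ((|α| : ℝ) : ℂ) := by
      rw [← Complex.ofReal_mul, Real.sqrt_inv, inv_inv, abs_of_pos hα]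
      congr 1
      rw [eq_inv_mul_iff_mul_eq₀ (Real.sqrt_pos.mpr hα).ne', Real.mul_self_sqrt hα.le]
    rw [h5, mul_assoc, ← Complex.real_smul (x := |α|), ← h4, ← integral_const_mul]
    congr 1
    ext v
    rw [smul_eq_mul, smul_eq_mul, mul_left_comm]
    congr 3
    have hα' : (α : ℂ) ≠ 0 := by exact_mod_cast hα.ne'
    simp
    field_simp
  refine Eq.trans (congrArg _ h3) ?_
  ring

end Covariance

/-! ### Linear independence of the code states. -/

section LinearIndependence

/-- A nonzero polynomial has finitely many roots, and each root has countably many logarithms. -/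
theorem countable_exp_eq {a : ℝ} (ha : a ≠ 0) {p : Polynomial ℂ} (hp : p ≠ 0) :
    {x : ℝ | p.eval (Complex.exp (Complex.I * (a * x : ℝ))) = 0}.Countable := by
  have h1 : {z : ℂ | p.eval z = 0}.Countable := by
    refine (p.roots.toFinset.finite_toSet.countable).mono fun z hz => ?_
    simpa [hp] using hz
  have hinj : Function.Injective fun x : ℝ => Complex.I * ((a * x : ℝ) : ℂ) := by
    intro x y hxy
    have h2 := mul_left_cancel₀ Complex.I_ne_zero hxy
    exact mul_left_cancel₀ ha (by exact_mod_cast h2)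
  exact h1.preimage_cexp.preimage hinj

/-- The Fourier transform turns a linear relation into p(e^{iax}) g(x) = 0 with g the transform of f
and p the polynomial of its coefficients. A nonzero p(e^{iax}) vanishes only on a null set, forcing
g = 0. The argument needs no near-orthogonality, so it covers every κ. -/
theorem linearIndependent_translation {a : ℝ} (ha : a ≠ 0) {f : L2R} (hf : f ≠ 0) (d : ℕ) :
    LinearIndependent ℂ fun j : Fin d => translation (((j : ℕ) : ℝ) * a) f := by
  rw [Fintype.linearIndependent_iff]
  intro c hc
  by_contra! hne
  obtain ⟨i, hi⟩ := hne
  set p : Polynomial ℂ := ∑ j : Fin d, Polynomial.monomial (j : ℕ) (c j) with hp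
  have hp0 : p ≠ 0 := by
    intro h
    apply hi
    have := congrArg (fun q : Polynomial ℂ => q.coeff (i : ℕ)) h
    simpa [hp, Polynomial.finsetSum_coeff, Polynomial.coeff_monomial, Fin.val_inj] using this
  have h1 := congrArg fourierUnitary hc
  simp only [map_sum, map_smul, map_zero, fourierUnitary_translation] at h1
  set g := fourierUnitary f with hg
  have h2 : (∑ j : Fin d, c j • modulation (((j : ℕ) : ℝ) * a) g : L2R) =ᵐ[volume]
      fun x => p.eval (Complex.exp (Complex.I * (a * x : ℝ))) * g x := by
    refine (Lp.coeFn_finsetSum _ _).trans ?_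
    have h3 : ∀ᵐ x, ∀ j : Fin d, (c j • modulation (((j : ℕ) : ℝ) * a) g : L2R) x =
        c j * (Complex.exp (Complex.I * (((j : ℕ) : ℝ) * a * x : ℝ)) * g x) := by
      rw [ae_all_iff]
      intro j
      filter_upwards [Lp.coeFn_smul (c j) (modulation (((j : ℕ) : ℝ) * a) g),
        modulation_coeFn (((j : ℕ) : ℝ) * a) g] with x hx hy
      rw [hx, Pi.smul_apply, hy, smul_eq_mul]
    filter_upwards [h3] with x hx
    rw [Finset.sum_apply, Finset.sum_congr rfl fun j _ => hx j, hp, Polynomial.eval_finsetSum,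
      Finset.sum_mul]
    refine Finset.sum_congr rfl fun j _ => ?_
    have h6 : Complex.exp (Complex.I * (((j : ℕ) : ℝ) * a * x : ℝ)) =
        Complex.exp ((j : ℕ) * (Complex.I * (a * x : ℝ))) := by
      congr 1
      push_cast
      ring
    rw [Polynomial.eval_monomial, ← Complex.exp_nat_mul, h6]
    ring
  rw [h1] at h2
  have h4 : g = 0 := by
    apply Lp.ext
    have h5 := measure_eq_zero_iff_ae_notMem.mp
      ((countable_exp_eq ha hp0).measure_zero (volume : Measure ℝ))
    filter_upwards [h2, h5, Lp.coeFn_zero ℂ 2 (volume : Measure ℝ)] with x hx hy hz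
    rw [hz, Pi.zero_apply] at hx ⊢
    exact (mul_eq_zero.mp hx.symm).resolve_left hy
  exact hf ((LinearIsometryEquiv.map_eq_zero_iff _).mp h4)

theorem linearIndependent_codeword {d : ℕ} (hd : 2 ≤ d) {f : L2R} (hf : f ≠ 0) :
    LinearIndependent ℂ (codeword hd f) := by
  have hd0 : (0 : ℝ) < d := by exact_mod_cast (by omega : 0 < d)
  exact linearIndependent_translation (by positivity)
    ((LinearIsometryEquiv.map_eq_zero_iff _).not.mpr hf) d

end LinearIndependence

/-! ### The isometric factor of a near-isometry. -/

section Isometry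

/-- The isometric factor in the polar decomposition of an injective operator `A` that nearly
preserves norms is close to `A`. -/
theorem exists_isometry_near {E H : Type*} [NormedAddCommGroup E] [InnerProductSpace ℂ E]
    [FiniteDimensional ℂ E] [NormedAddCommGroup H] [InnerProductSpace ℂ H] [CompleteSpace H]
    (A : E →ₗ[ℂ] H) (hA : Function.Injective A) {δ : ℝ} (hδ : 0 ≤ δ)
    (h : ∀ x, |‖A x‖ - ‖x‖| ≤ δ * ‖x‖) :
    ∃ V : E ≃ₗᵢ[ℂ] LinearMap.range A, ∀ x, ‖(V x : H) - A x‖ ≤ δ * ‖x‖ := by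
  have : CompleteSpace E := FiniteDimensional.complete ℂ E
  set A' : E →L[ℂ] H := LinearMap.toContinuousLinearMap A with hA'
  set G : E →L[ℂ] E := ContinuousLinearMap.adjoint A' ∘L A' with hG
  have hGs : (G : E →ₗ[ℂ] E).IsSymmetric := by
    intro x y
    change inner ℂ (ContinuousLinearMap.adjoint A' (A' x)) y =
      inner ℂ x (ContinuousLinearMap.adjoint A' (A' y))
    rw [ContinuousLinearMap.adjoint_inner_left, ContinuousLinearMap.adjoint_inner_right]
  -- Eigenvectors of A†A have mutually orthogonal images under A. Sending each b_i to its normalized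
  -- image u_i is therefore an isometry V, and V − A sends b_i to (1 − ‖A b_i‖) u_i.
  set b := hGs.eigenvectorBasis rfl with hb
  have hor (i j) (hij : i ≠ j) : inner ℂ (A (b i)) (A (b j)) = 0 := by
    have h1 : inner ℂ (A (b i)) (A (b j)) = inner ℂ (b i) (G (b j)) := by
      rw [hG, ContinuousLinearMap.comp_apply, ContinuousLinearMap.adjoint_inner_right]; rfl
    have h2 := hGs.apply_eigenvectorBasis rfl j
    rw [h1]
    refine (congrArg _ h2).trans ?_
    rw [inner_smul_right, b.orthonormal.2 hij, mul_zero]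
  have hpos (i) : 0 < ‖A (b i)‖ := by
    rw [norm_pos_iff]
    intro h0
    have h1 : b i = 0 := hA (by rw [h0, map_zero])
    have h2 := b.orthonormal.1 i
    rw [h1, norm_zero] at h2
    exact zero_ne_one h2
  let u : Fin (Module.finrank ℂ E) → LinearMap.range A := fun i =>
    ((‖A (b i)‖⁻¹ : ℝ) : ℂ) • ⟨A (b i), LinearMap.mem_range_self A (b i)⟩
  have hu : Orthonormal ℂ u := by
    refine ⟨fun i => ?_, fun i j hij => ?_⟩
    · rw [norm_smul, Complex.norm_real, norm_inv, norm_norm]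
      exact inv_mul_cancel₀ (hpos i).ne'
    · change inner ℂ (u i) (u j) = 0
      rw [inner_smul_left, inner_smul_right, Submodule.coe_inner, hor i j hij, mul_zero, mul_zero]
  let f : E →ₗ[ℂ] LinearMap.range A := b.toBasis.constr ℂ u
  have hf (i) : f (b i) = u i := by
    have := b.toBasis.constr_basis ℂ u i
    rwa [b.coe_toBasis] at this
  let V := (f.isometryOfOrthonormal (v := b.toBasis) (by rw [b.coe_toBasis]; exact b.orthonormal)
    (by
      have : f ∘ b.toBasis = u := by ext1 i; simp [hf]
      rwa [this]))
  refine ⟨V.toLinearIsometryEquiv (LinearMap.finrank_range_of_inj hA).symm, fun x => ?_⟩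
  have hx := b.sum_repr x
  set y : EuclideanSpace ℂ (Fin (Module.finrank ℂ E)) :=
    WithLp.toLp 2 fun i => ((1 - ‖A (b i)‖ : ℝ) : ℂ) * b.repr x i with hy
  have h1 : (V x : H) - A x = V (b.repr.symm y) := by
    rw [← b.sum_repr_symm, map_sum]
    conv_lhs => rw [← hx]
    rw [map_sum, map_sum, Submodule.coe_sum, Submodule.coe_sum, ← Finset.sum_sub_distrib]
    refine Finset.sum_congr rfl fun i _ => ?_
    have h2 : V (b i) = u i := hf i
    have h3 : A (b i) = ((‖A (b i)‖ : ℝ) : ℂ) • (u i : H) := by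
      simp only [u, Submodule.coe_smul, smul_smul]
      rw [← Complex.ofReal_mul, mul_inv_cancel₀ (hpos i).ne', Complex.ofReal_one, one_smul]
    obtain ⟨w, hw⟩ : ∃ w, w = u i := ⟨_, rfl⟩
    rw [← hw] at h2 h3
    rw [map_smul, map_smul, map_smul, h2, Submodule.coe_smul, Submodule.coe_smul, h3, smul_smul,
      ← sub_smul]
    congr 1
    rw [hy]
    push_cast
    ring
  rw [LinearIsometry.toLinearIsometryEquiv_apply, h1, Submodule.norm_coe, V.norm_map,
    LinearIsometryEquiv.norm_map, ← b.repr.norm_map x]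
  refine (sq_le_sq₀ (norm_nonneg _) (by positivity)).mp ?_
  rw [mul_pow, EuclideanSpace.norm_sq_eq, EuclideanSpace.norm_sq_eq, Finset.mul_sum]
  refine Finset.sum_le_sum fun i _ => ?_
  rw [← mul_pow, hy, norm_mul, Complex.norm_real, Real.norm_eq_abs, abs_sub_comm]
  have h4 := h (b i)
  rw [b.orthonormal.1 i, mul_one] at h4
  gcongr

end Isometry

/-! ### Gaussian lattice sums. -/

section GaussianSums

/-- Comparison with the two-sided geometric series of ratio e^{-c} ≤ 1/3; at ratio 1/3 its sum is
exactly 2. -/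
theorem tsum_exp_neg_mul_sq_le_two {c : ℝ} (hc : 2 ≤ c)
    (hs : Summable fun s : ℤ => Real.exp (-(c * (s : ℝ) ^ 2))) :
    ∑' s : ℤ, Real.exp (-(c * (s : ℝ) ^ 2)) ≤ 2 := by
  set q := Real.exp (-c) with hq
  have hq0 : 0 < q := Real.exp_pos _
  have hq3 : q ≤ 1 / 3 := by
    rw [hq, Real.exp_neg, one_div]
    exact inv_anti₀ (by norm_num) (by linarith [Real.add_one_le_exp c])
  have hg := hasSum_geometric_of_lt_one hq0.le (by linarith : q < 1)
  have hsum : HasSum (fun s : ℤ => q ^ s.natAbs) ((1 - q)⁻¹ + q * (1 - q)⁻¹) := by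
    refine HasSum.of_nat_of_neg_add_one (by simpa using hg) ?_
    refine (hg.mul_left q).congr_fun fun n => ?_
    rw [← pow_succ']
    congr 1
  refine (hs.tsum_le_tsum (fun s => ?_) hsum.summable).trans ?_
  · rw [hq, ← Real.exp_nat_mul]
    apply Real.exp_le_exp.mpr
    have h1 : (s.natAbs : ℝ) ≤ (s : ℝ) ^ 2 := by
      have : (s.natAbs : ℤ) ≤ s ^ 2 := by
        rw [← Int.natAbs_sq]; nlinarith [Int.natCast_nonneg s.natAbs]
      have h2 := (Int.cast_le (R := ℝ)).mpr this
      rwa [Int.cast_natCast, Int.cast_pow] at h2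
    nlinarith
  · rw [hsum.tsum_eq, ← one_add_mul, ← div_eq_mul_inv, div_le_iff₀ (by linarith)]
    linarith

theorem summable_exp_neg_mul_sq {a : ℝ} (ha : 0 < a) :
    Summable fun s : ℤ => Real.exp (-(a * (s : ℝ) ^ 2)) := by
  have h := summable_envelope (κ := Real.sqrt (2 * a)) (by positivity)
  unfold envelope at h
  rw [summable_mul_left_iff (by positivity)] at h
  refine h.congr fun s => ?_
  rw [Real.sq_sqrt (by positivity)]
  congr 1
  ring

/-- Jacobi's theta transformation. For a ≤ 1 the dual sum lies between 1 (its zero mode) and 2, so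
the original one is √(π/a) up to a factor 2. -/
theorem tsum_exp_neg_mul_sq {a : ℝ} (ha : 0 < a) :
    ∑' s : ℤ, Real.exp (-(a * (s : ℝ) ^ 2)) =
      Real.sqrt (π / a) * ∑' s : ℤ, Real.exp (-(π ^ 2 / a * (s : ℝ) ^ 2)) := by
  have hp := Real.pi_pos
  have h := Real.tsum_exp_neg_mul_int_sq (a := a / π) (by positivity)
  have h1 : (1 : ℝ) / (a / π) ^ (1 / 2 : ℝ) = Real.sqrt (π / a) := by
    rw [← Real.sqrt_eq_rpow, one_div, ← Real.sqrt_inv, inv_div]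
  rw [h1] at h
  convert h using 4 with s
  · field_simp
  · field_simp

theorem tsum_exp_neg_mul_sq_le {a : ℝ} (ha : 0 < a) (ha1 : a ≤ 1) :
    ∑' s : ℤ, Real.exp (-(a * (s : ℝ) ^ 2)) ≤ 2 * Real.sqrt (π / a) := by
  have hp := Real.pi_gt_three
  have hc : 2 ≤ π ^ 2 / a := by
    rw [le_div_iff₀ ha]; nlinarith
  rw [tsum_exp_neg_mul_sq ha, mul_comm]
  gcongr
  exact tsum_exp_neg_mul_sq_le_two hc (summable_exp_neg_mul_sq (by positivity))

theorem le_tsum_exp_neg_mul_sq {a : ℝ} (ha : 0 < a) :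
    Real.sqrt (π / a) ≤ ∑' s : ℤ, Real.exp (-(a * (s : ℝ) ^ 2)) := by
  rw [tsum_exp_neg_mul_sq ha]
  refine le_mul_of_one_le_right (Real.sqrt_nonneg _) ?_
  have := (summable_exp_neg_mul_sq (a := π ^ 2 / a) (by positivity)).le_tsum 0
    fun _ _ => (Real.exp_pos _).le
  simpa using this

theorem envelope_pos {κ : ℝ} (hκ : 0 < κ) (x : ℝ) : 0 < envelope κ x := by
  unfold envelope; positivity

theorem pi_rpow_quarter_sq : (π ^ (1 / 4 : ℝ)) ^ 2 = Real.sqrt π := by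
  rw [← Real.rpow_natCast, ← Real.rpow_mul Real.pi_pos.le, Real.sqrt_eq_rpow]
  norm_num

/-- About 1/κ teeth carry weight of order √κ each. The factor κ^{-1/2} is the price of estimating a
comb by the triangle inequality, so errors per tooth must be of order κ. -/
theorem tsum_envelope_le {κ : ℝ} (hκ : 0 < κ) (hκ1 : κ ≤ 1) :
    ∑' s : ℤ, envelope κ s ≤ 4 / Real.sqrt κ := by
  have h1 : (fun s : ℤ => envelope κ s) = fun s : ℤ =>
      Real.sqrt κ / π ^ (1 / 4 : ℝ) * Real.exp (-(κ ^ 2 / 2 * (s : ℝ) ^ 2)) := by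
    ext s
    rw [envelope]
    congr 3
    ring
  have h2 := tsum_exp_neg_mul_sq_le (a := κ ^ 2 / 2) (by positivity) (by nlinarith)
  rw [h1, tsum_mul_left]
  have hp := Real.pi_pos
  set p := π ^ (1 / 4 : ℝ) with hpd
  have hp0 : 0 < p := by positivity
  have hpp : (p ^ 2) ^ 2 = π := by rw [pi_rpow_quarter_sq, Real.sq_sqrt hp.le]
  have h3 : Real.sqrt (π / (κ ^ 2 / 2)) = p ^ 2 * Real.sqrt 2 / κ := by
    rw [pi_rpow_quarter_sq, ← Real.sqrt_mul hp.le, show π / (κ ^ 2 / 2) = π * 2 / κ ^ 2 by field_simp,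
      Real.sqrt_div (by positivity), Real.sqrt_sq hκ.le]
  have h4 : p * Real.sqrt 2 ≤ 2 := by
    have h5 : p ^ 2 ≤ 2 := by
      by_contra! h
      nlinarith [Real.pi_lt_four]
    refine (sq_le_sq₀ (by positivity) (by norm_num)).mp ?_
    rw [mul_pow, Real.sq_sqrt (by norm_num)]
    linarith
  rw [h3] at h2
  have h6 : Real.sqrt κ * Real.sqrt κ = κ := Real.mul_self_sqrt hκ.le
  have hs0 : 0 < Real.sqrt κ := Real.sqrt_pos.mpr hκ
  calc _ ≤ Real.sqrt κ / p * (2 * (p ^ 2 * Real.sqrt 2 / κ)) := by gcongr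
    _ = 2 * (p * Real.sqrt 2) / Real.sqrt κ := by
        field_simp
        rw [Real.sq_sqrt hκ.le]
    _ ≤ 2 * 2 / Real.sqrt κ := by gcongr
    _ = _ := by norm_num

theorem summable_envelope_sq {κ : ℝ} (hκ : 0 < κ) : Summable fun s : ℤ => envelope κ s ^ 2 := by
  have h := (summable_exp_neg_mul_sq (a := κ ^ 2) (by positivity)).mul_left
    ((Real.sqrt κ / π ^ (1 / 4 : ℝ)) ^ 2)
  refine h.congr fun s => ?_
  rw [envelope, mul_pow, ← Real.exp_nat_mul]
  congr 2
  push_cast; ring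

/-- The prefactor κ/√π of η_κ² cancels the factor √π/κ of the theta transformation, whose dual sum
is at least 1. -/
theorem one_le_tsum_envelope_sq {κ : ℝ} (hκ : 0 < κ) : 1 ≤ ∑' s : ℤ, envelope κ s ^ 2 := by
  have h1 : (fun s : ℤ => envelope κ s ^ 2) = fun s : ℤ =>
      (Real.sqrt κ / π ^ (1 / 4 : ℝ)) ^ 2 * Real.exp (-(κ ^ 2 * (s : ℝ) ^ 2)) := by
    ext s
    rw [envelope, mul_pow, ← Real.exp_nat_mul]
    congr 2
    push_cast; ring
  have hp := Real.pi_pos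
  have h2 := le_tsum_exp_neg_mul_sq (a := κ ^ 2) (by positivity)
  rw [Real.sqrt_div hp.le, Real.sqrt_sq hκ.le] at h2
  rw [h1, tsum_mul_left, div_pow, pi_rpow_quarter_sq, Real.sq_sqrt hκ.le]
  have hs := Real.sqrt_pos.mpr hp
  calc (1 : ℝ) = κ / Real.sqrt π * (Real.sqrt π / κ) := by field_simp
    _ ≤ _ := by gcongr

end GaussianSums

/-! ### Combs and their norms. -/

section Comb

/-- The unnormalized comb `∑_s η_κ(s) f(· - s)`. -/
def comb (κ : ℝ) (f : L2R) : L2R := ∑' s : ℤ, (envelope κ s : ℂ) • translation s f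

theorem norm_envelope_smul {κ : ℝ} (hκ : 0 < κ) (x : ℝ) (f : L2R) :
    ‖(envelope κ x : ℂ) • f‖ = envelope κ x * ‖f‖ := by
  rw [norm_smul, Complex.norm_real, Real.norm_of_nonneg (envelope_pos hκ _).le]

theorem summable_comb {κ : ℝ} (hκ : 0 < κ) (f : L2R) :
    Summable fun s : ℤ => (envelope κ s : ℂ) • translation s f := by
  refine Summable.of_norm (((summable_envelope hκ).mul_right ‖f‖).congr fun s => ?_)
  rw [norm_envelope_smul hκ, LinearIsometryEquiv.norm_map]

theorem norm_tsum_envelope_smul_le {κ : ℝ} (hκ : 0 < κ) (hκ1 : κ ≤ 1) {f : ℤ → L2R} {c : ℝ}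
    (hf : ∀ s, ‖f s‖ ≤ c) : ‖∑' s : ℤ, (envelope κ s : ℂ) • f s‖ ≤ 4 / Real.sqrt κ * c := by
  have hc : 0 ≤ c := (norm_nonneg _).trans (hf 0)
  have h := tsum_of_norm_bounded ((summable_envelope hκ).mul_right c).hasSum
    (f := fun s : ℤ => (envelope κ s : ℂ) • f s) fun s => by
      rw [norm_envelope_smul hκ]
      exact mul_le_mul_of_nonneg_left (hf s) (envelope_pos hκ _).le
  refine h.trans ?_
  rw [tsum_mul_right]
  exact mul_le_mul_of_nonneg_right (tsum_envelope_le hκ hκ1) hc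

theorem comb_sub {κ : ℝ} (hκ : 0 < κ) (f g : L2R) : comb κ (f - g) = comb κ f - comb κ g := by
  simp only [comb, map_sub, smul_sub]
  exact (summable_comb hκ f).tsum_sub (summable_comb hκ g)

theorem comb_smul (κ : ℝ) (c : ℂ) (f : L2R) : comb κ (c • f) = c • comb κ f := by
  simp only [comb, map_smul]
  rw [← tsum_const_smul'' c]
  exact tsum_congr fun s => smul_comm _ _ _

theorem normalized_smul {r : ℝ} (hr : 0 < r) (f : L2R) :
    normalized ((r : ℂ) • f) = normalized f := by
  unfold normalized
  rw [smul_smul, norm_smul, Complex.norm_real, Real.norm_of_nonneg hr.le, ← Complex.ofReal_mul]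
  congr 2
  rw [mul_inv, mul_comm r⁻¹, mul_assoc, inv_mul_cancel₀ hr.ne', mul_one]

/-- Only ‖f‖ enters, so no lower bound on ‖g‖ is needed; for g = 0 the normalization is 0 and the
bound still holds. -/
theorem norm_normalized_sub_le (f g : L2R) (hf : f ≠ 0) :
    ‖normalized f - normalized g‖ ≤ 2 * ‖f - g‖ / ‖f‖ := by
  have hf0 : 0 < ‖f‖ := norm_pos_iff.mpr hf
  have h1 : normalized f - normalized g =
      ((‖f‖⁻¹ : ℝ) : ℂ) • (f - g) + ((‖f‖⁻¹ - ‖g‖⁻¹ : ℝ) : ℂ) • g := by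
    unfold normalized
    rw [smul_sub, Complex.ofReal_sub, sub_smul]
    abel
  have h2 : ‖((‖f‖⁻¹ - ‖g‖⁻¹ : ℝ) : ℂ) • g‖ ≤ ‖f - g‖ / ‖f‖ := by
    rw [norm_smul, Complex.norm_real, Real.norm_eq_abs]
    rcases eq_or_ne g 0 with rfl | hg
    · simp
      positivity
    have hg0 : 0 < ‖g‖ := norm_pos_iff.mpr hg
    have h3 : |‖f‖⁻¹ - ‖g‖⁻¹| * ‖g‖ = |‖g‖ - ‖f‖| / ‖f‖ := by
      rw [inv_sub_inv hf0.ne' hg0.ne', abs_div, abs_mul, abs_of_pos hf0, abs_of_pos hg0]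
      field_simp
    rw [h3, abs_sub_comm]
    gcongr
    exact abs_norm_sub_norm_le f g
  rw [h1]
  refine (norm_add_le _ _).trans ?_
  have h4 : ‖((‖f‖⁻¹ : ℝ) : ℂ) • (f - g)‖ = ‖f - g‖ / ‖f‖ := by
    rw [norm_smul, Complex.norm_real, norm_inv, norm_norm, inv_mul_eq_div]
  rw [h4, two_mul, add_div]
  gcongr

/-- `f` is almost everywhere real and nonnegative. -/
def AENonneg (f : L2R) : Prop := ∀ᵐ x, ∃ r : ℝ, 0 ≤ r ∧ f x = r

theorem AENonneg.translation {f : L2R} (hf : AENonneg f) (a : ℝ) :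
    AENonneg (translation a f) := by
  filter_upwards [(quasi_affine one_pos a).ae hf, translation_coeFn a f] with x hx hy
  rw [hy]
  simpa using hx

theorem AENonneg.re_inner_nonneg {f g : L2R} (hf : AENonneg f) (hg : AENonneg g) :
    0 ≤ RCLike.re (inner ℂ f g) := by
  rw [L2.inner_def, ← integral_re (L2.integrable_inner f g)]
  apply integral_nonneg_of_ae
  filter_upwards [hf, hg] with x ⟨r, hr, hx⟩ ⟨t, ht, hy⟩
  rw [hx, hy]
  have : inner ℂ (r : ℂ) (t : ℂ) = ((t * r : ℝ) : ℂ) := by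
    rw [RCLike.inner_apply]; simp
  rw [this]
  exact mul_nonneg ht hr

/-- Translates of a nonnegative function have nonnegative overlaps. Dropping the cross terms in
‖comb‖² leaves Σ η_κ(s)² ‖f‖² ≥ ‖f‖²; this replaces orthogonality, which overlapping full peaks
lack. -/
theorem norm_le_norm_comb {κ : ℝ} (hκ : 0 < κ) {f : L2R} (hf : AENonneg f) :
    ‖f‖ ≤ ‖comb κ f‖ := by
  have hsum (g : L2R) : HasSum (fun s : ℤ => envelope κ s * RCLike.re (inner ℂ g (translation s f)))
      (RCLike.re (inner ℂ g (comb κ f))) := by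
    have h1 := (summable_comb hκ f).hasSum.mapL (RCLike.reCLM ∘L
      ((innerSL ℂ g).restrictScalars ℝ))
    refine h1.congr_fun fun s => ?_
    simp
  have h2 (s : ℤ) : envelope κ s * ‖f‖ ^ 2 ≤ RCLike.re (inner ℂ (translation s f) (comb κ f)) := by
    have h3 := (hsum (translation s f)).summable.le_tsum s fun t _ =>
      mul_nonneg (envelope_pos hκ _).le ((hf.translation s).re_inner_nonneg (hf.translation t))
    rwa [(hsum (translation s f)).tsum_eq, inner_self_eq_norm_sq, LinearIsometryEquiv.norm_map] at h3
  have h4 : ‖f‖ ^ 2 ≤ ‖comb κ f‖ ^ 2 := by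
    have h5 := hsum (comb κ f)
    rw [inner_self_eq_norm_sq] at h5
    have h6 := ((summable_envelope_sq hκ).mul_right (‖f‖ ^ 2)).hasSum
    rw [tsum_mul_right] at h6
    refine le_trans ?_ (hasSum_le (fun s => ?_) h6 h5)
    · exact le_mul_of_one_le_left (by positivity) (one_le_tsum_envelope_sq hκ)
    · rw [sq (envelope κ s), mul_assoc, inner_re_symm]
      exact mul_le_mul_of_nonneg_left (h2 s) (envelope_pos hκ _).le
  exact (sq_le_sq₀ (norm_nonneg _) (norm_nonneg _)).mp h4

end Comb

/-! ### Gaussian peaks and the cost of truncating them. -/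

section Peak

theorem peak_pos {Δ : ℝ} (hΔ : 0 < Δ) (x : ℝ) : 0 < peak Δ x := by
  unfold peak; positivity

theorem peakL2_coeFn (Δ : ℝ) : peakL2 Δ =ᵐ[volume] fun x => (peak Δ x : ℂ) :=
  (memLp_peak Δ).coeFn_toLp

theorem peak_mul {σ τ : ℝ} (hσ : 0 < σ) (hτ : 0 < τ) (x : ℝ) :
    (Real.sqrt σ)⁻¹ * peak τ (x / σ) = peak (σ * τ) x := by
  unfold peak
  rw [Real.sqrt_mul hσ.le]
  have : (x / σ) ^ 2 / (2 * τ ^ 2) = x ^ 2 / (2 * (σ * τ) ^ 2) := by field_simp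
  rw [this]
  field_simp

theorem squeezing_peakL2 {σ τ : ℝ} (hσ : 0 < σ) (hτ : 0 < τ) :
    squeezing hσ (peakL2 τ) = peakL2 (σ * τ) := by
  apply Lp.ext
  refine (squeezing_coeFn hσ _).trans (.trans ?_ (peakL2_coeFn _).symm)
  filter_upwards [(quasi_affine hσ 0).ae_eq_comp (peakL2_coeFn τ)] with x hx
  simp only [Function.comp, sub_zero] at hx
  rw [hx, ← Complex.ofReal_mul, peak_mul hσ hτ]

theorem norm_peakL2 {Δ : ℝ} (hΔ : 0 < Δ) : ‖peakL2 Δ‖ = 1 := by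
  have h1 : ‖peakL2 Δ‖ = ‖peakL2 1‖ := by
    have := squeezing_peakL2 hΔ one_pos
    rw [mul_one] at this
    rw [← this, LinearIsometryEquiv.norm_map]
  have h2 : inner ℂ (peakL2 1) (peakL2 1) = 1 := by
    rw [L2.inner_def]
    have h3 : ∀ᵐ x : ℝ, inner ℂ (peakL2 1 x) (peakL2 1 x) =
        (((Real.sqrt π)⁻¹ * Real.exp (-1 * x ^ 2) : ℝ) : ℂ) := by
      filter_upwards [peakL2_coeFn 1] with x hx
      rw [hx, RCLike.inner_apply, Complex.conj_ofReal, ← Complex.ofReal_mul, peak]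
      congr 1
      rw [← pi_rpow_quarter_sq, mul_mul_mul_comm, ← Real.exp_add]
      simp
      congr 1
      · rw [sq, mul_inv]
      · ring_nf
    rw [integral_congr_ae h3, integral_complex_ofReal, integral_const_mul, integral_gaussian, div_one,
      inv_mul_cancel₀ (Real.sqrt_pos.mpr Real.pi_pos).ne', Complex.ofReal_one]
  have h4 : ‖peakL2 1‖ ^ 2 = 1 := by
    rw [← inner_self_eq_norm_sq (𝕜 := ℂ), h2]
    exact Complex.one_re
  rw [h1]
  exact (pow_eq_one_iff_of_nonneg (norm_nonneg _) two_ne_zero).mp h4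

/-- Since Ψ_σ has norm one, L² bounds reduce to pointwise domination by a Gaussian and no further
integral has to be evaluated. -/
theorem norm_le_of_le_peak {f : L2R} {C σ : ℝ} (hσ : 0 < σ)
    (h : ∀ᵐ x, ‖f x‖ ≤ C * peak σ x) : ‖f‖ ≤ C := by
  have h1 : ‖f‖ ≤ C * ‖peakL2 σ‖ := by
    apply Lp.norm_le_mul_norm_of_ae_le_mul
    filter_upwards [h, peakL2_coeFn σ] with x hx hy
    rwa [hy, Complex.norm_real, Real.norm_of_nonneg (peak_pos hσ x).le]
  rwa [norm_peakL2 hσ, mul_one] at h1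

/-- Half of the Gaussian exponent is split off to pay for tails or growing factors; the other half
is a wider peak. The sharp constant is 2^{1/4}. -/
theorem peak_le_exp_mul_peak {Δ : ℝ} (hΔ : 0 < Δ) (x : ℝ) :
    peak Δ x ≤ 2 * Real.exp (-(x ^ 2 / (4 * Δ ^ 2))) * peak (Real.sqrt 2 * Δ) x := by
  unfold peak
  have h2 : (0 : ℝ) < Real.sqrt 2 := by positivity
  have h3 : Real.sqrt (Real.sqrt 2) ≤ 2 := by
    rw [Real.sqrt_le_left (by norm_num), Real.sqrt_le_left (by norm_num)]; norm_num
  have h4 : Real.exp (-(x ^ 2 / (2 * Δ ^ 2))) =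
      Real.exp (-(x ^ 2 / (4 * Δ ^ 2))) * Real.exp (-(x ^ 2 / (4 * Δ ^ 2))) := by
    rw [← Real.exp_add]; congr 1; field_simp; ring
  have h5 : x ^ 2 / (2 * (Real.sqrt 2 * Δ) ^ 2) = x ^ 2 / (4 * Δ ^ 2) := by
    rw [mul_pow, Real.sq_sqrt (by norm_num)]; ring
  rw [h4, h5, Real.sqrt_mul h2.le]
  set E := Real.exp (-(x ^ 2 / (4 * Δ ^ 2)))
  have h6 : 1 / (π ^ (1 / 4 : ℝ) * Real.sqrt Δ) ≤
      2 * (1 / (π ^ (1 / 4 : ℝ) * (Real.sqrt (Real.sqrt 2) * Real.sqrt Δ))) := by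
    rw [mul_one_div, div_le_div_iff₀ (by positivity) (by positivity)]
    have : 0 < π ^ (1 / 4 : ℝ) * Real.sqrt Δ := by positivity
    nlinarith
  calc _ ≤ 2 * (1 / (π ^ (1 / 4 : ℝ) * (Real.sqrt (Real.sqrt 2) * Real.sqrt Δ))) * (E * E) := by
        gcongr
    _ = _ := by ring

theorem aenonneg_peakL2 {Δ : ℝ} (hΔ : 0 < Δ) : AENonneg (peakL2 Δ) := by
  filter_upwards [peakL2_coeFn Δ] with x hx
  exact ⟨_, (peak_pos hΔ x).le, hx⟩

theorem one_le_norm_comb_peakL2 {κ Δ : ℝ} (hκ : 0 < κ) (hΔ : 0 < Δ) :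
    1 ≤ ‖comb κ (peakL2 Δ)‖ :=
  (norm_peakL2 hΔ).symm.le.trans (norm_le_norm_comb hκ (aenonneg_peakL2 hΔ))

theorem norm_peak_sub_trunc_le {ε Δ : ℝ} (hε : 0 < ε) (hΔ : 0 < Δ) :
    ‖peakL2 Δ - (memLp_peakTrunc ε Δ).toLp‖ ≤ 2 * Real.exp (-(ε ^ 2 / (4 * Δ ^ 2))) := by
  apply norm_le_of_le_peak (σ := Real.sqrt 2 * Δ) (by positivity)
  filter_upwards [Lp.coeFn_sub (peakL2 Δ) (memLp_peakTrunc ε Δ).toLp, peakL2_coeFn Δ,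
    (memLp_peakTrunc ε Δ).coeFn_toLp] with x h1 h2 h3
  rw [h1, Pi.sub_apply, h2, h3]
  have hp := peak_pos (Δ := Real.sqrt 2 * Δ) (by positivity) x
  by_cases hx : x ∈ Set.Icc (-ε) ε
  · rw [Set.indicator_of_mem hx, sub_self, norm_zero]
    positivity
  · rw [Set.indicator_of_notMem hx, sub_zero, Complex.norm_real,
      Real.norm_of_nonneg (peak_pos hΔ x).le]
    refine (peak_le_exp_mul_peak hΔ x).trans ?_
    have hx2 : ε ^ 2 ≤ x ^ 2 := by
      rw [Set.mem_Icc, ← abs_le, not_le] at hx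
      rw [← sq_abs x]
      exact pow_le_pow_left₀ hε.le hx.le 2
    gcongr

theorem gkp_eq (κ Δ : ℝ) : gkp κ Δ = normalized (comb κ (peakL2 Δ)) := rfl

theorem gkp_ne_zero {κ Δ : ℝ} (hκ : 0 < κ) (hΔ : 0 < Δ) : gkp κ Δ ≠ 0 := by
  have h := one_le_norm_comb_peakL2 hκ hΔ
  have h1 : comb κ (peakL2 Δ) ≠ 0 := by
    intro h0
    rw [h0, norm_zero] at h
    linarith
  intro h0
  have := norm_normalized h1
  rw [← gkp_eq, h0, norm_zero] at this
  exact zero_ne_one this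

/-- Normalizing the comb makes the normalization of the truncated peak irrelevant. Each tooth loses
a tail of at most 2e^{-ε²/(4Δ²)}, and summing costs 4/√κ. -/
theorem norm_gkp_sub_gkpTrunc_le {d : ℕ} (hd : 2 ≤ d) {κ : ℝ} (hκ : 0 < κ) (hκ1 : κ ≤ 1) :
    ‖gkp κ (symWidth d κ) - gkpTrunc (1 / (2 * d)) κ (symWidth d κ)‖ ≤ 7 * (κ * Real.sqrt κ) := by
  have hd0 : (0 : ℝ) < d := by exact_mod_cast (by omega : 0 < d)
  have hΔ := symWidth_pos hd hκ
  set Δ := symWidth d κ with hΔd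
  set ε : ℝ := 1 / (2 * d) with hε
  have hε0 : 0 < ε := by positivity
  set t : L2R := (memLp_peakTrunc ε Δ).toLp with ht
  have hone := one_le_norm_comb_peakL2 hκ hΔ
  have hne : comb κ (peakL2 Δ) ≠ 0 := by
    intro h0
    rw [h0, norm_zero] at hone
    linarith
  have ht0 : t ≠ 0 := by
    intro h0
    have := norm_peakTruncL2 hε0 hΔ
    rw [peakTruncL2, ← ht, h0] at this
    simp [normalized] at this
  have h1 : gkpTrunc ε κ Δ = normalized (comb κ t) := by
    change normalized (comb κ (((‖t‖⁻¹ : ℝ) : ℂ) • t)) = _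
    rw [comb_smul, normalized_smul (inv_pos.mpr (norm_pos_iff.mpr ht0))]
  rw [h1, gkp_eq]
  refine (norm_normalized_sub_le _ _ hne).trans ?_
  refine (div_le_self (by positivity) hone).trans ?_
  rw [← comb_sub hκ]
  have h2 : ‖comb κ (peakL2 Δ - t)‖ ≤ 4 / Real.sqrt κ * (2 * Real.exp (-(ε ^ 2 / (4 * Δ ^ 2)))) :=
    norm_tsum_envelope_smul_le hκ hκ1 fun s => by
      rw [LinearIsometryEquiv.norm_map]; exact norm_peak_sub_trunc_le hε0 hΔ
  have h3 : ε ^ 2 / (4 * Δ ^ 2) = π ^ 2 / (4 * κ ^ 2) := by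
    rw [hε, hΔd, symWidth]
    have := Real.pi_pos
    field_simp
  -- The crude bound e^{-x} ≤ 1/x suffices, since π²/4 ≥ 16/7. The final constant is 2 · 4 · 2 ·
  -- 7/16 = 7.
  have h4 : Real.exp (-(π ^ 2 / (4 * κ ^ 2))) ≤ 7 / 16 * κ ^ 2 := by
    have hp := Real.pi_gt_d2
    have h5 := Real.add_one_le_exp (π ^ 2 / (4 * κ ^ 2))
    have h6 : 16 / (7 * κ ^ 2) ≤ π ^ 2 / (4 * κ ^ 2) := by
      rw [div_le_div_iff₀ (by positivity) (by positivity)]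
      have h7 : 64 ≤ 7 * π ^ 2 := by nlinarith
      have : 0 < κ ^ 2 := by positivity
      nlinarith
    rw [Real.exp_neg]
    refine (inv_anti₀ (by positivity) (h6.trans (by linarith))).trans (le_of_eq ?_)
    rw [inv_div]; ring
  rw [h3] at h2
  have h6 : Real.sqrt κ * Real.sqrt κ = κ := Real.mul_self_sqrt hκ.le
  have hs0 : 0 < Real.sqrt κ := Real.sqrt_pos.mpr hκ
  calc _ ≤ 2 * (4 / Real.sqrt κ * (2 * (7 / 16 * κ ^ 2))) := by gcongr; exact h2.trans (by gcongr)
    _ = 7 * (κ * Real.sqrt κ) := by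
      field_simp
      rw [Real.sq_sqrt hκ.le]
      ring

end Peak

/-! ### Encoding of the untruncated code, and reduction of gate errors to full combs. -/

section Encoding

variable {d : ℕ}

theorem sum_norm_le (v : EuclideanSpace ℂ (Fin d)) : ∑ j, ‖v j‖ ≤ Real.sqrt d * ‖v‖ := by
  refine Real.le_sqrt_of_sq_le (?_ : _ ≤ (d : ℝ) * ‖v‖ ^ 2) |>.trans_eq ?_
  · rw [EuclideanSpace.norm_sq_eq]
    simpa using sq_sum_le_card_mul_sum_sq (s := Finset.univ) (f := fun j => ‖v j‖)
  · rw [Real.sqrt_mul (by positivity), Real.sqrt_sq (norm_nonneg _)]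

/-- A linearly independent family close to an orthonormal one has an isometric encoding close to
that of the orthonormal one. -/
theorem exists_encoding_near {v w : Fin d → L2R} (hv : LinearIndependent ℂ v)
    (hw : Orthonormal ℂ w) {δ : ℝ} (hδ : 0 ≤ δ) (h : ∀ j, ‖v j - w j‖ ≤ δ) :
    ∃ V : EuclideanSpace ℂ (Fin d) ≃ₗᵢ[ℂ] Submodule.span ℂ (Set.range v), ∀ x,
      ‖(V x : L2R) - isometricEncoding hw x‖ ≤ 2 * (Real.sqrt d * δ) * ‖x‖ := by
  let b := (EuclideanSpace.basisFun (Fin d) ℂ).toBasis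
  let A : EuclideanSpace ℂ (Fin d) →ₗ[ℂ] L2R := b.constr ℂ v
  have hA (x) : A x = ∑ j, x j • v j := by
    rw [Module.Basis.constr_apply_fintype]; rfl
  have hS (x) : (isometricEncoding hw x : L2R) = ∑ j, x j • w j := by
    conv_lhs => rw [← (EuclideanSpace.basisFun (Fin d) ℂ).sum_repr x]
    simp only [map_sum, map_smul, Submodule.coe_sum, Submodule.coe_smul,
      EuclideanSpace.basisFun_apply, isometricEncoding_single, EuclideanSpace.basisFun_repr]
  have hAi : Function.Injective A := by
    rw [injective_iff_map_eq_zero]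
    intro x hx
    rw [hA] at hx
    ext j
    exact Fintype.linearIndependent_iff.mp hv _ hx j
  have hAS (x) : ‖A x - isometricEncoding hw x‖ ≤ Real.sqrt d * δ * ‖x‖ := by
    rw [hA, hS, ← Finset.sum_sub_distrib]
    calc _ ≤ ∑ j, ‖x j‖ * δ := norm_sum_le_of_le _ fun j _ => by
          rw [← smul_sub, norm_smul]
          exact mul_le_mul_of_nonneg_left (h j) (norm_nonneg _)
      _ ≤ _ := by
          rw [← Finset.sum_mul]
          nlinarith [mul_le_mul_of_nonneg_right (sum_norm_le x) hδ]
  have hnear (x) : |‖A x‖ - ‖x‖| ≤ Real.sqrt d * δ * ‖x‖ := by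
    have h1 : ‖x‖ = ‖(isometricEncoding hw x : L2R)‖ :=
      ((isometricEncoding hw).norm_map x).symm
    conv_lhs => rw [h1]
    exact (abs_norm_sub_norm_le _ _).trans (hAS x)
  -- A is within √d δ of the orthonormal encoding, and its isometric factor is within √d δ of A;
  -- hence the factor 2.
  obtain ⟨V, hV⟩ := exists_isometry_near A hAi (by positivity) hnear
  have hr : LinearMap.range A = Submodule.span ℂ (Set.range v) := b.constr_range ℂ
  refine ⟨V.trans (LinearIsometryEquiv.ofEq _ _ hr), fun x => ?_⟩
  have h2 : ((V.trans (LinearIsometryEquiv.ofEq _ _ hr)) x : L2R) = V x := rfl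
  rw [h2, ← sub_add_sub_cancel _ (A x) _]
  refine (norm_add_le _ _).trans ?_
  linarith [hV x, hAS x]

theorem codeword_sub (hd : 2 ≤ d) (f g : L2R) (j : Fin d) :
    codeword hd (f - g) j = codeword hd f j - codeword hd g j := by
  simp [codeword]

theorem exists_symEncoding (hd : 2 ≤ d) {κ : ℝ} (hκ : 0 < κ) (hκ1 : κ ≤ 1) :
    ∃ enc : EuclideanSpace ℂ (Fin d) ≃ₗᵢ[ℂ] symCode hd κ, ∀ x,
      ‖(enc x : L2R) - symEncodingTrunc hd hκ x‖ ≤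
        2 * (Real.sqrt d * (7 * (κ * Real.sqrt κ))) * ‖x‖ := by
  refine exists_encoding_near
    (linearIndependent_codeword hd (gkp_ne_zero hκ (symWidth_pos hd hκ)))
    (orthonormal_codeword hd hκ (symWidth_pos hd hκ)) (by positivity) fun j => ?_
  rw [← codeword_sub, norm_codeword]
  exact norm_gkp_sub_gkpTrunc_le hd hκ hκ1

/-- The left side is 56 √d κ^{3/2}, already at most 14 d^{3/4} κ^{1/4} for κ ≤ 1/4. -/
theorem encoding_error_le (hd : 2 ≤ d) {κ : ℝ} (hκ : 0 < κ) (hκ1 : κ ≤ 1 / 4) :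
    4 * (2 * (Real.sqrt d * (7 * (κ * Real.sqrt κ)))) ≤
      20 * (d : ℝ) ^ (3 / 4 : ℝ) * κ ^ (1 / 4 : ℝ) := by
  have hd1 : (1 : ℝ) ≤ d := by exact_mod_cast (by omega : 1 ≤ d)
  have h1 : Real.sqrt d ≤ (d : ℝ) ^ (3 / 4 : ℝ) := by
    rw [Real.sqrt_eq_rpow]
    exact Real.rpow_le_rpow_of_exponent_le hd1 (by norm_num)
  have h2 : Real.sqrt κ ≤ κ ^ (1 / 4 : ℝ) := by
    rw [Real.sqrt_eq_rpow]
    exact Real.rpow_le_rpow_of_exponent_ge hκ (by linarith) (by norm_num)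
  have h3 : κ * Real.sqrt κ ≤ 1 / 4 * κ ^ (1 / 4 : ℝ) := by gcongr
  have h4 := mul_le_mul h1 h3 (by positivity) (by positivity)
  have h5 : 0 ≤ (d : ℝ) ^ (3 / 4 : ℝ) * κ ^ (1 / 4 : ℝ) := by positivity
  nlinarith

/-- The logical error on the truncated code, in terms of the unnormalized untruncated states. -/
theorem logicalError_trunc_le (hd : 2 ≤ d) {κ : ℝ} (hκ : 0 < κ) (hκ1 : κ ≤ 1)
    (W : L2R ≃ₗᵢ[ℂ] L2R) {U : Matrix (Fin d) (Fin d) ℂ} (hU : U ∈ Matrix.unitaryGroup (Fin d) ℂ)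
    {c : ℂ} (hc : ‖c‖ = 1) {B : ℝ}
    (h : ∀ j, ‖W (codeword hd (comb κ (peakL2 (symWidth d κ))) j) -
      c • ∑ k, U k j • codeword hd (comb κ (peakL2 (symWidth d κ))) k‖ ≤ B * Real.sqrt κ) :
    logicalError (symEncodingTrunc hd hκ) W U ≤
      ENNReal.ofReal (2 * d * (B + 7 * (1 + d)) * Real.sqrt κ) := by
  have hΔ := symWidth_pos hd hκ
  set Δ := symWidth d κ
  set A := comb κ (peakL2 Δ) with hA
  have hone : 1 ≤ ‖A‖ := one_le_norm_comb_peakL2 hκ hΔ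
  refine (logicalError_le_sum _ W hU hc).trans (ENNReal.ofReal_le_ofReal ?_)
  have hs : ∀ j, ((symEncodingTrunc hd hκ (EuclideanSpace.single j 1)) : L2R) =
      codeword hd (gkpTrunc (1 / (2 * d)) κ Δ) j := isometricEncoding_single _
  simp only [hs]
  set g := gkp κ Δ with hg
  set t := gkpTrunc (1 / (2 * d)) κ Δ with ht
  set δ := 7 * (κ * Real.sqrt κ) with hδ
  have hgt (j : Fin d) : ‖codeword hd t j - codeword hd g j‖ ≤ δ := by
    rw [← codeword_sub, norm_codeword, norm_sub_rev]
    exact norm_gkp_sub_gkpTrunc_le hd hκ hκ1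
  have hgA (j : Fin d) : codeword hd g j = ((‖A‖⁻¹ : ℝ) : ℂ) • codeword hd A j := by
    rw [← codeword_smul]; rfl
  -- All the code states share the normalization ‖A‖ ≥ 1, and dividing by it only lowers the error.
  have hB (j : Fin d) : ‖W (codeword hd g j) - c • ∑ k, U k j • codeword hd g k‖ ≤
      B * Real.sqrt κ := by
    have h1 : W (codeword hd g j) - c • ∑ k, U k j • codeword hd g k = ((‖A‖⁻¹ : ℝ) : ℂ) •
        (W (codeword hd A j) - c • ∑ k, U k j • codeword hd A k) := by
      simp only [hgA, map_smul, smul_sub, Finset.smul_sum]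
      congr 1
      refine Finset.sum_congr rfl fun k _ => ?_
      rw [smul_comm (U k j), smul_comm c]
    rw [h1, norm_smul, Complex.norm_real, norm_inv, norm_norm]
    refine le_trans ?_ (h j)
    exact mul_le_of_le_one_left (norm_nonneg _) (inv_le_one_of_one_le₀ hone)
  have hterm (j : Fin d) : ‖W (codeword hd t j) - c • ∑ k, U k j • codeword hd t k‖ ≤
      (B + 7 * (1 + d)) * Real.sqrt κ := by
    -- Passing from full to truncated states costs δ in the argument of W and at most dδ in the
    -- target, as |U_{kj}| ≤ 1.
    have h1 : W (codeword hd t j) - c • ∑ k, U k j • codeword hd t k =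
        (W (codeword hd g j) - c • ∑ k, U k j • codeword hd g k) +
          (W (codeword hd t j - codeword hd g j) -
            c • ∑ k, U k j • (codeword hd t k - codeword hd g k)) := by
      simp only [map_sub, smul_sub, Finset.sum_sub_distrib]
      abel
    have h2 : ‖c • ∑ k, U k j • (codeword hd t k - codeword hd g k)‖ ≤ d * δ := by
      rw [norm_smul, hc, one_mul]
      refine (norm_sum_le_of_le _ (f := fun k => U k j • (codeword hd t k - codeword hd g k))
        (n := fun _ => δ) fun k _ => ?_).trans_eq (by simp)
      rw [norm_smul]
      calc _ ≤ 1 * δ := mul_le_mul (entry_norm_bound_of_unitary hU k j) (hgt k) (norm_nonneg _)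
              zero_le_one
        _ = δ := one_mul δ
    have h3 : ‖W (codeword hd t j - codeword hd g j)‖ ≤ δ := by
      rw [LinearIsometryEquiv.norm_map]; exact hgt j
    have h4 : δ ≤ 7 * Real.sqrt κ := by
      rw [hδ]
      nlinarith [mul_le_of_le_one_left (Real.sqrt_nonneg κ) hκ1]
    rw [h1]
    refine (norm_add_le _ _).trans ((add_le_add (hB j) (norm_sub_le _ _)).trans ?_)
    have h5 : (d : ℝ) * δ ≤ d * (7 * Real.sqrt κ) := by gcongr
    linarith
  calc _ ≤ 2 * ∑ j : Fin d, (B + 7 * (1 + d)) * Real.sqrt κ := by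
        gcongr with j; exact hterm j
    _ = _ := by simp; ring

theorem tendsto_logicalError_trunc (hd : 2 ≤ d)
    (W : L2R ≃ₗᵢ[ℂ] L2R) {U : Matrix (Fin d) (Fin d) ℂ} (hU : U ∈ Matrix.unitaryGroup (Fin d) ℂ)
    {c : ℂ} (hc : ‖c‖ = 1) {B : ℝ}
    (h : ∀ κ : ℝ, 0 < κ → κ ≤ 1 / 4 → ∀ j,
      ‖W (codeword hd (comb κ (peakL2 (symWidth d κ))) j) -
        c • ∑ k, U k j • codeword hd (comb κ (peakL2 (symWidth d κ))) k‖ ≤ B * Real.sqrt κ) :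
    Filter.Tendsto (fun κ : Set.Ioo (0 : ℝ) (1 / 4) =>
        logicalError (symEncodingTrunc hd κ.2.1) W U)
      (Filter.comap Subtype.val (nhds (0 : ℝ))) (nhds 0) := by
  have h1 : Filter.Tendsto (fun κ : Set.Ioo (0 : ℝ) (1 / 4) =>
      ENNReal.ofReal (2 * d * (B + 7 * (1 + d)) * Real.sqrt κ))
      (Filter.comap Subtype.val (nhds (0 : ℝ))) (nhds 0) := by
    have h2 : Continuous fun κ : ℝ => ENNReal.ofReal (2 * d * (B + 7 * (1 + d)) * Real.sqrt κ) :=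
      ENNReal.continuous_ofReal.comp (by fun_prop)
    have h3 := (h2.tendsto 0).comp (Filter.tendsto_comap (f := (Subtype.val :
      Set.Ioo (0 : ℝ) (1 / 4) → ℝ)))
    simp only [Real.sqrt_zero, mul_zero, ENNReal.ofReal_zero] at h3
    exact h3
  refine tendsto_of_tendsto_of_tendsto_of_le_of_le tendsto_const_nhds h1 (fun _ => bot_le)
    fun κ => ?_
  exact logicalError_trunc_le hd κ.2.1 (by linarith [κ.2.2]) W hU hc
    (h κ κ.2.1 κ.2.2.le)

end Encoding

/-! ### Unitarity of the logical gates. -/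

section Gates

variable {d : ℕ}

theorem gateX_mem (hd : 2 ≤ d) : gateX d ∈ Matrix.unitaryGroup (Fin d) ℂ := by
  rw [Matrix.mem_unitaryGroup_iff']
  ext i j
  have hd0 : 0 < d := by omega
  set k : Fin d := ⟨((i : ℕ) + 1) % d, Nat.mod_lt _ hd0⟩ with hk
  rw [Matrix.mul_apply, Finset.sum_eq_single k]
  · have h1 : gateX d k i = 1 := by simp [gateX, hk]
    rw [Matrix.star_apply, h1, star_one, one_mul, Matrix.one_apply]
    have h2 : ((i : ℕ) + 1) % d = ((j : ℕ) + 1) % d ↔ i = j := by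
      refine ⟨fun h => ?_, fun h => by rw [h]⟩
      have h3 : (i : ℕ) ≡ j [MOD d] := Nat.ModEq.add_right_cancel' 1 h
      exact Fin.ext (Nat.ModEq.eq_of_lt_of_lt h3 i.2 j.2)
    simp [gateX, hk, h2]
  · intro b _ hb
    have : gateX d b i = 0 := by
      simp only [gateX, Matrix.of_apply, ite_eq_right_iff]
      intro h
      exact absurd (Fin.ext h) hb
    rw [Matrix.star_apply, this, star_zero, zero_mul]
  · simp

theorem gateZ_mem (d : ℕ) : gateZ d ∈ Matrix.unitaryGroup (Fin d) ℂ := by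
  rw [Matrix.mem_unitaryGroup_iff', gateZ, Matrix.star_eq_conjTranspose,
    Matrix.diagonal_conjTranspose, Matrix.diagonal_mul_diagonal, ← Matrix.diagonal_one]
  congr 1
  ext x
  have h : 2 * π * Complex.I * (x : ℕ) / d = ((2 * π * (x : ℕ) / d : ℝ) : ℂ) * Complex.I := by
    push_cast; ring
  rw [Pi.star_apply, h, RCLike.star_def, RCLike.conj_mul, Complex.norm_exp_ofReal_mul_I]
  simp

/-- Entries of F†F are geometric sums in z = e^{2πi(j−i)/d}, a d-th root of unity that equals 1 only
for i = j. -/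
theorem gateF_mem (hd : 2 ≤ d) : gateF d ∈ Matrix.unitaryGroup (Fin d) ℂ := by
  have hd0 : (d : ℂ) ≠ 0 := by exact_mod_cast (by omega : d ≠ 0)
  rw [Matrix.mem_unitaryGroup_iff']
  ext i j
  set ζ := Complex.exp (2 * π * Complex.I / d) with hζ
  have hprim : IsPrimitiveRoot ζ d := Complex.isPrimitiveRoot_exp d (by omega)
  set z := Complex.exp (2 * π * Complex.I * (((j : ℕ) : ℂ) - (i : ℕ)) / d) with hz
  have hentry (k : Fin d) : star (gateF d) i k * gateF d k j = (d : ℂ)⁻¹ * z ^ (k : ℕ) := by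
    rw [Matrix.star_apply, gateF, Matrix.of_apply, Matrix.of_apply, RCLike.star_def, map_mul,
      Complex.conj_ofReal, ← Complex.exp_conj, mul_mul_mul_comm, ← Complex.exp_add,
      ← Complex.ofReal_mul, ← mul_inv, Real.mul_self_sqrt (by positivity), hz,
      ← Complex.exp_nat_mul]
    congr 1
    · push_cast; rfl
    · congr 1
      simp only [map_div₀, map_mul, Complex.conj_I, Complex.conj_ofReal, map_natCast, map_ofNat]
      ring
  rw [Matrix.mul_apply, Finset.sum_congr rfl fun k _ => hentry k, ← Finset.mul_sum,
    Fin.sum_univ_eq_sum_range fun n => z ^ n, Matrix.one_apply]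
  split_ifs with hij
  · have : z = 1 := by rw [hz, hij]; simp
    simp [this, hd0]
  · have hz1 : z ≠ 1 := by
      intro h
      apply hij
      have h1 : ζ ^ (j : ℕ) = ζ ^ (i : ℕ) := by
        have h2 : ζ ^ (j : ℕ) = z * ζ ^ (i : ℕ) := by
          rw [hz, hζ, ← Complex.exp_nat_mul, ← Complex.exp_nat_mul, ← Complex.exp_add]
          congr 1
          ring
        rw [h2, h, one_mul]
      exact (Fin.ext (hprim.pow_inj j.2 i.2 h1)).symm
    have hzd : z ^ d = 1 := by
      rw [hz, ← Complex.exp_nat_mul, Complex.exp_eq_one_iff]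
      refine ⟨(j : ℕ) - (i : ℕ), ?_⟩
      push_cast
      field_simp
    rw [geom_sum_eq hz1, hzd, sub_self, zero_div, mul_zero]

end Gates

/-! ### The gates X and Z: combs under translation and modulation. -/

section Displacements

variable {d : ℕ}

theorem sqrt_mul_eq (hd : 2 ≤ d) :
    Real.sqrt (2 * π / d) = Real.sqrt (2 * π * d) * (1 / d) := by
  have hd0 : (0 : ℝ) < d := by exact_mod_cast (by omega : 0 < d)
  rw [Real.sqrt_eq_iff_mul_self_eq (by positivity) (by positivity),
    mul_mul_mul_comm, Real.mul_self_sqrt (by positivity)]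
  field_simp

theorem sqrt_mul_sqrt (hd : 2 ≤ d) : Real.sqrt (2 * π / d) * Real.sqrt (2 * π * d) = 2 * π := by
  have hd0 : (0 : ℝ) < d := by exact_mod_cast (by omega : 0 < d)
  rw [sqrt_mul_eq hd, mul_right_comm, Real.mul_self_sqrt (by positivity)]
  field_simp

/-- Before squeezing, one logical step is a translation by 1/d, so d steps make exactly one period
of the comb. -/
theorem translation_mul_sqrt (hd : 2 ≤ d) (t : ℝ) (f : L2R) :
    translation (t * Real.sqrt (2 * π / d)) (squeezing (sqrt_two_pi_mul_pos hd) f) =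
      squeezing (sqrt_two_pi_mul_pos hd) (translation (t / d) f) := by
  rw [← translation_squeezing, sqrt_mul_eq hd]
  congr 2
  ring

theorem codeword_eq (hd : 2 ≤ d) (f : L2R) (j : Fin d) :
    codeword hd f j =
      squeezing (sqrt_two_pi_mul_pos hd) (translation (((j : ℕ) : ℝ) / d) f) :=
  translation_mul_sqrt hd _ f

theorem translation_zero (f : L2R) : translation 0 f = f := by
  apply Lp.ext
  filter_upwards [translation_coeFn 0 f] with x hx
  rw [hx, sub_zero]

/-- The increments of the envelope are dominated by a wider envelope. -/
theorem abs_envelope_add_sub_le {κ : ℝ} (hκ : 0 < κ) (s z : ℝ) :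
    |envelope κ (s + z) - envelope κ s| ≤
      6 * κ * |z| * Real.exp (3 * κ ^ 2 * z ^ 2) * envelope (κ / 2) s := by
  set a := κ * |s| with ha
  set b := κ * |z| with hb
  have ha0 : 0 ≤ a := by positivity
  have hb0 : 0 ≤ b := by positivity
  have ha2 : a ^ 2 = κ ^ 2 * s ^ 2 := by rw [ha, mul_pow, sq_abs]
  have hb2 : b ^ 2 = κ ^ 2 * z ^ 2 := by rw [hb, mul_pow, sq_abs]
  set u := -(κ ^ 2 * s * z + κ ^ 2 * z ^ 2 / 2) with hu
  have hule : |u| ≤ b * (a + b / 2) := by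
    rw [hu, abs_neg]
    refine (abs_add_le _ _).trans (le_of_eq ?_)
    rw [abs_mul, abs_mul, abs_of_nonneg (by positivity : 0 ≤ κ ^ 2 * z ^ 2 / 2),
      abs_of_nonneg (by positivity : 0 ≤ κ ^ 2), ← hb2, ha, hb]
    ring
  have hexp : |Real.exp u - 1| ≤ |u| * Real.exp |u| := by
    rcases le_total 0 u with h | h
    · rw [abs_of_nonneg h, abs_of_nonneg (by linarith [Real.add_one_le_exp u])]
      have h1 := Real.add_one_le_exp (-u)
      have h2 : Real.exp (-u) * Real.exp u = 1 := by rw [← Real.exp_add]; simp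
      nlinarith [Real.exp_pos u]
    · rw [abs_of_nonpos h, abs_of_nonpos (by linarith [Real.exp_le_one_iff.mpr h])]
      have h1 := Real.add_one_le_exp u
      have h2 : 1 ≤ Real.exp (-u) := Real.one_le_exp (by linarith)
      nlinarith
  have hfac : envelope κ (s + z) - envelope κ s =
      Real.sqrt κ / π ^ (1 / 4 : ℝ) * Real.exp (-(a ^ 2 / 2)) * (Real.exp u - 1) := by
    have : Real.exp (-(κ ^ 2 * (s + z) ^ 2 / 2)) = Real.exp (-(a ^ 2 / 2)) * Real.exp u := by
      rw [← Real.exp_add, ha2, hu]; congr 1; ring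
    rw [envelope, envelope, this, ha2]; ring
  -- The exponent is chosen so that adding −a²/2 and b(a + b/2) gives −a²/8 + 3b²: the decay of
  -- η_{κ/2}(s) times e^{3κ²z²}. The quadratic form is positive definite and so dominates the linear
  -- left side.
  have hquad : a + b / 2 ≤ 3 * Real.exp (3 / 8 * a ^ 2 - a * b + 5 / 2 * b ^ 2) := by
    have h1 := Real.add_one_le_exp (3 / 8 * a ^ 2 - a * b + 5 / 2 * b ^ 2)
    nlinarith [sq_nonneg (a / 2 - b), sq_nonneg (a - 2), sq_nonneg (b - 1 / 2)]
  have hwide : Real.sqrt κ ≤ 2 * Real.sqrt (κ / 2) := by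
    rw [Real.sqrt_le_left (by positivity), mul_pow, Real.sq_sqrt (by positivity)]
    linarith
  have hE : Real.exp (-(a ^ 2 / 2)) * (Real.exp (3 / 8 * a ^ 2 - a * b + 5 / 2 * b ^ 2) *
      Real.exp (b * (a + b / 2))) = Real.exp (3 * κ ^ 2 * z ^ 2) *
        Real.exp (-((κ / 2) ^ 2 * s ^ 2 / 2)) := by
    rw [← Real.exp_add, ← Real.exp_add, ← Real.exp_add]
    congr 1
    linear_combination (-1 / 8 : ℝ) * ha2 + 3 * hb2
  have hp : 0 < π ^ (1 / 4 : ℝ) := Real.rpow_pos_of_pos Real.pi_pos _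
  rw [hfac, abs_mul, abs_of_nonneg (by positivity)]
  calc _ ≤ Real.sqrt κ / π ^ (1 / 4 : ℝ) * Real.exp (-(a ^ 2 / 2)) *
        (b * (a + b / 2) * Real.exp (b * (a + b / 2))) := by
        gcongr
        exact hexp.trans (by gcongr)
    _ ≤ 2 * Real.sqrt (κ / 2) / π ^ (1 / 4 : ℝ) * Real.exp (-(a ^ 2 / 2)) *
        (b * (3 * Real.exp (3 / 8 * a ^ 2 - a * b + 5 / 2 * b ^ 2)) *
          Real.exp (b * (a + b / 2))) := by
        gcongr
    _ = 6 * b * (Real.sqrt (κ / 2) / π ^ (1 / 4 : ℝ)) * (Real.exp (-(a ^ 2 / 2)) *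
        (Real.exp (3 / 8 * a ^ 2 - a * b + 5 / 2 * b ^ 2) * Real.exp (b * (a + b / 2)))) := by ring
    _ = _ := by rw [hE, envelope]; ring

theorem tsum_envelope_half_le {κ : ℝ} (hκ : 0 < κ) (hκ1 : κ ≤ 1) :
    ∑' s : ℤ, envelope (κ / 2) s ≤ 8 / Real.sqrt κ := by
  refine (tsum_envelope_le (by positivity) (by linarith)).trans ?_
  have h1 : 0 < Real.sqrt κ := Real.sqrt_pos.mpr hκ
  have hwide : Real.sqrt κ ≤ 2 * Real.sqrt (κ / 2) := by
    rw [Real.sqrt_le_left (by positivity), mul_pow, Real.sq_sqrt (by positivity)]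
    linarith
  rw [div_le_div_iff₀ (by positivity) h1]
  linarith

theorem norm_tsum_le_of_norm_le_envelope_half {κ : ℝ} (hκ : 0 < κ) (hκ1 : κ ≤ 1) {f : ℤ → L2R}
    {c : ℝ} (hc : 0 ≤ c) (hf : ∀ s : ℤ, ‖f s‖ ≤ c * κ * envelope (κ / 2) s) :
    ‖∑' s : ℤ, f s‖ ≤ 8 * c * Real.sqrt κ := by
  have h := tsum_of_norm_bounded
    ((summable_envelope (by positivity : 0 < κ / 2)).mul_left (c * κ)).hasSum hf
  refine h.trans ?_
  rw [tsum_mul_left]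
  have h1 : 0 < Real.sqrt κ := Real.sqrt_pos.mpr hκ
  calc _ ≤ c * κ * (8 / Real.sqrt κ) := by
        gcongr; exact tsum_envelope_half_le hκ hκ1
    _ = _ := by
        field_simp
        rw [Real.sq_sqrt hκ.le]

/-- A comb is nearly invariant under translation by one period. -/
theorem norm_translation_one_comb_sub_le {κ : ℝ} (hκ : 0 < κ) (hκ1 : κ ≤ 1 / 4) {f : L2R}
    (hf : ‖f‖ = 1) : ‖translation 1 (comb κ f) - comb κ f‖ ≤ 96 * Real.sqrt κ := by
  -- After reindexing, the shifted comb has the same teeth, with weights η_κ(s − 1) in place of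
  -- η_κ(s).
  have h1 : HasSum (fun s : ℤ => (envelope κ ((s : ℝ) + -1) : ℂ) • translation s f)
      (translation 1 (comb κ f)) := by
    have h2 := (summable_comb hκ f).hasSum.mapL
      (translation 1).toContinuousLinearEquiv.toContinuousLinearMap
    rw [← (Equiv.addRight (1 : ℤ)).hasSum_iff]
    refine h2.congr_fun fun s => ?_
    change _ = translation 1 ((envelope κ s : ℂ) • translation s f)
    simp only [Function.comp, Equiv.coe_addRight]
    rw [map_smul, translation_translation]
    push_cast
    rw [add_comm (1 : ℝ), add_neg_cancel_right]
  have h3 := h1.sub (summable_comb hκ f).hasSum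
  refine (congrArg norm h3.tsum_eq.symm).trans_le ?_
  -- 12 = 6 · 2, the 2 bounding e^{3κ²} for κ ≤ 1/4.
  refine (norm_tsum_le_of_norm_le_envelope_half (c := 12) hκ (by linarith) (by norm_num)
    fun s => ?_).trans_eq (by ring)
  rw [← sub_smul, norm_smul, LinearIsometryEquiv.norm_map, hf, mul_one, ← Complex.ofReal_sub,
    Complex.norm_real, Real.norm_eq_abs]
  refine (abs_envelope_add_sub_le hκ s (-1)).trans ?_
  have h4 : Real.exp (3 * κ ^ 2 * (-1) ^ 2) ≤ 2 := by
    have h5 : 3 * κ ^ 2 * (-1) ^ 2 ≤ 1 / 2 := by nlinarith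
    have h6 := Real.add_one_le_exp (-(1 / 2) : ℝ)
    refine (Real.exp_le_exp.mpr h5).trans ?_
    rw [← neg_neg (1 / 2 : ℝ), Real.exp_neg]
    exact inv_le_of_inv_le₀ (by norm_num) (by linarith)
  have h7 := (envelope_pos (by positivity : 0 < κ / 2) s).le
  rw [abs_neg, abs_one, mul_one]
  nlinarith [mul_le_mul_of_nonneg_right h4 (mul_nonneg hκ.le h7)]

theorem gateX_error (hd : 2 ≤ d) {κ : ℝ} (hκ : 0 < κ) (hκ1 : κ ≤ 1 / 4) {f : L2R}
    (hf : ‖f‖ = 1) (j : Fin d) :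
    ‖translation (Real.sqrt (2 * π / d)) (codeword hd (comb κ f) j) -
      (1 : ℂ) • ∑ k, gateX d k j • codeword hd (comb κ f) k‖ ≤ 96 * Real.sqrt κ := by
  have hd0 : 0 < d := by omega
  have hdR : (d : ℝ) ≠ 0 := by exact_mod_cast hd0.ne'
  set A := comb κ f
  set k : Fin d := ⟨((j : ℕ) + 1) % d, Nat.mod_lt _ hd0⟩ with hk
  have h1 : ∑ i, gateX d i j • codeword hd A i = codeword hd A k := by
    rw [Finset.sum_eq_single k]
    · simp [gateX, hk]
    · intro b _ hb
      have : gateX d b j = 0 := by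
        simp only [gateX, Matrix.of_apply, ite_eq_right_iff]
        intro h
        exact absurd (Fin.ext h) hb
      rw [this, zero_smul]
    · simp
  have h2 : translation (Real.sqrt (2 * π / d)) (codeword hd A j) =
      squeezing (sqrt_two_pi_mul_pos hd) (translation ((((j : ℕ) + 1 : ℕ) : ℝ) / d) A) := by
    rw [codeword, translation_translation, ← translation_mul_sqrt hd]
    congr 2
    push_cast
    ring
  rw [one_smul, h1, h2, codeword_eq, ← map_sub, LinearIsometryEquiv.norm_map]
  -- The shift is exact except at j = d − 1, where wrapping around to 0 leaves a translation by one
  -- full period.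
  rcases (by omega : (j : ℕ) + 1 < d ∨ (j : ℕ) + 1 = d) with h | h
  · have : (k : ℕ) = (j : ℕ) + 1 := Nat.mod_eq_of_lt h
    rw [this, sub_self, norm_zero]
    positivity
  · have : (k : ℕ) = 0 := by simp [hk, h]
    rw [this, h, div_self hdR, Nat.cast_zero, zero_div, translation_zero]
    exact norm_translation_one_comb_sub_le hκ hκ1 hf

/-- |e^{iax} − 1| ≤ |a||x| and |x| ≤ 2Δ e^{x²/(4Δ²)}; the split-off half of the Gaussian absorbs the
exponential. -/
theorem norm_modulation_peakL2_sub_le (a : ℝ) {Δ : ℝ} (hΔ : 0 < Δ) :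
    ‖modulation a (peakL2 Δ) - peakL2 Δ‖ ≤ 4 * Δ * |a| := by
  apply norm_le_of_le_peak (σ := Real.sqrt 2 * Δ) (by positivity)
  filter_upwards [Lp.coeFn_sub (modulation a (peakL2 Δ)) (peakL2 Δ), peakL2_coeFn Δ,
    modulation_coeFn a (peakL2 Δ)] with x h1 h2 h3
  rw [h1, Pi.sub_apply, h3, h2, ← sub_one_mul, norm_mul, Complex.norm_real,
    Real.norm_of_nonneg (peak_pos hΔ x).le]
  have h4 : ‖Complex.exp (Complex.I * (a * x : ℝ)) - 1‖ ≤ |a| * |x| := by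
    have := Real.norm_exp_I_mul_ofReal_sub_one_le (x := a * x)
    rwa [Real.norm_eq_abs, abs_mul] at this
  have h5 : |x| ≤ 2 * Δ * Real.exp (x ^ 2 / (4 * Δ ^ 2)) := by
    have h6 := Real.add_one_le_exp (x ^ 2 / (4 * Δ ^ 2))
    have h7 : x ^ 2 / (4 * Δ ^ 2) = (|x| / (2 * Δ)) ^ 2 := by
      rw [div_pow, sq_abs]; ring
    have h8 : |x| / (2 * Δ) ≤ Real.exp (x ^ 2 / (4 * Δ ^ 2)) := by
      rw [h7] at h6 ⊢
      nlinarith [sq_nonneg (|x| / (2 * Δ) - 1 / 2)]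
    rwa [div_le_iff₀ (by positivity), mul_comm] at h8
  have h9 : Real.exp (x ^ 2 / (4 * Δ ^ 2)) * Real.exp (-(x ^ 2 / (4 * Δ ^ 2))) = 1 := by
    rw [← Real.exp_add]; simp
  have hp := peak_pos (Δ := Real.sqrt 2 * Δ) (by positivity) x
  calc _ ≤ |a| * (2 * Δ * Real.exp (x ^ 2 / (4 * Δ ^ 2))) *
        (2 * Real.exp (-(x ^ 2 / (4 * Δ ^ 2))) * peak (Real.sqrt 2 * Δ) x) := by
        refine mul_le_mul (h4.trans (by gcongr)) (peak_le_exp_mul_peak hΔ x) (peak_pos hΔ x).le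
          (by positivity)
    _ = 4 * Δ * |a| * peak (Real.sqrt 2 * Δ) x * (Real.exp (x ^ 2 / (4 * Δ ^ 2)) *
        Real.exp (-(x ^ 2 / (4 * Δ ^ 2)))) := by ring
    _ = _ := by rw [h9, mul_one]

/-- A comb of narrow peaks is nearly invariant under modulations of period one. -/
theorem norm_modulation_comb_sub_le {κ Δ : ℝ} (hκ : 0 < κ) (hκ1 : κ ≤ 1) (hΔ : 0 < Δ)
    (hΔκ : 2 * π * Δ ≤ κ) (n : ℕ) :
    ‖modulation (2 * π * n) (comb κ (peakL2 Δ)) - comb κ (peakL2 Δ)‖ ≤ 16 * n * Real.sqrt κ := by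
  set ψ := peakL2 Δ
  -- Modulation by 2πn commutes with integer translations, so it acts on the single peak, where 2πΔ
  -- ≤ κ makes its effect of order κ.
  have hphase (s : ℤ) : Complex.exp (Complex.I * (2 * π * n * s : ℝ)) = 1 := by
    rw [Complex.exp_eq_one_iff]
    exact ⟨n * s, by push_cast; ring⟩
  have h1 : HasSum (fun s : ℤ => (envelope κ s : ℂ) • translation s (modulation (2 * π * n) ψ))
      (modulation (2 * π * n) (comb κ ψ)) := by
    have h2 := (summable_comb hκ ψ).hasSum.mapL
      (modulation (2 * π * n)).toContinuousLinearEquiv.toContinuousLinearMap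
    refine h2.congr_fun fun s => ?_
    change _ = modulation (2 * π * n) ((envelope κ s : ℂ) • translation s ψ)
    rw [map_smul, modulation_translation, hphase, one_smul]
  have h3 : modulation (2 * π * n) (comb κ ψ) = comb κ (modulation (2 * π * n) ψ) :=
    h1.tsum_eq.symm
  rw [h3, ← comb_sub hκ]
  refine (norm_tsum_envelope_smul_le hκ hκ1 (c := 4 * Δ * |2 * π * n|) fun s => ?_).trans ?_
  · rw [LinearIsometryEquiv.norm_map]
    exact norm_modulation_peakL2_sub_le _ hΔ
  · have h5 : 0 < Real.sqrt κ := Real.sqrt_pos.mpr hκ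
    have hp := Real.pi_pos
    rw [abs_of_nonneg (by positivity)]
    calc _ = 16 * n * (2 * π * Δ) / Real.sqrt κ := by ring
      _ ≤ 16 * n * κ / Real.sqrt κ := by gcongr
      _ = _ := by
        field_simp
        rw [Real.sq_sqrt hκ.le]

theorem two_pi_mul_symWidth_le (hd : 2 ≤ d) {κ : ℝ} (hκ : 0 < κ) : 2 * π * symWidth d κ ≤ κ := by
  have hd1 : (1 : ℝ) ≤ d := by exact_mod_cast (by omega : 1 ≤ d)
  have hp := Real.pi_pos
  rw [symWidth, mul_div_assoc', div_le_iff₀ (by positivity)]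
  have : 0 < κ * (2 * π) := by positivity
  nlinarith

/-- Before squeezing, the modulation has frequency 2π. Moving it past the translation by j/d
produces the entry e^{2πij/d} of Z exactly; only its effect on the comb itself is an error. -/
theorem gateZ_error (hd : 2 ≤ d) {κ : ℝ} (hκ : 0 < κ) (hκ1 : κ ≤ 1) (j : Fin d) :
    ‖modulation (Real.sqrt (2 * π / d)) (codeword hd (comb κ (peakL2 (symWidth d κ))) j) -
      (1 : ℂ) • ∑ k, gateZ d k j • codeword hd (comb κ (peakL2 (symWidth d κ))) k‖ ≤
        16 * Real.sqrt κ := by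
  set A := comb κ (peakL2 (symWidth d κ)) with hA
  have hd0 : (d : ℂ) ≠ 0 := by exact_mod_cast (by omega : d ≠ 0)
  have h1 : ∑ k, gateZ d k j • codeword hd A k = gateZ d j j • codeword hd A j := by
    refine Finset.sum_eq_single j (fun b _ hb => ?_) (by simp)
    rw [gateZ, Matrix.diagonal_apply_ne _ hb, zero_smul]
  have h2 : modulation (Real.sqrt (2 * π / d)) (codeword hd A j) = gateZ d j j •
      squeezing (sqrt_two_pi_mul_pos hd) (translation (((j : ℕ) : ℝ) / d)
        (modulation (2 * π * (1 : ℕ)) A)) := by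
    rw [codeword_eq, modulation_squeezing, sqrt_mul_sqrt hd, modulation_translation, map_smul,
      Nat.cast_one, mul_one]
    congr 1
    rw [gateZ, Matrix.diagonal_apply_eq]
    congr 1
    push_cast
    ring
  have hz : ‖gateZ d j j‖ ≤ 1 := entry_norm_bound_of_unitary (gateZ_mem d) j j
  rw [one_smul, h1, h2, codeword_eq, ← smul_sub, ← map_sub, ← map_sub, norm_smul,
    LinearIsometryEquiv.norm_map, LinearIsometryEquiv.norm_map]
  refine (mul_le_of_le_one_left (norm_nonneg _) hz).trans ?_
  simpa using norm_modulation_comb_sub_le hκ hκ1 (symWidth_pos hd hκ)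
    (two_pi_mul_symWidth_le hd hκ) 1

end Displacements

/-! ### The gate F: Poisson summation for combs. -/

section Fourier

variable {d : ℕ}

/-- A series in `L²` that also converges pointwise has the pointwise sum. -/
theorem ae_eq_of_hasSum {F : ℤ → L2R} {f : L2R} (h : HasSum F f) {g : ℝ → ℂ}
    (hp : ∀ᵐ x, HasSum (fun s => F s x) (g x)) : f =ᵐ[volume] g := by
  have h1 : Filter.Tendsto (fun S : Finset ℤ => ∑ s ∈ S, F s) Filter.atTop (nhds f) := h
  -- L² convergence gives almost everywhere convergence along a sequence of finite partial sums; the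
  -- pointwise sum must be the limit along it.
  obtain ⟨ns, hns, hae⟩ := (tendstoInMeasure_of_tendsto_Lp h1).exists_seq_tendsto_ae'
  have h2 : ∀ᵐ x, ∀ S : Finset ℤ, (∑ s ∈ S, F s : L2R) x = ∑ s ∈ S, F s x := by
    rw [ae_all_iff]
    intro S
    filter_upwards [Lp.coeFn_finsetSum S F] with x hx
    rw [hx, Finset.sum_apply]
  filter_upwards [hae, h2, hp] with x hx1 hx2 hx3
  simp only [hx2] at hx1
  have h3 : Filter.Tendsto (fun S : Finset ℤ => ∑ s ∈ S, F s x) Filter.atTop (nhds (g x)) := hx3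
  exact tendsto_nhds_unique hx1 (h3.comp hns)

/-- The global phase `e^{iπ/4}` of the Fourier transform. -/
def fourierPhase : ℂ := Complex.exp (Complex.I * (π / 4 : ℝ))

theorem norm_fourierPhase : ‖fourierPhase‖ = 1 := by
  rw [fourierPhase, mul_comm]
  exact Complex.norm_exp_ofReal_mul_I _

/-- Ψ_1 is a multiple of the zeroth Hermite function, hence an eigenvector with eigenvalue e^{iπ/4};
squeezing reaches the other widths. -/
theorem fourierUnitary_peakL2 {Δ : ℝ} (hΔ : 0 < Δ) :
    fourierUnitary (peakL2 Δ) = fourierPhase • peakL2 Δ⁻¹ := by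
  have h1 : peakL2 1 = (((π ^ (1 / 4 : ℝ))⁻¹ : ℝ) : ℂ) • (herm 0).toLp 2 volume := by
    apply Lp.ext
    filter_upwards [peakL2_coeFn 1, (herm 0).coeFn_toLp 2 volume,
      Lp.coeFn_smul (((π ^ (1 / 4 : ℝ))⁻¹ : ℝ) : ℂ) ((herm 0).toLp 2 (volume : Measure ℝ))]
      with x hx hy hz
    rw [hx, hz, Pi.smul_apply, hy, herm, Function.iterate_zero_apply, gauss_apply, peak,
      smul_eq_mul]
    push_cast
    simp
  have h2 : fourierUnitary (peakL2 1) = fourierPhase • peakL2 1 := by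
    have h3 := fourierUnitary_herm 0
    rw [h1, map_smul, h3, smul_comm, fourierPhase]
    congr 3
    push_cast
    ring
  have h4 := squeezing_peakL2 hΔ one_pos
  have h5 := squeezing_peakL2 (inv_pos.mpr hΔ) one_pos
  rw [mul_one] at h4 h5
  rw [← h4, fourierUnitary_squeezing, h2, map_smul, h5]

/-- The rescaled Fourier transform of a narrow peak thereby becomes the envelope of the new comb. -/
theorem peak_inv {κ : ℝ} (hκ : 0 < κ) (x : ℝ) : peak κ⁻¹ x = envelope κ x := by
  rw [peak, envelope, Real.sqrt_inv]
  have : x ^ 2 / (2 * κ⁻¹ ^ 2) = κ ^ 2 * x ^ 2 / 2 := by field_simp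
  rw [this]
  congr 1
  have := Real.sqrt_pos.mpr hκ
  field_simp

/-- (2u − m)² ≥ 0 amounts to e^{-(u−m)²/(2σ²)} ≤ e^{u²/(2σ²)} e^{-m²/(4σ²)}. -/
theorem summable_peak {σ : ℝ} (hσ : 0 < σ) (u : ℝ) : Summable fun m : ℤ => peak σ (u - m) := by
  unfold peak
  apply Summable.mul_left
  have h := (summable_exp_neg_mul_sq (a := 1 / (4 * σ ^ 2)) (by positivity)).mul_left
    (Real.exp (u ^ 2 / (2 * σ ^ 2)))
  refine Summable.of_nonneg_of_le (fun _ => (Real.exp_pos _).le) (fun m => ?_) h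
  rw [← Real.exp_add]
  apply Real.exp_le_exp.mpr
  have h1 : 0 ≤ (2 * u - m) ^ 2 / (4 * σ ^ 2) := by positivity
  have h2 : u ^ 2 / (2 * σ ^ 2) + -(1 / (4 * σ ^ 2) * (m : ℝ) ^ 2) - -((u - m) ^ 2 / (2 * σ ^ 2)) =
      (2 * u - m) ^ 2 / (4 * σ ^ 2) := by
    field_simp
    ring
  linarith

/-- Poisson summation for the Gaussian envelope. -/
theorem tsum_envelope_mul_exp {κ : ℝ} (hκ : 0 < κ) (u : ℝ) :
    ∑' s : ℤ, (envelope κ s : ℂ) * Complex.exp (Complex.I * (2 * π * s * u : ℝ)) =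
      ((∑' m : ℤ, peak (κ / (2 * π)) (u - m) : ℝ) : ℂ) := by
  have hp := Real.pi_pos
  have hpc : (π : ℂ) ≠ 0 := by exact_mod_cast hp.ne'
  have hκc : (κ : ℂ) ≠ 0 := by exact_mod_cast hκ.ne'
  set a : ℝ := κ ^ 2 / (2 * π) with ha
  have ha0 : 0 < a := by positivity
  -- The phase e^{2πisu} is the linear term with parameter iu; in the dual sum it shifts m to m +
  -- i(iu) = m − u.
  have h := Complex.tsum_exp_neg_quadratic (a := (a : ℂ)) (by simpa using ha0) (Complex.I * u)
  have hl (s : ℤ) : (envelope κ s : ℂ) * Complex.exp (Complex.I * (2 * π * s * u : ℝ)) =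
      ((Real.sqrt κ / π ^ (1 / 4 : ℝ) : ℝ) : ℂ) *
        Complex.exp (-π * a * s ^ 2 + 2 * π * (Complex.I * u) * s) := by
    rw [envelope, Complex.ofReal_mul, mul_assoc, Complex.ofReal_exp, ← Complex.exp_add]
    congr 2
    rw [ha]
    push_cast
    field_simp
  have hr (m : ℤ) : Complex.exp (-π / a * (m + Complex.I * (Complex.I * u)) ^ 2) =
      ((π ^ (1 / 4 : ℝ) * Real.sqrt (κ / (2 * π)) : ℝ) : ℂ) * (peak (κ / (2 * π)) (u - m) : ℂ) := by
    have h0 : 0 < π ^ (1 / 4 : ℝ) * Real.sqrt (κ / (2 * π)) := by positivity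
    have h1 : π ^ (1 / 4 : ℝ) * Real.sqrt (κ / (2 * π)) * peak (κ / (2 * π)) (u - m) =
        Real.exp (-((u - m) ^ 2 / (2 * (κ / (2 * π)) ^ 2))) := by
      rw [peak, ← mul_assoc, mul_one_div_cancel h0.ne', one_mul]
    rw [← Complex.ofReal_mul, h1, Complex.ofReal_exp]
    congr 1
    rw [← mul_assoc, Complex.I_mul_I, ha]
    push_cast
    field_simp
    ring
  have hconst : (1 : ℂ) / (a : ℂ) ^ (1 / 2 : ℂ) = (((Real.sqrt a)⁻¹ : ℝ) : ℂ) := by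
    rw [Real.sqrt_eq_rpow, Complex.ofReal_inv, Complex.ofReal_cpow ha0.le, one_div]
    push_cast
    rfl
  simp_rw [hl, tsum_mul_left, h, hr, tsum_mul_left, hconst]
  rw [← Complex.ofReal_tsum, ← Complex.ofReal_mul, ← Complex.ofReal_mul, ← Complex.ofReal_mul]
  congr 1
  have h2p : 0 < Real.sqrt (2 * π) := Real.sqrt_pos.mpr (by positivity)
  have hsκ : 0 < Real.sqrt κ := Real.sqrt_pos.mpr hκ
  have hq : 0 < π ^ (1 / 4 : ℝ) := by positivity
  have hc : Real.sqrt κ / π ^ (1 / 4 : ℝ) * (Real.sqrt a)⁻¹ *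
      (π ^ (1 / 4 : ℝ) * Real.sqrt (κ / (2 * π))) = 1 := by
    rw [ha, Real.sqrt_div (by positivity), Real.sqrt_sq hκ.le, Real.sqrt_div hκ.le]
    field_simp
    exact Real.sq_sqrt hκ.le
  rw [← mul_assoc, ← mul_assoc, hc, one_mul]

/-- The product of the envelope and a shifted peak is square integrable. -/
theorem memLp_envelope_mul_peak (κ Δ a : ℝ) :
    MemLp (fun x : ℝ => ((envelope κ x * peak Δ (x - a) : ℝ) : ℂ)) 2 volume := by
  have h1 : MemLp (fun x : ℝ => (peak Δ (x - a) : ℂ)) 2 volume :=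
    (memLp_peak Δ).comp_measurePreserving (measurePreserving_sub_right volume a)
  refine h1.of_le_mul (c := Real.sqrt κ / π ^ (1 / 4 : ℝ)) ?_ ?_
  · apply Measurable.aestronglyMeasurable
    unfold envelope peak
    fun_prop
  · filter_upwards with x
    rw [Complex.norm_real, Complex.norm_real, norm_mul]
    refine mul_le_mul_of_nonneg_right ?_ (norm_nonneg _)
    rw [envelope, Real.norm_of_nonneg (by positivity)]
    refine mul_le_of_le_one_right (by positivity) (Real.exp_le_one_iff.mpr ?_)
    rw [neg_nonpos]
    positivity

/-- The peak `Ψ_Δ(· - a)` multiplied by the envelope `η_κ`. -/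
def windowedPeak (κ Δ a : ℝ) : L2R := (memLp_envelope_mul_peak κ Δ a).toLp

theorem windowedPeak_coeFn (κ Δ a : ℝ) :
    windowedPeak κ Δ a =ᵐ[volume] fun x => ((envelope κ x * peak Δ (x - a) : ℝ) : ℂ) :=
  (memLp_envelope_mul_peak κ Δ a).coeFn_toLp

theorem norm_le_of_le_peak_sub {f : L2R} {C σ a : ℝ} (hσ : 0 < σ)
    (h : ∀ᵐ x, ‖f x‖ ≤ C * peak σ (x - a)) : ‖f‖ ≤ C := by
  rw [← LinearIsometryEquiv.norm_map (translation (-a))]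
  apply norm_le_of_le_peak hσ
  filter_upwards [translation_coeFn (-a) f, (quasi_affine one_pos (-a)).ae h] with x hx hy
  rw [hx]
  simpa using hy

/-- Around its centre t + s the peak is so narrow that η_κ(x) may be replaced by η_κ(s). The growth
|z| e^{3κ²z²} of the increment, z = x − s, is absorbed by half of the peak's Gaussian because Δ ≤
1/4. The constant is 6 · 4 · 2. -/
theorem norm_windowedPeak_sub_le {κ Δ t : ℝ} (hκ : 0 < κ) (hκ1 : κ ≤ 1 / 4) (hΔ : 0 < Δ)
    (hΔ1 : Δ ≤ 1 / 4) (ht : |t| ≤ 1) (s : ℝ) :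
    ‖windowedPeak κ Δ (t + s) - (envelope κ s : ℂ) • translation (t + s) (peakL2 Δ)‖ ≤
      48 * κ * envelope (κ / 2) s := by
  apply norm_le_of_le_peak_sub (σ := Real.sqrt 2 * Δ) (a := t + s) (by positivity)
  have h0 : ∀ᵐ x : ℝ, peakL2 Δ (x - (t + s)) = (peak Δ (x - (t + s)) : ℂ) := by
    filter_upwards [(quasi_affine one_pos (t + s)).ae_eq_comp (peakL2_coeFn Δ)] with x hx
    simpa using hx
  filter_upwards [Lp.coeFn_sub (windowedPeak κ Δ (t + s))
      ((envelope κ s : ℂ) • translation (t + s) (peakL2 Δ)), windowedPeak_coeFn κ Δ (t + s),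
    Lp.coeFn_smul (envelope κ s : ℂ) (translation (t + s) (peakL2 Δ)),
    translation_coeFn (t + s) (peakL2 Δ), h0] with x h1 h2 h3 h4 h5
  rw [h1, Pi.sub_apply, h2, h3, Pi.smul_apply, h4, h5, smul_eq_mul, ← Complex.ofReal_mul,
    ← Complex.ofReal_sub, Complex.norm_real, ← sub_mul, norm_mul, Real.norm_eq_abs,
    Real.norm_of_nonneg (peak_pos hΔ _).le]
  set y := x - (t + s) with hy
  have hx : x = s + (t + y) := by rw [hy]; ring
  set z := t + y with hz
  have h6 := abs_envelope_add_sub_le hκ s z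
  rw [← hx] at h6
  have hz1 : |z| ≤ 1 + |y| := (abs_add_le t y).trans (by gcongr)
  have hz2 : |z| * Real.exp (3 * κ ^ 2 * z ^ 2) ≤ 4 * Real.exp (y ^ 2 / (4 * Δ ^ 2)) := by
    have e1 : 3 * κ ^ 2 * z ^ 2 ≤ 1 / 2 + y ^ 2 := by
      have e2 : z ^ 2 ≤ 2 + 2 * y ^ 2 := by
        rw [← sq_abs z, ← sq_abs y]
        nlinarith [abs_nonneg z, sq_nonneg (|y| - 1)]
      have e3 : κ ^ 2 ≤ 1 / 16 := by nlinarith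
      nlinarith [sq_nonneg z, sq_nonneg y, sq_nonneg κ]
    have e4 : |z| ≤ 2 * Real.exp (y ^ 2) := by
      have := Real.add_one_le_exp (y ^ 2)
      rw [← sq_abs y] at this ⊢
      nlinarith [sq_nonneg (|y| - 1 / 2)]
    have e5 : Real.exp (1 / 2) ≤ 2 := by
      have h6 := Real.add_one_le_exp (-(1 / 2) : ℝ)
      rw [← neg_neg (1 / 2 : ℝ), Real.exp_neg]
      exact inv_le_of_inv_le₀ (by norm_num) (by linarith)
    have e6 : y ^ 2 + y ^ 2 ≤ y ^ 2 / (4 * Δ ^ 2) := by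
      rw [le_div_iff₀ (by positivity)]
      have : Δ ^ 2 ≤ 1 / 16 := by nlinarith
      nlinarith [sq_nonneg y]
    calc |z| * Real.exp (3 * κ ^ 2 * z ^ 2)
        ≤ 2 * Real.exp (y ^ 2) * (Real.exp (1 / 2) * Real.exp (y ^ 2)) := by
          rw [← Real.exp_add]
          gcongr
      _ ≤ 2 * Real.exp (y ^ 2) * (2 * Real.exp (y ^ 2)) := by gcongr
      _ = 4 * Real.exp (y ^ 2 + y ^ 2) := by rw [Real.exp_add]; ring
      _ ≤ _ := by gcongr
  have h9 : Real.exp (y ^ 2 / (4 * Δ ^ 2)) * Real.exp (-(y ^ 2 / (4 * Δ ^ 2))) = 1 := by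
    rw [← Real.exp_add]; simp
  have hp := peak_pos (Δ := Real.sqrt 2 * Δ) (by positivity) y
  have he := envelope_pos (by positivity : 0 < κ / 2) s
  calc _ ≤ (6 * κ * (4 * Real.exp (y ^ 2 / (4 * Δ ^ 2))) * envelope (κ / 2) s) *
        (2 * Real.exp (-(y ^ 2 / (4 * Δ ^ 2))) * peak (Real.sqrt 2 * Δ) y) := by
        refine mul_le_mul (h6.trans ?_) (peak_le_exp_mul_peak hΔ y) (peak_pos hΔ y).le
          (by positivity)
        rw [mul_assoc (6 * κ)]
        gcongr
    _ = 48 * κ * envelope (κ / 2) s * peak (Real.sqrt 2 * Δ) y * (Real.exp (y ^ 2 / (4 * Δ ^ 2)) *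
        Real.exp (-(y ^ 2 / (4 * Δ ^ 2)))) := by ring
    _ = _ := by rw [h9, mul_one]

/-- The comb `η_κ(x) ∑_s Ψ_Δ(x - t - s)`, modulated by the envelope pointwise. -/
def windowedComb (κ Δ t : ℝ) : L2R := ∑' s : ℤ, windowedPeak κ Δ (t + s)

theorem hasSum_translation_comb {κ : ℝ} (hκ : 0 < κ) (t : ℝ) (f : L2R) :
    HasSum (fun s : ℤ => (envelope κ s : ℂ) • translation (t + s) f)
      (translation t (comb κ f)) := by
  have h2 := (summable_comb hκ f).hasSum.mapL
    (translation t).toContinuousLinearEquiv.toContinuousLinearMap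
  refine h2.congr_fun fun s => ?_
  change _ = translation t ((envelope κ s : ℂ) • translation s f)
  rw [map_smul, translation_translation]

theorem summable_windowedPeak {κ Δ t : ℝ} (hκ : 0 < κ) (hκ1 : κ ≤ 1 / 4) (hΔ : 0 < Δ)
    (hΔ1 : Δ ≤ 1 / 4) (ht : |t| ≤ 1) : Summable fun s : ℤ => windowedPeak κ Δ (t + s) := by
  have h1 : Summable fun s : ℤ =>
      windowedPeak κ Δ (t + s) - (envelope κ s : ℂ) • translation (t + s) (peakL2 Δ) :=
    Summable.of_norm_bounded ((summable_envelope (by positivity : 0 < κ / 2)).mul_left (48 * κ))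
      fun s => norm_windowedPeak_sub_le hκ hκ1 hΔ hΔ1 ht s
  refine (h1.add (hasSum_translation_comb hκ t (peakL2 Δ)).summable).congr fun s => ?_
  exact sub_add_cancel _ _

theorem norm_windowedComb_sub_le {κ Δ t : ℝ} (hκ : 0 < κ) (hκ1 : κ ≤ 1 / 4) (hΔ : 0 < Δ)
    (hΔ1 : Δ ≤ 1 / 4) (ht : |t| ≤ 1) :
    ‖windowedComb κ Δ t - translation t (comb κ (peakL2 Δ))‖ ≤ 384 * Real.sqrt κ := by
  have h1 := (summable_windowedPeak hκ hκ1 hΔ hΔ1 ht).hasSum.sub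
    (hasSum_translation_comb hκ t (peakL2 Δ))
  refine (congrArg norm h1.tsum_eq.symm).trans_le ?_
  exact (norm_tsum_le_of_norm_le_envelope_half hκ (by linarith) (by norm_num)
    fun s => norm_windowedPeak_sub_le hκ hκ1 hΔ hΔ1 ht s).trans_eq (by ring)

theorem windowedComb_coeFn {κ Δ t : ℝ} (hκ : 0 < κ) (hκ1 : κ ≤ 1 / 4) (hΔ : 0 < Δ)
    (hΔ1 : Δ ≤ 1 / 4) (ht : |t| ≤ 1) : windowedComb κ Δ t =ᵐ[volume]
      fun x => ((envelope κ x * ∑' s : ℤ, peak Δ (x - t - s) : ℝ) : ℂ) := by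
  refine ae_eq_of_hasSum (summable_windowedPeak hκ hκ1 hΔ hΔ1 ht).hasSum ?_
  filter_upwards [ae_all_iff.mpr fun s : ℤ => windowedPeak_coeFn κ Δ (t + s)] with x hx
  have h1 := Complex.hasSum_ofReal.mpr ((summable_peak hΔ (x - t)).hasSum.mul_left (envelope κ x))
  refine h1.congr_fun fun s => ?_
  rw [hx, sub_sub]

/-- Division with remainder, m = ds + k, splits (1/d)ℤ into d shifted copies of ℤ; √d is the
normalization of the dilation by d. -/
theorem tsum_peak_sub_div (hd : 2 ≤ d) {Δ : ℝ} (hΔ : 0 < Δ) (x : ℝ) :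
    ∑ k : Fin d, ∑' s : ℤ, peak Δ (x - ((k : ℕ) : ℝ) / d - s) =
      Real.sqrt d * ∑' m : ℤ, peak (d * Δ) (d * x - m) := by
  have : NeZero d := ⟨by omega⟩
  have hd0 : (0 : ℝ) < d := by exact_mod_cast (by omega : 0 < d)
  have h1 (m : ℤ) : Real.sqrt d * peak (d * Δ) (d * x - m) = peak Δ (x - m / d) := by
    have h2 := peak_mul (σ := (d : ℝ)⁻¹) (τ := d * Δ) (by positivity) (by positivity) (x - m / d)
    have h3 : (d : ℝ)⁻¹ * (d * Δ) = Δ := by field_simp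
    have h4 : (x - m / d) / (d : ℝ)⁻¹ = d * x - m := by field_simp
    rw [h3, h4, Real.sqrt_inv, inv_inv] at h2
    exact h2
  have h2 : HasSum (fun m : ℤ => peak Δ (x - m / d))
      (Real.sqrt d * ∑' m : ℤ, peak (d * Δ) (d * x - m)) :=
    ((summable_peak (by positivity : 0 < d * Δ) (d * x)).hasSum.mul_left (Real.sqrt d)).congr_fun
      fun m => (h1 m).symm
  have h3 := ((Equiv.prodComm (Fin d) ℤ).trans (Int.divModEquiv d).symm).hasSum_iff.mpr h2
  have h4 := h3.prod_fiberwise (g := fun k : Fin d => ∑' s : ℤ, peak Δ (x - ((k : ℕ) : ℝ) / d - s))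
    fun k => (summable_peak hΔ (x - ((k : ℕ) : ℝ) / d)).hasSum.congr_fun fun s => by
      simp only [Function.comp, Equiv.trans_apply, Equiv.prodComm_apply, Prod.swap,
        Int.divModEquiv_symm_apply]
      congr 1
      push_cast
      field_simp
      ring
  exact (hasSum_fintype _).unique h4

theorem symWidth_le (hd : 2 ≤ d) {κ : ℝ} (hκ : 0 < κ) (hκ1 : κ ≤ 1 / 4) :
    symWidth d κ ≤ 1 / 4 := by
  have h1 := two_pi_mul_symWidth_le hd hκ
  have h2 := symWidth_pos hd hκ
  nlinarith [Real.pi_gt_three]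

/-- The rescaled Fourier transform of a comb is a comb with `d` times as many peaks. -/
theorem squeezing_fourierUnitary_comb (hd : 2 ≤ d) {κ : ℝ} (hκ : 0 < κ) (hκ1 : κ ≤ 1 / 4)
    (hα : 0 < (2 * π * d)⁻¹) :
    squeezing hα (fourierUnitary (comb κ (peakL2 (symWidth d κ)))) =
      fourierPhase • (((Real.sqrt d)⁻¹ : ℝ) : ℂ) •
        ∑ k : Fin d, windowedComb κ (symWidth d κ) (((k : ℕ) : ℝ) / d) := by
  have hd0 : (0 : ℝ) < d := by exact_mod_cast (by omega : 0 < d)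
  have hp := Real.pi_pos
  have hΔ := symWidth_pos hd hκ
  have hΔ1 := symWidth_le hd hκ hκ1
  set Δ := symWidth d κ with hΔd
  have h1 : HasSum (fun s : ℤ => (envelope κ s : ℂ) • fourierPhase •
      modulation (2 * π * d * s) (peakL2 κ⁻¹)) (squeezing hα (fourierUnitary (comb κ (peakL2 Δ)))) := by
    have h2 := (summable_comb hκ (peakL2 Δ)).hasSum.mapL
      (fourierUnitary.trans (squeezing hα)).toContinuousLinearEquiv.toContinuousLinearMap
    refine h2.congr_fun fun s => ?_
    change _ = squeezing hα (fourierUnitary ((envelope κ s : ℂ) • translation s (peakL2 Δ)))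
    -- First use of the symmetric width: the transformed peak Ψ_{1/Δ} rescales to Ψ_{1/κ} = η_κ.
    have h3 : (2 * π * d)⁻¹ * Δ⁻¹ = κ⁻¹ := by
      rw [hΔd, symWidth]; field_simp
    have h4 : 2 * π * d * s * (2 * π * d)⁻¹ = s := by field_simp
    rw [map_smul, map_smul, fourierUnitary_translation, fourierUnitary_peakL2 hΔ, map_smul,
      map_smul, ← h3, ← squeezing_peakL2 hα (inv_pos.mpr hΔ), modulation_squeezing, h4]
  have hLHS := ae_eq_of_hasSum h1 (g := fun x => fourierPhase * (envelope κ x : ℂ) *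
    ((∑' m : ℤ, peak (κ / (2 * π)) (d * x - m) : ℝ) : ℂ)) ?_
  swap
  · have h2 : ∀ᵐ x, ∀ s : ℤ, ((envelope κ s : ℂ) • fourierPhase •
        modulation (2 * π * d * s) (peakL2 κ⁻¹) : L2R) x = fourierPhase * (envelope κ x : ℂ) *
          ((envelope κ s : ℂ) * Complex.exp (Complex.I * (2 * π * s * (d * x) : ℝ))) := by
      rw [ae_all_iff]
      intro s
      filter_upwards [Lp.coeFn_smul (envelope κ s : ℂ)
        (fourierPhase • modulation (2 * π * d * s) (peakL2 κ⁻¹)), Lp.coeFn_smul fourierPhase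
        (modulation (2 * π * d * s) (peakL2 κ⁻¹)), modulation_coeFn (2 * π * d * s) (peakL2 κ⁻¹),
        peakL2_coeFn κ⁻¹] with x e1 e2 e3 e4
      rw [e1, Pi.smul_apply, e2, Pi.smul_apply, e3, e4, peak_inv hκ, smul_eq_mul, smul_eq_mul,
        show 2 * π * d * s * x = 2 * π * s * (d * x) by ring]
      ring
    filter_upwards [h2] with x hx
    rw [← tsum_envelope_mul_exp hκ]
    refine (Summable.hasSum ?_).mul_left (fourierPhase * (envelope κ x : ℂ)) |>.congr_fun hx
    refine Summable.of_norm ((summable_envelope hκ).congr fun s => ?_)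
    rw [norm_mul, mul_comm Complex.I, Complex.norm_exp_ofReal_mul_I, mul_one, Complex.norm_real,
      Real.norm_of_nonneg (envelope_pos hκ _).le]
  apply Lp.ext
  refine hLHS.trans ?_
  have h5 : ∀ᵐ x, ∀ k : Fin d, windowedComb κ Δ (((k : ℕ) : ℝ) / d) x =
      ((envelope κ x * ∑' s : ℤ, peak Δ (x - ((k : ℕ) : ℝ) / d - s) : ℝ) : ℂ) := by
    rw [ae_all_iff]
    intro k
    refine windowedComb_coeFn hκ hκ1 hΔ hΔ1 ?_
    have : ((k : ℕ) : ℝ) ≤ d := by exact_mod_cast k.2.le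
    rw [abs_of_nonneg (by positivity)]
    exact div_le_one_of_le₀ this hd0.le
  filter_upwards [h5, Lp.coeFn_smul fourierPhase ((((Real.sqrt d)⁻¹ : ℝ) : ℂ) •
        ∑ k : Fin d, windowedComb κ Δ (((k : ℕ) : ℝ) / d)), Lp.coeFn_smul
        (((Real.sqrt d)⁻¹ : ℝ) : ℂ) (∑ k : Fin d, windowedComb κ Δ (((k : ℕ) : ℝ) / d)),
    Lp.coeFn_finsetSum Finset.univ (fun k : Fin d => windowedComb κ Δ (((k : ℕ) : ℝ) / d))]
    with x e1 e2 e3 e4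
  rw [e2, Pi.smul_apply, e3, Pi.smul_apply, e4, Finset.sum_apply, Finset.sum_congr rfl fun k _ => e1 k,
    ← Complex.ofReal_sum, ← Finset.mul_sum, tsum_peak_sub_div hd hΔ]
  -- Second use of the symmetric width: the peaks from Poisson summation are d-fold dilations of
  -- Ψ_Δ.
  have h6 : d * Δ = κ / (2 * π) := by rw [hΔd, symWidth]; field_simp
  have h7 : Real.sqrt d ≠ 0 := (Real.sqrt_pos.mpr hd0).ne'
  rw [h6, smul_eq_mul, smul_eq_mul, mul_assoc, ← Complex.ofReal_mul, ← Complex.ofReal_mul]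
  congr 2
  field_simp

theorem gateF_error (hd : 2 ≤ d) {κ : ℝ} (hκ : 0 < κ) (hκ1 : κ ≤ 1 / 4) (j : Fin d) :
    ‖fourierUnitary (codeword hd (comb κ (peakL2 (symWidth d κ))) j) -
      fourierPhase • ∑ k, gateF d k j • codeword hd (comb κ (peakL2 (symWidth d κ))) k‖ ≤
        (400 * d ^ 2) * Real.sqrt κ := by
  have hd1 : (1 : ℝ) ≤ d := by exact_mod_cast (by omega : 1 ≤ d)
  have hd0 : (0 : ℝ) < d := by linarith
  have hp := Real.pi_pos
  have hΔ := symWidth_pos hd hκ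
  have hΔ1 := symWidth_le hd hκ hκ1
  set Δ := symWidth d κ with hΔd
  set A := comb κ (peakL2 Δ) with hA
  have hr := sqrt_two_pi_mul_pos hd
  have hα : 0 < (2 * π * d)⁻¹ := by positivity
  set B := squeezing hα (fourierUnitary A) with hB
  set c := fourierPhase
  set C : ℂ := (((Real.sqrt d)⁻¹ : ℝ) : ℂ)
  have hc : ‖c‖ = 1 := norm_fourierPhase
  have hC : ‖C‖ ≤ 1 := by
    rw [Complex.norm_real, norm_inv, Real.norm_of_nonneg (Real.sqrt_nonneg _)]
    exact inv_le_one_of_one_le₀ (Real.one_le_sqrt.mpr hd1)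
  -- The transform yields squeezing by r⁻¹, r = √(2πd). Written as squeezing by r after squeezing by
  -- r⁻², it has the outer squeezing of the codewords, and the translation by j steps has become a
  -- modulation by 2πj.
  have h1 : fourierUnitary (codeword hd A j) =
      squeezing hr (modulation (2 * π * (j : ℕ)) B) := by
    have h2 : Real.sqrt (2 * π * d) * (2 * π * d)⁻¹ = (Real.sqrt (2 * π * d))⁻¹ := by
      rw [mul_inv_eq_iff_eq_mul₀ (by positivity), ← Real.mul_self_sqrt (by positivity : 0 ≤ 2 * π * d),
        Real.sqrt_mul_self hr.le]
      field_simp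
    have e : ((j : ℕ) : ℝ) * Real.sqrt (2 * π / d) * Real.sqrt (2 * π * d) = 2 * π * (j : ℕ) := by
      rw [mul_assoc, sqrt_mul_sqrt hd]
      ring
    rw [codeword, fourierUnitary_translation, fourierUnitary_squeezing,
      ← squeezing_squeezing hr hα _ h2, modulation_squeezing, e]
  have hBe : ‖B - c • C • ∑ k : Fin d, translation (((k : ℕ) : ℝ) / d) A‖ ≤
      d * (384 * Real.sqrt κ) := by
    rw [hB, squeezing_fourierUnitary_comb hd hκ hκ1, ← smul_sub, ← smul_sub,
      ← Finset.sum_sub_distrib, norm_smul, hc, one_mul, norm_smul]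
    refine (mul_le_of_le_one_left (norm_nonneg _) hC).trans ?_
    refine (norm_sum_le_of_le _ (n := fun _ => 384 * Real.sqrt κ) fun k _ => ?_).trans_eq (by simp)
    refine norm_windowedComb_sub_le hκ hκ1 hΔ hΔ1 ?_
    have : ((k : ℕ) : ℝ) ≤ d := by exact_mod_cast k.2.le
    rw [abs_of_nonneg (by positivity)]
    exact div_le_one_of_le₀ this hd0.le
  -- Moving the modulation by 2πj past the translation by k/d yields e^{2πijk/d}, which together
  -- with C = d^{-1/2} is the matrix entry of F.
  have hF (k : Fin d) : C • modulation (2 * π * (j : ℕ)) (translation (((k : ℕ) : ℝ) / d) A) =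
      gateF d k j • translation (((k : ℕ) : ℝ) / d) (modulation (2 * π * (j : ℕ)) A) := by
    rw [modulation_translation, smul_smul, gateF, Matrix.of_apply]
    congr 3
    push_cast
    ring
  -- Two errors: freezing the envelope on each peak (384 d √κ) and dropping the modulation of A by
  -- 2πj (16 d² √κ).
  have key : fourierUnitary (codeword hd A j) - c • ∑ k, gateF d k j • codeword hd A k =
      squeezing hr (modulation (2 * π * (j : ℕ))
          (B - c • C • ∑ k : Fin d, translation (((k : ℕ) : ℝ) / d) A) +
        c • ∑ k : Fin d, gateF d k j • translation (((k : ℕ) : ℝ) / d)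
          (modulation (2 * π * (j : ℕ)) A - A)) := by
    have h3 : modulation (2 * π * (j : ℕ))
        (c • C • ∑ k : Fin d, translation (((k : ℕ) : ℝ) / d) A) =
        c • ∑ k : Fin d, gateF d k j • translation (((k : ℕ) : ℝ) / d)
          (modulation (2 * π * (j : ℕ)) A) := by
      rw [map_smul, map_smul, map_sum, Finset.smul_sum, Finset.sum_congr rfl fun k _ => hF k]
    rw [h1, map_add, map_sub (modulation _), h3]
    simp only [codeword_eq, map_sub, smul_sub, Finset.sum_sub_distrib, map_smul, map_sum]
    abel
  have hj : ((j : ℕ) : ℝ) ≤ d := by exact_mod_cast j.2.le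
  have hmod := norm_modulation_comb_sub_le hκ (by linarith : κ ≤ 1) hΔ
    (two_pi_mul_symWidth_le hd hκ) (j : ℕ)
  have hs := Real.sqrt_nonneg κ
  have h4 : ‖c • ∑ k : Fin d, gateF d k j • translation (((k : ℕ) : ℝ) / d)
      (modulation (2 * π * (j : ℕ)) A - A)‖ ≤ d * (16 * d * Real.sqrt κ) := by
    rw [norm_smul, hc, one_mul]
    refine (norm_sum_le_of_le _ (n := fun _ => 16 * d * Real.sqrt κ) fun k _ => ?_).trans_eq (by simp)
    rw [norm_smul, LinearIsometryEquiv.norm_map]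
    refine (mul_le_of_le_one_left (norm_nonneg _)
      (entry_norm_bound_of_unitary (gateF_mem hd) k j)).trans (hmod.trans ?_)
    gcongr
  rw [key, LinearIsometryEquiv.norm_map]
  refine (norm_add_le _ _).trans ?_
  rw [LinearIsometryEquiv.norm_map]
  have h5 : (d : ℝ) * (384 * Real.sqrt κ) ≤ 384 * d ^ 2 * Real.sqrt κ := by
    have : (d : ℝ) ≤ d ^ 2 := by nlinarith
    nlinarith [mul_le_mul_of_nonneg_right this hs]
  calc _ ≤ d * (384 * Real.sqrt κ) + d * (16 * d * Real.sqrt κ) := add_le_add hBe h4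
    _ ≤ _ := by nlinarith

end Fourier

end GKP

/-! ### Assembly of the claims. -/

theorem mainTheorem8 (d : ℕ) (hd : 2 ≤ d) :
    ∃ enc : ∀ κ : Set.Ioo (0 : ℝ) (1 / 4),
        EuclideanSpace ℂ (Fin d) ≃ₗᵢ[ℂ] GKP.symCode hd (κ : ℝ),
      -- comparison of the untruncated code with the truncated one
      (∀ (κ : Set.Ioo (0 : ℝ) (1 / 4)) (W : GKP.L2R ≃ₗᵢ[ℂ] GKP.L2R),
        ∀ U ∈ Matrix.unitaryGroup (Fin d) ℂ,
          GKP.logicalError (enc κ) W U ≤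
            ENNReal.ofReal (5 / 2) * GKP.logicalError (GKP.symEncodingTrunc hd κ.2.1) W U +
              ENNReal.ofReal (20 * (d : ℝ) ^ (3 / 4 : ℝ) * (κ : ℝ) ^ (1 / 4 : ℝ))) ∧
      -- vanishing error on the truncated code implies vanishing error on the untruncated one
      (∀ (W : Set.Ioo (0 : ℝ) (1 / 4) → (GKP.L2R ≃ₗᵢ[ℂ] GKP.L2R)),
        ∀ U ∈ Matrix.unitaryGroup (Fin d) ℂ,
          Filter.Tendsto (fun κ => GKP.logicalError (GKP.symEncodingTrunc hd κ.2.1) (W κ) U)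
            (Filter.comap Subtype.val (nhds (0 : ℝ))) (nhds 0) →
          Filter.Tendsto (fun κ => GKP.logicalError (enc κ) (W κ) U)
            (Filter.comap Subtype.val (nhds (0 : ℝ))) (nhds 0)) ∧
      -- the implementations of `X`, `Z` and `F`
      Filter.Tendsto (fun κ => GKP.logicalError (enc κ)
          (GKP.translation (Real.sqrt (2 * Real.pi / d))) (GKP.gateX d))
        (Filter.comap Subtype.val (nhds (0 : ℝ))) (nhds 0) ∧
      Filter.Tendsto (fun κ => GKP.logicalError (enc κ)
          (GKP.modulation (Real.sqrt (2 * Real.pi / d))) (GKP.gateZ d))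
        (Filter.comap Subtype.val (nhds (0 : ℝ))) (nhds 0) ∧
      Filter.Tendsto (fun κ => GKP.logicalError (enc κ) GKP.fourierUnitary (GKP.gateF d))
        (Filter.comap Subtype.val (nhds (0 : ℝ))) (nhds 0) := by
  have hex (κ : Set.Ioo (0 : ℝ) (1 / 4)) :=
    GKP.exists_symEncoding hd κ.2.1 (κ.2.2.le.trans (by norm_num))
  choose enc henc using hex
  have h1 : ∀ (κ : Set.Ioo (0 : ℝ) (1 / 4)) (W : GKP.L2R ≃ₗᵢ[ℂ] GKP.L2R),
      ∀ U ∈ Matrix.unitaryGroup (Fin d) ℂ, GKP.logicalError (enc κ) W U ≤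
        ENNReal.ofReal (5 / 2) * GKP.logicalError (GKP.symEncodingTrunc hd κ.2.1) W U +
          ENNReal.ofReal (20 * (d : ℝ) ^ (3 / 4 : ℝ) * (κ : ℝ) ^ (1 / 4 : ℝ)) := by
    intro κ W U hU
    have hκ := κ.2.1
    refine (GKP.logicalError_le_add (GKP.symEncodingTrunc hd κ.2.1) (enc κ) W hU
      (by positivity) (henc κ)).trans (add_le_add ?_ ?_)
    -- The comparison holds with factor 1, so 5/2 is slack.
    · refine le_mul_of_one_le_left' ?_
      rw [ENNReal.one_le_ofReal]
      norm_num
    · exact ENNReal.ofReal_le_ofReal (GKP.encoding_error_le hd κ.2.1 κ.2.2.le)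
  have h2 : ∀ (W : Set.Ioo (0 : ℝ) (1 / 4) → (GKP.L2R ≃ₗᵢ[ℂ] GKP.L2R)),
      ∀ U ∈ Matrix.unitaryGroup (Fin d) ℂ,
        Filter.Tendsto (fun κ => GKP.logicalError (GKP.symEncodingTrunc hd κ.2.1) (W κ) U)
          (Filter.comap Subtype.val (nhds (0 : ℝ))) (nhds 0) →
        Filter.Tendsto (fun κ => GKP.logicalError (enc κ) (W κ) U)
          (Filter.comap Subtype.val (nhds (0 : ℝ))) (nhds 0) := by
    intro W U hU h
    have h3 : Filter.Tendsto (fun κ : Set.Ioo (0 : ℝ) (1 / 4) =>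
        ENNReal.ofReal (20 * (d : ℝ) ^ (3 / 4 : ℝ) * (κ : ℝ) ^ (1 / 4 : ℝ)))
        (Filter.comap Subtype.val (nhds (0 : ℝ))) (nhds 0) := by
      -- The bound is continuous on all of ℝ and vanishes at κ = 0, so its limit pulls back to the
      -- subtype.
      have h4 : Continuous fun κ : ℝ =>
          ENNReal.ofReal (20 * (d : ℝ) ^ (3 / 4 : ℝ) * κ ^ (1 / 4 : ℝ)) :=
        ENNReal.continuous_ofReal.comp
          (continuous_const.mul (Real.continuous_rpow_const (by norm_num)))
      have h5 := (h4.tendsto 0).comp (Filter.tendsto_comap (f := (Subtype.val :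
        Set.Ioo (0 : ℝ) (1 / 4) → ℝ)))
      rw [Real.zero_rpow (by norm_num), mul_zero, ENNReal.ofReal_zero] at h5
      exact h5
    have h6 := (ENNReal.Tendsto.const_mul (a := ENNReal.ofReal (5 / 2)) h
      (Or.inr ENNReal.ofReal_ne_top)).add h3
    rw [mul_zero, add_zero] at h6
    exact tendsto_of_tendsto_of_tendsto_of_le_of_le tendsto_const_nhds h6 (fun _ => bot_le)
      fun κ => h1 κ (W κ) U hU
  refine ⟨enc, h1, h2, h2 (fun _ => _) _ (GKP.gateX_mem hd) ?_,
    h2 (fun _ => _) _ (GKP.gateZ_mem d) ?_, h2 (fun _ => _) _ (GKP.gateF_mem hd) ?_⟩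
  · exact GKP.tendsto_logicalError_trunc hd _ (GKP.gateX_mem hd) norm_one fun κ hκ hκ1 j =>
      GKP.gateX_error hd hκ hκ1 (GKP.norm_peakL2 (GKP.symWidth_pos hd hκ)) j
  · exact GKP.tendsto_logicalError_trunc hd _ (GKP.gateZ_mem d) norm_one fun κ hκ hκ1 j =>
      GKP.gateZ_error hd hκ (by linarith) j
  · exact GKP.tendsto_logicalError_trunc hd _ (GKP.gateF_mem hd) GKP.norm_fourierPhase
      fun κ hκ hκ1 j => GKP.gateF_error hd hκ hκ1 j

end
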